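/- Let $k$ be a field of characteristic $0$, let $Q$ be a finite quiver with vertex set $Q_0$, arrow set $Q_1$ and source and target maps $s,t$ (loops and oriented cycles are allowed; paths are composed from right to left, so that $a=e_{t(a)}\,a\,e_{s(a)}$), and let $W\in kQ/[kQ,kQ]$ be a potential, with cyclic derivatives determined by $\partial (a_n\cdots a_1)/\partial a=\sum_{j:\,a_j=a}a_{j-1}\cdots a_1a_n\cdots a_{j+1}$ for a cycle $a_n\cdots a_1$. Let $R=k^{Q_0}$, spanned by the constant paths $e_i$. Let $\overline Q$ be the double quiver, with arrows $a$ of degree $0$ and reversed arrows $a^*:t(a)\to s(a)$ of degree $-1$ for $a\in Q_1$, and let $\widehat Q$ be $\overline Q$ together with a loop $t_i$ of degree $-2$ at each vertex $i$. Let $\Gamma_{Q,W}$ be the graded path algebra $k\widehat Q$ with the $R$-linear super-derivation $d$ of degree $1$ given by $$d a=0,\qquad d a^*=\partial W/\partial a,\qquad d t_i=e_i\Big(\sum_{a\in Q_1}[a,a^*]\Big)e_i .$$ Notation. For a graded $R$-algebra $A$ (with $R$ in degree $0$) let $\Omega^1_RA=\ker(A\otimes_RA\to A)$, $D(a)=a\otimes1-1\otimes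 a$, $\Omega_R^\bullet A=T_A(\Omega^1_RA)$, and $\mathrm{DR}_R(A)=\Omega_R^\bullet A/[\Omega_R^\bullet A,\Omega_R^\bullet A]$. These are bigraded by form degree and internal degree, and signs follow the Koszul rule for both degrees: exchanging elements of bidegrees $(p,m)$ and $(q,n)$ costs $(-1)^{pq+mn}$. $\mathrm{Der}_R(A)$ and $\mathbb D\mathrm{er}_R(A)$ are the graded spaces of super-derivations $A\to A$ and $A\to A\otimes_kA$ (outer bimodule structure) that vanish on $R$. For $\theta\in\mathrm{Der}_R(A)$, $i_\theta$ is the contraction ($a\mapsto0$, $D(a)\mapsto\theta(a)$) and $L_\theta$ the Lie derivative ($a\mapsto\theta(a)$, $D(a)\mapsto D(\theta(a))$), extended as super-derivations; for $\lambda\in\mathbb D\mathrm{er}_R(A)$, $\iota_\lambda=m\circ\beta\circ i_\lambda$, where $i_\lambda:\Omega^\bullet_RA\to\Omega^\bullet_RA\otimes\Omega^\bullet_RA$ is the double super-derivation with $a\mapsto0$, $D(a)\mapsto\lambda(a)$, $\beta$ is the signed flip and $m$ the multiplication; these maps descend to $\mathrm{DR}_R(A)$. A closed $\omega\in\mathrm{DR}^2_R(A)$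 is bisymplectic if $\lambda\mapsto\iota_\lambda(\omega)$ is an isomorphism $\mathbb D\mathrm{er}_R(A)\to\Omega^1_RA$, and symplectic if $\theta\mapsto i_\theta(\omega)$ is an isomorphism $\mathrm{Der}_R(A)\to\mathrm{DR}^1_R(A)$; in the latter case $\{W,-\}_\omega$ is the $\theta$ with $i_\theta(\omega)=D(W)$. With $\delta(a)=\sum_i(ae_i\otimes e_i-e_i\otimes e_ia)$, an element $\mathbf w\in A$ represents $\mu_{\mathrm{nc}}(\omega)\in(A/R)^R$ if its class in $A/R$ commutes with $R$ and is the unique class with $D(\mathbf w)=\iota_\delta(\omega)$. Claim. Let $A=k\overline Q$, $\omega=\sum_{a\in Q_1}D(a^*)D(a)\in\mathrm{DR}^2_R(A)$ and $\mathbf w=\sum_{a\in Q_1}[a,a^*]$. There is a super-derivation $\xi\in\mathrm{Der}_R(A)$ of degree $1$ such that: 1. $A$ is non-positively graded, finitely generated over $k$, $\Omega^1_RA$ is a projective $A$-bimodule, and it is generated as an $A$-bimodule by homogeneous elements of degrees $0$ and $-1$; 2. $\omega$ is closed, homogeneous of internal degree $-1$, bisymplectic and symplectic; 3. $\xi=\{W,-\}_\omega$,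 and explicitly $\xi(a)=0$ and $\xi(a^*)=\partial W/\partial a$ for all $a\in Q_1$; 4. $\mathbf w$ is homogeneous of degree $-1$ and represents $\mu_{\mathrm{nc}}(\omega)$; 5. $\xi^2=0$, $L_\xi(\omega)=0$ in $\mathrm{DR}_R(A)$, and $\xi(\mathbf w)=0$; 6. $d^2=0$, and $\Gamma_{Q,W}$ is isomorphic, as a dg $R$-algebra, to the free product $A*_RR[t]$ with $t$ in degree $-2$ and with the differential given by $a\mapsto\xi(a)$ for $a\in A$ and $t\mapsto\mathbf w$; the isomorphism identifies the arrows $a$, $a^*$ of the two sides and sends $t$ to $\sum_{i\in Q_0}t_i$. That is, $\Gamma_{Q,W}$ is the relative Ginzburg dg algebra $\mathfrak D(A,\omega,\xi)$. -/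

import Mathlib

open scoped TensorProduct DirectSum

noncomputable section

namespace NCForms

universe u v w

/-! ### Graded algebras over `R = kI` -/

/-- A `ℤ`-graded `R`-algebra, where `R = I → k` is the algebra of `k`-valued functions on `I`:
a `k`-algebra `A` with an algebra homomorphism `R → A` (whose image need not be central) and a
grading for which the image of `R` lies in degree `0`. -/
class GrAlg (k : Type u) (I : Type v) (A : Type w) [Field k] [Ring A] [Algebra k A] where
  str : (I → k) →ₐ[k] A
  deg : ℤ → Submodule k A
  [graded : GradedAlgebra deg]
  str_mem : ∀ r, str r ∈ deg 0

attribute [reducible, instance] GrAlg.graded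

section General

variable (k : Type u) (I : Type v) (A : Type w) [Field k] [Ring A] [Algebra k A] [GrAlg k I A]

/-- The structure map `R → A`. -/
abbrev str : (I → k) →ₐ[k] A := GrAlg.str

/-- The homogeneous components of `A`. -/
abbrev deg : ℤ → Submodule k A := GrAlg.deg I

/-- The algebra automorphism of `A` that is multiplication by `(-1) ^ (n * m)` in degree `m`. -/
def twist (n : ℤ) : A →ₐ[k] A :=
  (DirectSum.toAlgebra k (fun m => deg k I A m)
    (fun m => ((-1 : k) ^ (n * m)) • (deg k I A m).subtype)
    (by simp)
    (by
      intro i j a b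
      simp [mul_add, zpow_add₀, smul_smul, mul_comm])).comp
    (DirectSum.decomposeAlgEquiv (deg k I A)).toAlgHom

variable {k I A}

theorem twist_of_mem (n : ℤ) {m : ℤ} {a : A} (ha : a ∈ deg k I A m) :
    twist k I A n a = ((-1 : k) ^ (n * m)) • a := by
  have h : DirectSum.decompose (deg k I A) a = DirectSum.of (fun m => deg k I A m) m ⟨a, ha⟩ :=
    DirectSum.decompose_of_mem _ ha
  simp only [twist, AlgHom.comp_apply]
  erw [DirectSum.decomposeAlgEquiv_apply, h]
  exact DirectSum.toAddMonoid_of (β := fun m => deg k I A m)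
    (fun m => (((-1 : k) ^ (n * m)) • (deg k I A m).subtype).toAddMonoidHom) m ⟨a, ha⟩

theorem twist_str (n : ℤ) (r : I → k) : twist k I A n (str k I A r) = str k I A r := by
  rw [twist_of_mem n (GrAlg.str_mem r)]; simp

theorem twist_ext {n : ℤ} {f : A →ₐ[k] A}
    (h : ∀ m, ∀ a ∈ deg k I A m, f a = ((-1 : k) ^ (n * m)) • a) : f = twist k I A n := by
  ext a
  induction a using DirectSum.Decomposition.inductionOn (deg k I A) with
  | zero => simp
  | homogeneous a => rw [h _ _ a.2, twist_of_mem n a.2]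
  | add a b ha hb => simp [ha, hb]

theorem twist_even {n : ℤ} (hn : Even n) : twist k I A n = AlgHom.id k A :=
  (twist_ext fun m a _ => by simp [(hn.mul_right m).neg_one_zpow]).symm

theorem twist_odd {n : ℤ} (hn : Odd n) : twist k I A n = twist k I A 1 :=
  (twist_ext fun m a ha => by
    rw [twist_of_mem 1 ha, one_mul, zpow_mul, hn.neg_one_zpow]).symm

theorem twist_one_twist_one (a : A) : twist k I A 1 (twist k I A 1 a) = a := by
  have : (twist k I A 1).comp (twist k I A 1) = twist k I A 0 := twist_ext fun m a ha => by
    rw [AlgHom.comp_apply, twist_of_mem 1 ha, map_smul, twist_of_mem 1 ha, smul_smul,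
      ← zpow_add₀ (by simp), zero_mul, one_mul, Even.neg_one_zpow (⟨m, rfl⟩ : Even (m + m)), zpow_zero]
  rw [twist_even (n := 0) (by simp)] at this
  exact DFunLike.congr_fun this a

variable (k I A)

/-! ### Relative one-forms -/

/-- The enveloping algebra `A ⊗ Aᵒᵖ`; its left modules are the `A`-bimodules.  Acting on itself by
left multiplication it is `A ⊗ A` with the outer bimodule structure. -/
abbrev Env (k : Type u) (A : Type w) [Field k] [Ring A] [Algebra k A] : Type w := A ⊗[k] Aᵐᵒᵖ

/-- The sub-bimodule of `A ⊗ A` generated by the elements `r ⊗ 1 - 1 ⊗ r`, `r ∈ R`. -/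
def relSub : Submodule (Env k A) (Env k A) :=
  Submodule.span _ (Set.range fun r : I → k =>
    (str k I A r) ⊗ₜ[k] (1 : Aᵐᵒᵖ) - (1 : A) ⊗ₜ[k] MulOpposite.op (str k I A r))

/-- The `A`-bimodule `A ⊗_R A`. -/
abbrev TenR : Type w := Env k A ⧸ relSub k I A

/-- `A` as a bimodule over itself. -/
local instance : Module (Env k A) A := instModuleTensorProductMop k A

theorem env_smul (a b x : A) : (a ⊗ₜ[k] MulOpposite.op b : Env k A) • x = a * x * b := by
  change TensorProduct.Algebra.moduleAux _ _ = _
  simp [TensorProduct.Algebra.moduleAux, ← mul_assoc]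

/-- The multiplication `A ⊗_R A → A`, `a ⊗ b ↦ a b`. -/
def mulR : TenR k I A →ₗ[Env k A] A :=
  (relSub k I A).liftQ (LinearMap.toSpanSingleton (Env k A) A 1) (by
    rw [relSub, Submodule.span_le]
    rintro _ ⟨r, rfl⟩
    have h1 := env_smul k A (str k I A r) 1 1
    have h2 := env_smul k A 1 (str k I A r) 1
    simp only [MulOpposite.op_one] at h1
    simp [sub_smul, h1, h2])

/-- The bimodule of relative one-forms `Ω¹_R A = Ker (A ⊗_R A → A)`. -/
def Omega1 : Submodule (Env k A) (TenR k I A) := LinearMap.ker (mulR k I A)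

instance : AddCommGroup (Omega1 k I A) := inferInstance
instance : Module (Env k A) (Omega1 k I A) := inferInstance
instance : Module k (Omega1 k I A) := inferInstance

variable {k A} in
/-- The class of `a ⊗ b` in `A ⊗_R A`. -/
def tmulR (a b : A) : TenR k I A := (relSub k I A).mkQ (a ⊗ₜ[k] MulOpposite.op b)

theorem mulR_tmulR (a b : A) : mulR k I A (tmulR I a b) = a * b := by
  have := env_smul k A a b 1
  simpa [mulR, tmulR] using this

theorem tmulR_add_left (a a' b : A) : tmulR (k := k) I (a + a') b = tmulR I a b + tmulR I a' b := by
  simp [tmulR, TensorProduct.add_tmul]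

theorem smul_tmulR (a b x y : A) :
    (a ⊗ₜ[k] MulOpposite.op b : Env k A) • tmulR (k := k) I x y = tmulR I (a * x) (y * b) := by
  simp only [tmulR, ← map_smul, smul_eq_mul, Algebra.TensorProduct.tmul_mul_tmul,
    MulOpposite.op_mul]

theorem tmulR_str (a b : A) (r : I → k) :
    tmulR (k := k) I (a * str k I A r) b = tmulR I a (str k I A r * b) := by
  rw [← sub_eq_zero]
  have h : ((relSub k I A).mkQ ((a ⊗ₜ[k] MulOpposite.op b : Env k A) •
      ((str k I A r) ⊗ₜ[k] (1 : Aᵐᵒᵖ) - (1 : A) ⊗ₜ[k] MulOpposite.op (str k I A r)))) = 0 := by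
    rw [map_smul]
    have : (relSub k I A).mkQ
      ((str k I A r) ⊗ₜ[k] (1 : Aᵐᵒᵖ) - (1 : A) ⊗ₜ[k] MulOpposite.op (str k I A r)) = 0 :=
      (Submodule.Quotient.mk_eq_zero _).2 (Submodule.subset_span ⟨r, rfl⟩)
    rw [this, smul_zero]
  simpa [tmulR, mul_sub] using h

/-- The universal derivation `D a = a ⊗ 1 - 1 ⊗ a`, with values in `Ω¹_R A`. -/
def dOne : A →ₗ[k] Omega1 k I A where
  toFun a := ⟨tmulR I a 1 - tmulR I 1 a, by
    simp [Omega1, LinearMap.mem_ker, map_sub, mulR_tmulR]⟩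
  map_add' a b := by
    ext
    simp [tmulR, TensorProduct.add_tmul, TensorProduct.tmul_add]
    abel
  map_smul' c a := by
    ext
    have : ∀ x : Env k A, (relSub k I A).mkQ (c • x) = c • (relSub k I A).mkQ x := fun _ => rfl
    simp only [tmulR, MulOpposite.op_smul, TensorProduct.tmul_smul, ← TensorProduct.smul_tmul',
      this, RingHom.id_apply, ← smul_sub]
    rfl

theorem dOne_str (r : I → k) : dOne k I A (str k I A r) = 0 := by
  ext
  have := tmulR_str k I A 1 1 r
  simp only [one_mul, mul_one] at this
  simp [dOne, this]

theorem dOne_mul (a b : A) : dOne k I A (a * b) =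
    ((1 : A) ⊗ₜ[k] MulOpposite.op b : Env k A) • dOne k I A a +
      (a ⊗ₜ[k] (1 : Aᵐᵒᵖ) : Env k A) • dOne k I A b := by
  ext
  have h := smul_tmulR k I A a 1
  simp only [MulOpposite.op_one] at h
  simp [dOne, smul_sub, smul_tmulR, h]

/-- A one-form `∑ a ⊗ b` (with `∑ a b = 0`) equals `∑ (D a) b`. -/
theorem omega1_induction {p : Omega1 k I A → Prop}
    (add : ∀ x y, p x → p y → p (x + y)) (zero : p 0)
    (mem : ∀ a b, p (((1 : A) ⊗ₜ[k] MulOpposite.op b : Env k A) • dOne k I A a)) (x) : p x := by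
  obtain ⟨x, hx⟩ := x
  obtain ⟨t, rfl⟩ := (relSub k I A).mkQ_surjective x
  have key : ∀ t : Env k A, ∃ (y : Omega1 k I A) (c : A), p y ∧
      (relSub k I A).mkQ t = (y : TenR k I A) + tmulR I 1 c := by
    intro t
    induction t using TensorProduct.induction_on with
    | zero => exact ⟨0, 0, zero, by simp [tmulR]⟩
    | tmul a b =>
      refine ⟨_, a * b.unop, mem a b.unop, ?_⟩
      simp only [dOne, LinearMap.coe_mk, AddHom.coe_mk, SetLike.val_smul, smul_sub, smul_tmulR]
      simp [tmulR]
    | add t t' h h' =>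
      obtain ⟨y, c, hy, h⟩ := h
      obtain ⟨y', c', hy', h'⟩ := h'
      refine ⟨y + y', c + c', add _ _ hy hy', ?_⟩
      rw [map_add, h, h']
      simp [tmulR, TensorProduct.tmul_add]
      abel
  obtain ⟨y, c, hy, h⟩ := key t
  have hc : c = 0 := by
    have h1 : mulR k I A ((relSub k I A).mkQ t) = 0 := hx
    have h2 : mulR k I A (y : TenR k I A) = 0 := y.2
    rw [h, map_add, h2, mulR_tmulR] at h1
    simpa using h1
  subst hc
  convert hy
  rw [h]
  simp [tmulR]

/-! ### The tensor algebra of a bimodule -/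

section TensorAlg

variable (M : Type w) [AddCommGroup M] [Module k M] [Module (Env k A) M]

/-- The relations that define `T_A(M)` as a quotient of the tensor algebra of the `k`-module
`A ⊕ M`. -/
inductive BimodTA.Rel : TensorAlgebra k (A × M) → TensorAlgebra k (A × M) → Prop
  | one : Rel (TensorAlgebra.ι k (1, 0)) 1
  | mul (a b : A) : Rel (TensorAlgebra.ι k (a * b, 0))
      (TensorAlgebra.ι k (a, 0) * TensorAlgebra.ι k (b, 0))
  | bimod (a b : A) (m : M) : Rel (TensorAlgebra.ι k (0, (a ⊗ₜ[k] MulOpposite.op b : Env k A) • m))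
      (TensorAlgebra.ι k (a, 0) * TensorAlgebra.ι k (0, m) * TensorAlgebra.ι k (b, 0))

/-- The tensor algebra `T_A(M)` of an `A`-bimodule `M`: the universal algebra that receives an
algebra homomorphism from `A` and a bimodule homomorphism from `M`. -/
def BimodTA : Type (max u w) := RingQuot (BimodTA.Rel k A M)

instance : Ring (BimodTA k A M) := inferInstanceAs (Ring (RingQuot _))
instance : Algebra k (BimodTA k A M) := inferInstanceAs (Algebra k (RingQuot _))

namespace BimodTA

/-- The projection from the tensor algebra of `A ⊕ M`. -/
def proj : TensorAlgebra k (A × M) →ₐ[k] BimodTA k A M := RingQuot.mkAlgHom k (Rel k A M)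

theorem proj_rel {x y : TensorAlgebra k (A × M)} (h : Rel k A M x y) :
    proj k A M x = proj k A M y := RingQuot.mkAlgHom_rel k h

/-- The inclusion `A = T_A⁰(M) → T_A(M)`. -/
def inA : A →ₐ[k] BimodTA k A M :=
  AlgHom.ofLinearMap
    ((proj k A M).toLinearMap ∘ₗ TensorAlgebra.ι k ∘ₗ LinearMap.inl k A M)
    (by simpa using proj_rel k A M Rel.one)
    (fun a b => by simpa using proj_rel k A M (Rel.mul a b))

/-- The inclusion `M = T_A¹(M) → T_A(M)`. -/
def inM : M →ₗ[k] BimodTA k A M :=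
  (proj k A M).toLinearMap ∘ₗ TensorAlgebra.ι k ∘ₗ LinearMap.inr k A M

theorem inM_smul (a b : A) (m : M) : inM k A M ((a ⊗ₜ[k] MulOpposite.op b : Env k A) • m) =
    inA k A M a * inM k A M m * inA k A M b := by
  simpa [inM, inA] using proj_rel k A M (Rel.bimod a b m)

variable {k A M} in
/-- The universal property of `T_A(M)`. -/
def lift {B : Type*} [Ring B] [Algebra k B] (f : A →ₐ[k] B) (g : M →ₗ[k] B)
    (h : ∀ a b m, g ((a ⊗ₜ[k] MulOpposite.op b : Env k A) • m) = f a * g m * f b) :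
    BimodTA k A M →ₐ[k] B :=
  RingQuot.liftAlgHom k ⟨TensorAlgebra.lift k (f.toLinearMap.coprod g), by
    rintro _ _ (_ | ⟨a, b⟩ | ⟨a, b, m⟩)
    · simp
    · simp
    · simp [h]⟩

variable {k A M} in
theorem lift_inA {B : Type*} [Ring B] [Algebra k B] (f : A →ₐ[k] B) (g : M →ₗ[k] B)
    (h : ∀ a b m, g ((a ⊗ₜ[k] MulOpposite.op b : Env k A) • m) = f a * g m * f b) (a : A) :
    lift f g h (inA k A M a) = f a := by
  simp only [lift, inA, proj, AlgHom.ofLinearMap_apply, LinearMap.comp_apply]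
  erw [RingQuot.liftAlgHom_mkAlgHom_apply]
  simp

variable {k A M} in
theorem lift_inM {B : Type*} [Ring B] [Algebra k B] (f : A →ₐ[k] B) (g : M →ₗ[k] B)
    (h : ∀ a b m, g ((a ⊗ₜ[k] MulOpposite.op b : Env k A) • m) = f a * g m * f b) (m : M) :
    lift f g h (inM k A M m) = g m := by
  simp only [lift, inM, proj, LinearMap.comp_apply]
  erw [RingQuot.liftAlgHom_mkAlgHom_apply]
  simp

variable {k A M} in
theorem hom_ext {B : Type*} [Ring B] [Algebra k B] {f g : BimodTA k A M →ₐ[k] B}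
    (hA : ∀ a, f (inA k A M a) = g (inA k A M a))
    (hM : ∀ m, f (inM k A M m) = g (inM k A M m)) : f = g := by
  refine RingQuot.ringQuot_ext' k f g (TensorAlgebra.hom_ext (LinearMap.prod_ext ?_ ?_))
  · exact LinearMap.ext fun a => hA a
  · exact LinearMap.ext fun a => hM a

end BimodTA

end TensorAlg


/-! ### Noncommutative differential forms -/

/-- The algebra of relative noncommutative differential forms `Ω_R A = T_A(Ω¹_R A)`. -/
def Omega : Type (max u w) := BimodTA k A (Omega1 k I A)

instance : Ring (Omega k I A) := inferInstanceAs (Ring (BimodTA k A (Omega1 k I A)))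
instance : Algebra k (Omega k I A) := inferInstanceAs (Algebra k (BimodTA k A (Omega1 k I A)))

namespace Omega

/-- The inclusion of `A = Ω⁰_R A`. -/
def inA : A →ₐ[k] Omega k I A := BimodTA.inA k A _

/-- The inclusion of `Ω¹_R A`. -/
def inOne : Omega1 k I A →ₗ[k] Omega k I A := BimodTA.inM k A _

/-- `a ↦ D a`, as a map from `A` to `Ω_R A`. -/
def dA : A →ₗ[k] Omega k I A := inOne k I A ∘ₗ dOne k I A

theorem dA_str (r : I → k) : dA k I A (str k I A r) = 0 := by
  simp [dA, dOne_str]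

theorem dA_mul (a b : A) :
    dA k I A (a * b) = dA k I A a * inA k I A b + inA k I A a * dA k I A b := by
  have h1 := BimodTA.inM_smul k A (Omega1 k I A) 1 b (dOne k I A a)
  have h2 := BimodTA.inM_smul k A (Omega1 k I A) a 1 (dOne k I A b)
  simp only [MulOpposite.op_one, map_one, one_mul, mul_one] at h1 h2
  change BimodTA.inM k A _ (dOne k I A (a * b)) = _
  rw [dOne_mul, map_add, h1, h2]
  rfl

theorem inOne_smul_dOne (a b : A) :
    inOne k I A (((1 : A) ⊗ₜ[k] MulOpposite.op b : Env k A) • dOne k I A a) =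
      dA k I A a * inA k I A b := by
  have h1 := BimodTA.inM_smul k A (Omega1 k I A) 1 b (dOne k I A a)
  rwa [map_one, one_mul] at h1

section Lift

variable {k I A} {C : Type*} [Ring C] [Algebra k C] (F : A →ₐ[k] C) (G : A →ₗ[k] C)
  (hG : ∀ a b, G (a * b) = G a * F b + F a * G b) (hR : ∀ r, G (str k I A r) = 0)

/-- The linear map `A ⊗ A → C`, `a ⊗ b ↦ G a * F b`. -/
def liftAux : Env k A →ₗ[k] C :=
  TensorProduct.lift ((LinearMap.mul k C).compl₁₂ G
    (F.toLinearMap ∘ₗ (MulOpposite.opLinearEquiv k).symm.toLinearMap))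

theorem liftAux_tmul (a b : A) :
    liftAux F G (a ⊗ₜ[k] MulOpposite.op b) = G a * F b := by
  simp [liftAux]

theorem liftAux_relSub (hG : ∀ a b, G (a * b) = G a * F b + F a * G b)
    (hR : ∀ r, G (str k I A r) = 0) (x : Env k A) (hx : x ∈ relSub k I A) : liftAux F G x = 0 := by
  suffices h : ∀ t : Env k A, liftAux F G (t • x) = 0 by simpa using h 1
  refine Submodule.span_induction ?_ ?_ ?_ ?_ hx
  · rintro _ ⟨r, rfl⟩ t
    induction t using TensorProduct.induction_on with
    | zero => simp
    | tmul a b =>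
      induction b using MulOpposite.rec' with
      | _ b =>
      have h1 := liftAux_tmul F G (a * str k I A r) b
      have h2 := liftAux_tmul F G a (str k I A r * b)
      rw [MulOpposite.op_mul] at h2
      simp only [smul_eq_mul, mul_sub, Algebra.TensorProduct.tmul_mul_tmul, mul_one, map_sub,
        h1, h2, hG, hR, map_mul]
      simp [mul_assoc]
    | add t t' h h' => simp only [add_smul, map_add, h, h', add_zero]
  · simp
  · intro x y _ _ hx hy t
    simp only [smul_add, map_add, hx, hy, add_zero]
  · intro a x _ hx t
    rw [smul_smul]
    exact hx _

/-- The linear map `Ω¹_R A → C` with `(D a) b ↦ G a * F b`. -/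
def liftOne : Omega1 k I A →ₗ[k] C :=
  (((relSub k I A).restrictScalars k).liftQ (liftAux F G) (liftAux_relSub F G hG hR)) ∘ₗ
    (Submodule.Quotient.restrictScalarsEquiv k (relSub k I A)).symm.toLinearMap ∘ₗ
    ((Omega1 k I A).subtype.restrictScalars k)

theorem liftOne_of (x : Omega1 k I A) (t : Env k A) (h : (x : TenR k I A) = (relSub k I A).mkQ t) :
    liftOne F G hG hR x = liftAux F G t := by
  simp only [liftOne, LinearMap.comp_apply, LinearMap.restrictScalars_apply, Submodule.subtype_apply,
    h]
  rfl

theorem liftOne_smul (a b x : A) :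
    liftOne F G hG hR ((a ⊗ₜ[k] MulOpposite.op b : Env k A) • dOne k I A x) = F a * G x * F b := by
  rw [liftOne_of F G hG hR _ ((a * x) ⊗ₜ MulOpposite.op b - a ⊗ₜ MulOpposite.op (x * b))]
  · rw [map_sub, liftAux_tmul, liftAux_tmul, hG, map_mul]
    noncomm_ring
  · simp only [dOne, LinearMap.coe_mk, AddHom.coe_mk, SetLike.val_smul, smul_sub, smul_tmulR]
    simp [tmulR]

/-- The universal property of `Ω_R A`: an algebra homomorphism `F` from `A` and an `R`-linear
derivation `G` along `F` extend to an algebra homomorphism with `D a ↦ G a`. -/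
def lift : Omega k I A →ₐ[k] C :=
  BimodTA.lift F (liftOne F G hG hR) (by
    intro a b m
    induction m using omega1_induction with
    | add x y hx hy => simp only [smul_add, map_add, hx, hy, mul_add, add_mul]
    | zero => simp
    | mem x y =>
      have e := (mul_smul (a ⊗ₜ[k] MulOpposite.op b : Env k A)
        ((1 : A) ⊗ₜ[k] MulOpposite.op y : Env k A) (dOne k I A x)).symm
      refine (congrArg (liftOne F G hG hR) e).trans ?_
      rw [Algebra.TensorProduct.tmul_mul_tmul, ← MulOpposite.op_mul, liftOne_smul, liftOne_smul]
      simp [mul_assoc])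

@[simp]
theorem lift_inA (a : A) : lift F G hG hR (inA k I A a) = F a := BimodTA.lift_inA _ _ _ _

@[simp]
theorem lift_dA (a : A) : lift F G hG hR (dA k I A a) = G a := by
  have h := liftOne_smul F G hG hR 1 1 a
  rw [MulOpposite.op_one, ← Algebra.TensorProduct.one_def, one_smul] at h
  refine (BimodTA.lift_inM _ _ _ _).trans (h.trans ?_)
  simp

theorem hom_ext {f g : Omega k I A →ₐ[k] C} (h0 : ∀ a, f (inA k I A a) = g (inA k I A a))
    (h1 : ∀ a, f (dA k I A a) = g (dA k I A a)) : f = g := by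
  refine BimodTA.hom_ext h0 fun m => ?_
  change f (inOne k I A m) = g (inOne k I A m)
  induction m using omega1_induction with
  | add x y hx hy => simp only [map_add, hx, hy]
  | zero => simp
  | mem a b =>
    rw [inOne_smul_dOne, map_mul, map_mul, h0, h1]

end Lift

variable {k I A} in
theorem induction {p : Omega k I A → Prop} (h0 : ∀ a, p (inA k I A a)) (h1 : ∀ a, p (dA k I A a))
    (add : ∀ x y, p x → p y → p (x + y)) (mul : ∀ x y, p x → p y → p (x * y)) (x) : p x := by
  let S : Subalgebra k (Omega k I A) :=
    { carrier := {x | p x}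
      add_mem' := fun hx hy => add _ _ hx hy
      mul_mem' := fun hx hy => mul _ _ hx hy
      algebraMap_mem' := fun r => by
        have := h0 (algebraMap k A r)
        rwa [AlgHom.commutes] at this }
  let F : A →ₐ[k] S := (inA k I A).codRestrict S h0
  let G : A →ₗ[k] S := (dA k I A).codRestrict (Subalgebra.toSubmodule S) h1
  let L : Omega k I A →ₐ[k] S := lift F G
    (fun a b => Subtype.ext (dA_mul k I A a b)) (fun r => Subtype.ext (dA_str k I A r))
  have : S.val.comp L = AlgHom.id k _ := by
    refine hom_ext (fun a => ?_) (fun a => ?_)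
    · simp [L, F]
    · simp [L]; rfl
  have hx := DFunLike.congr_fun this x
  simp only [AlgHom.comp_apply, AlgHom.id_apply] at hx
  rw [← hx]
  exact (L x).2

/-! ### Derivations of the algebra of forms -/

section Der

variable {k I A} {B : Type*} [Ring B] [Algebra k B] (f g : Omega k I A →ₐ[k] B)
  (d0 d1 : A →ₗ[k] B)

/-- `a ↦ !![p a, q a; 0, r a]`. -/
def triLin {X : Type*} [AddCommGroup X] [Module k X] (p q r : X →ₗ[k] B) :
    X →ₗ[k] Matrix (Fin 2) (Fin 2) B where
  toFun x := !![p x, q x; 0, r x]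
  map_add' x y := by
    ext i j
    fin_cases i <;> fin_cases j <;> simp
  map_smul' c x := by
    ext i j
    fin_cases i <;> fin_cases j <;> simp

/-- `a ↦ !![p a, q a; 0, r a]` as an algebra homomorphism, for a derivation `q` along `p`, `r`. -/
def triAlg {X : Type*} [Ring X] [Algebra k X] (p r : X →ₐ[k] B) (q : X →ₗ[k] B)
    (hq : ∀ a b, q (a * b) = q a * r b + p a * q b) : X →ₐ[k] Matrix (Fin 2) (Fin 2) B :=
  AlgHom.ofLinearMap (triLin p.toLinearMap q r.toLinearMap)
    (by
      have h1 : q 1 = 0 := by simpa using hq 1 1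
      ext i j
      fin_cases i <;> fin_cases j <;> simp [triLin, h1])
    (by
      intro a b
      ext i j
      fin_cases i <;> fin_cases j <;> simp [triLin, hq, Matrix.mul_apply, Fin.sum_univ_two, add_comm])

variable (h0 : ∀ a b, d0 (a * b) = d0 a * g (inA k I A b) + f (inA k I A a) * d0 b)
  (h1 : ∀ a b, d1 (a * b) = d1 a * g (inA k I A b) + f (dA k I A a) * d0 b +
    d0 a * g (dA k I A b) + f (inA k I A a) * d1 b)
  (hR : ∀ r, d1 (str k I A r) = 0)

/-- The matrix homomorphism `x ↦ !![f x, d x; 0, g x]` that defines the derivation below. -/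
def derMat : Omega k I A →ₐ[k] Matrix (Fin 2) (Fin 2) B :=
  lift (triAlg (f.comp (inA k I A)) (g.comp (inA k I A)) d0 h0)
    (triLin (f.toLinearMap ∘ₗ dA k I A) d1 (g.toLinearMap ∘ₗ dA k I A))
    (by
      intro a b
      ext i j
      fin_cases i <;> fin_cases j <;>
        simp [triLin, triAlg, h1, dA_mul]
      abel)
    (by
      intro r
      ext i j
      fin_cases i <;> fin_cases j <;> simp [triLin, hR, dA_str])

/-- The unique linear map `d : Ω_R A → B` with `d (x y) = d x * g y + f x * d y` that is given by
`d0` on `A` and sends `D a` to `d1 a`. -/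
def der : Omega k I A →ₗ[k] B :=
  (Matrix.entryLinearMap k B (0 : Fin 2) (1 : Fin 2)) ∘ₗ (derMat f g d0 d1 h0 h1 hR).toLinearMap

theorem derMat_apply (x : Omega k I A) :
    derMat f g d0 d1 h0 h1 hR x = !![f x, der f g d0 d1 h0 h1 hR x; 0, g x] := by
  have key : ∀ x, derMat f g d0 d1 h0 h1 hR x 0 0 = f x ∧ derMat f g d0 d1 h0 h1 hR x 1 0 = 0 ∧
      derMat f g d0 d1 h0 h1 hR x 1 1 = g x := by
    intro x
    induction x using Omega.induction with
    | h0 a => simp [derMat, triAlg, triLin]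
    | h1 a => simp [derMat, triLin]
    | add x y hx hy => simp [hx, hy]
    | mul x y hx hy => simp [hx, hy, Matrix.mul_apply, Fin.sum_univ_two]
  obtain ⟨k1, k2, k3⟩ := key x
  ext i j
  fin_cases i <;> fin_cases j <;> simp [k1, k2, k3, der]

@[simp]
theorem der_inA (a : A) : der f g d0 d1 h0 h1 hR (inA k I A a) = d0 a := by
  simp [der, derMat, triAlg, triLin]

@[simp]
theorem der_dA (a : A) : der f g d0 d1 h0 h1 hR (dA k I A a) = d1 a := by
  simp [der, derMat, triLin]

theorem der_mul (x y : Omega k I A) : der f g d0 d1 h0 h1 hR (x * y) =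
    der f g d0 d1 h0 h1 hR x * g y + f x * der f g d0 d1 h0 h1 hR y := by
  have h := map_mul (derMat f g d0 d1 h0 h1 hR) x y
  have h' := congrFun (congrFun h 0) 1
  simp only [derMat_apply] at h'
  simpa [Matrix.mul_apply, Fin.sum_univ_two, add_comm] using h'

theorem der_unique {f g : Omega k I A →ₐ[k] B} {d d' : Omega k I A →ₗ[k] B}
    (hd : ∀ x y, d (x * y) = d x * g y + f x * d y)
    (hd' : ∀ x y, d' (x * y) = d' x * g y + f x * d' y)
    (e0 : ∀ a, d (inA k I A a) = d' (inA k I A a))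
    (e1 : ∀ a, d (dA k I A a) = d' (dA k I A a)) : d = d' := by
  ext x
  induction x using Omega.induction with
  | h0 a => exact e0 a
  | h1 a => exact e1 a
  | add x y hx hy => simp [hx, hy]
  | mul x y hx hy => rw [hd, hd', hx, hy]

end Der

end Omega

theorem sign_congr {a b : ℤ} (h : Even (a - b)) : (-1 : k) ^ a = (-1 : k) ^ b := by
  have : a = (a - b) + b := by ring
  rw [this, zpow_add₀ (by simp), h.neg_one_zpow, one_mul]

theorem sign_mul (a b : ℤ) : (-1 : k) ^ a * (-1 : k) ^ b = (-1 : k) ^ (a + b) := by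
  rw [zpow_add₀ (by simp)]

/-! ### Super-derivations and double derivations -/

/-- The degree `n` part of `Der_R(A)`: the super-derivations of degree `n` of `A` over `R`. -/
def sder (n : ℤ) : Submodule k (A →ₗ[k] A) where
  carrier := {θ | (∀ r, θ (str k I A r) = 0) ∧ (∀ m, ∀ a ∈ deg k I A m, θ a ∈ deg k I A (m + n)) ∧
    ∀ m, ∀ a ∈ deg k I A m, ∀ b, θ (a * b) = θ a * b + ((-1 : k) ^ (n * m)) • (a * θ b)}
  add_mem' := by
    rintro θ η ⟨h1, h2, h3⟩ ⟨g1, g2, g3⟩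
    refine ⟨fun r => by simp [h1, g1], fun m a ha => add_mem (h2 m a ha) (g2 m a ha),
      fun m a ha b => ?_⟩
    simp only [LinearMap.add_apply, h3 m a ha, g3 m a ha, add_mul, mul_add, smul_add]
    abel
  zero_mem' := by simp
  smul_mem' := by
    rintro c θ ⟨h1, h2, h3⟩
    refine ⟨fun r => by simp [h1], fun m a ha => Submodule.smul_mem _ _ (h2 m a ha),
      fun m a ha b => ?_⟩
    simp only [LinearMap.smul_apply, h3 m a ha, smul_add, smul_mul_assoc, mul_smul_comm,
      smul_comm c]

/-- The homogeneous components of `A ⊗ A`. -/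
def degTen (n : ℤ) : Submodule k (A ⊗[k] A) :=
  Submodule.span k {t | ∃ i j, i + j = n ∧ ∃ x ∈ deg k I A i, ∃ y ∈ deg k I A j, t = x ⊗ₜ[k] y}

/-- The degree `n` part of the relative double derivations `𝔻er_R(A)`: the super-derivations
`A → A ⊗ A` of degree `n` over `R`, for the outer bimodule structure
`a (x ⊗ y) b = a x ⊗ y b`. -/
def dder (n : ℤ) : Submodule k (A →ₗ[k] A ⊗[k] A) where
  carrier := {μ | (∀ r, μ (str k I A r) = 0) ∧
    (∀ m, ∀ a ∈ deg k I A m, μ a ∈ degTen k I A (m + n)) ∧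
    ∀ m, ∀ a ∈ deg k I A m, ∀ b, μ (a * b) =
      μ a * ((1 : A) ⊗ₜ[k] b) + ((-1 : k) ^ (n * m)) • ((a ⊗ₜ[k] (1 : A)) * μ b)}
  add_mem' := by
    rintro θ η ⟨h1, h2, h3⟩ ⟨g1, g2, g3⟩
    refine ⟨fun r => by simp [h1, g1], fun m a ha => add_mem (h2 m a ha) (g2 m a ha),
      fun m a ha b => ?_⟩
    simp only [LinearMap.add_apply, h3 m a ha, g3 m a ha, add_mul, mul_add, smul_add]
    abel
  zero_mem' := by simp
  smul_mem' := by
    rintro c θ ⟨h1, h2, h3⟩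
    refine ⟨fun r => by simp [h1], fun m a ha => Submodule.smul_mem _ _ (h2 m a ha),
      fun m a ha b => ?_⟩
    simp only [LinearMap.smul_apply, h3 m a ha, smul_add, smul_mul_assoc, mul_smul_comm,
      smul_comm c]

/-- `Der_R(A)`, the graded vector space of super-derivations. -/
abbrev SDer : Type _ := ⨁ n : ℤ, sder k I A n

/-- `𝔻er_R(A)`, the graded vector space of relative double derivations. -/
abbrev DDer : Type _ := ⨁ n : ℤ, dder k I A n

variable {k I A}

theorem sder_mul {n : ℤ} {θ : A →ₗ[k] A} (h : θ ∈ sder k I A n) (a b : A) :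
    θ (a * b) = θ a * b + twist k I A n a * θ b := by
  induction a using DirectSum.Decomposition.inductionOn (deg k I A) with
  | zero => simp
  | homogeneous a => rw [h.2.2 _ _ a.2, twist_of_mem n a.2, smul_mul_assoc]
  | add a a' ha hb => simp only [add_mul, map_add, ha, hb]; abel

theorem sder_twist {n : ℤ} {θ : A →ₗ[k] A} (h : θ ∈ sder k I A n) (a : A) :
    θ (twist k I A 1 a) = ((-1 : k) ^ n) • twist k I A 1 (θ a) := by
  induction a using DirectSum.Decomposition.inductionOn (deg k I A) with
  | zero => simp
  | @homogeneous m a =>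
    rw [twist_of_mem 1 a.2, twist_of_mem 1 (h.2.1 _ _ a.2), map_smul, smul_smul, sign_mul]
    congr 1
    exact sign_congr k ⟨-n, by ring⟩
  | add a a' ha hb => simp only [map_add, ha, hb, smul_add]

theorem dder_mul {n : ℤ} {μ : A →ₗ[k] A ⊗[k] A} (h : μ ∈ dder k I A n) (a b : A) :
    μ (a * b) = μ a * ((1 : A) ⊗ₜ[k] b) + (twist k I A n a ⊗ₜ[k] (1 : A)) * μ b := by
  induction a using DirectSum.Decomposition.inductionOn (deg k I A) with
  | zero => simp
  | homogeneous a =>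
    rw [h.2.2 _ _ a.2, twist_of_mem n a.2, ← TensorProduct.smul_tmul', smul_mul_assoc]
  | add a a' ha hb => simp only [add_mul, map_add, ha, hb, TensorProduct.add_tmul]; abel

theorem degTen_twist {n : ℤ} {t : A ⊗[k] A} (ht : t ∈ degTen k I A n) :
    Algebra.TensorProduct.map (twist k I A 1) (twist k I A 1) t = ((-1 : k) ^ n) • t := by
  refine Submodule.span_induction ?_ ?_ ?_ ?_ ht
  · rintro _ ⟨i, j, rfl, x, hx, y, hy, rfl⟩
    rw [Algebra.TensorProduct.map_tmul, twist_of_mem 1 hx, twist_of_mem 1 hy,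
      TensorProduct.smul_tmul_smul, sign_mul]
    simp
  · simp
  · intro x y _ _ hx hy
    simp [hx, hy]
  · intro c x _ hx
    rw [map_smul, hx, smul_comm]

theorem dder_twist {n : ℤ} {μ : A →ₗ[k] A ⊗[k] A} (h : μ ∈ dder k I A n) (a : A) :
    μ (twist k I A 1 a) =
      ((-1 : k) ^ n) • Algebra.TensorProduct.map (twist k I A 1) (twist k I A 1) (μ a) := by
  induction a using DirectSum.Decomposition.inductionOn (deg k I A) with
  | zero => simp
  | @homogeneous m a =>
    rw [twist_of_mem 1 a.2, degTen_twist (h.2.1 _ _ a.2), map_smul, smul_smul, sign_mul]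
    congr 1
    exact sign_congr k ⟨-n, by ring⟩
  | add a a' ha hb => simp only [map_add, ha, hb, smul_add]

variable (k I A)

namespace Omega

/-! ### Parities of forms -/

/-- The automorphism of `Ω_R A` that is multiplication by `(-1) ^ p` on `p`-forms. -/
def par : Omega k I A →ₐ[k] Omega k I A :=
  lift (inA k I A) (-dA k I A) (fun a b => by simp [dA_mul]; abel) (fun r => by simp [dA_str])

/-- The automorphism of `Ω_R A` induced by `twist n` on `A`, so multiplication by
`(-1) ^ (n * m)` on forms of internal degree `m`. -/
def sgn (n : ℤ) : Omega k I A →ₐ[k] Omega k I A :=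
  lift ((inA k I A).comp (twist k I A n)) (dA k I A ∘ₗ (twist k I A n).toLinearMap)
    (fun a b => by simp [dA_mul]) (fun r => by simp [twist_str, dA_str])

@[simp] theorem par_inA (a : A) : par k I A (inA k I A a) = inA k I A a := by simp [par]
@[simp] theorem par_dA (a : A) : par k I A (dA k I A a) = -dA k I A a := by simp [par]
@[simp] theorem sgn_inA (n : ℤ) (a : A) :
    sgn k I A n (inA k I A a) = inA k I A (twist k I A n a) := lift_inA _ _ _ _ a
@[simp] theorem sgn_dA (n : ℤ) (a : A) :
    sgn k I A n (dA k I A a) = dA k I A (twist k I A n a) := lift_dA _ _ _ _ a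

@[simp] theorem par_par (x : Omega k I A) : par k I A (par k I A x) = x := by
  have : (par k I A).comp (par k I A) = AlgHom.id k _ := hom_ext (by simp) (by simp)
  exact DFunLike.congr_fun this x

@[simp] theorem sgn_sgn (x : Omega k I A) : sgn k I A 1 (sgn k I A 1 x) = x := by
  have : (sgn k I A 1).comp (sgn k I A 1) = AlgHom.id k _ :=
    hom_ext (by simp [twist_one_twist_one]) (by simp [twist_one_twist_one])
  exact DFunLike.congr_fun this x

theorem sgn_par (n : ℤ) (x : Omega k I A) :
    sgn k I A n (par k I A x) = par k I A (sgn k I A n x) := by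
  have : (sgn k I A n).comp (par k I A) = (par k I A).comp (sgn k I A n) :=
    hom_ext (by simp) (by simp)
  exact DFunLike.congr_fun this x

theorem sgn_even {n : ℤ} (hn : Even n) (x : Omega k I A) : sgn k I A n x = x := by
  have : sgn k I A n = AlgHom.id k _ := hom_ext (by simp [twist_even hn]) (by simp [twist_even hn])
  exact DFunLike.congr_fun this x

theorem sgn_odd {n : ℤ} (hn : Odd n) (x : Omega k I A) : sgn k I A n x = sgn k I A 1 x := by
  have : sgn k I A n = sgn k I A 1 := hom_ext (by simp [twist_odd hn]) (by simp [twist_odd hn])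
  exact DFunLike.congr_fun this x

variable {k I A} in
/-- `Par p m x`: every bihomogeneous component of the form `x` has form degree congruent to `p`
and internal degree congruent to `m` modulo `2`. -/
def Par (p m : ℤ) (x : Omega k I A) : Prop :=
  par k I A x = ((-1 : k) ^ p) • x ∧ sgn k I A 1 x = ((-1 : k) ^ m) • x

variable {k I A}

theorem Par.add {p m : ℤ} {x y : Omega k I A} (hx : Par p m x) (hy : Par p m y) :
    Par p m (x + y) := ⟨by simp [hx.1, hy.1], by simp [hx.2, hy.2]⟩

theorem Par.mul {p m q n : ℤ} {x y : Omega k I A} (hx : Par p m x) (hy : Par q n y) :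
    Par (p + q) (m + n) (x * y) :=
  ⟨by simp [hx.1, hy.1, smul_smul, sign_mul, add_comm],
    by simp [hx.2, hy.2, smul_smul, sign_mul, add_comm]⟩

theorem Par.sgn {p m : ℤ} {x : Omega k I A} (hx : Par p m x) (n : ℤ) :
    sgn k I A n x = ((-1 : k) ^ (n * m)) • x := by
  rcases Int.even_or_odd n with hn | hn
  · rw [sgn_even k I A hn, (hn.mul_right m).neg_one_zpow, one_smul]
  · rw [sgn_odd k I A hn, hx.2, zpow_mul, hn.neg_one_zpow]

theorem par_inA_of_mem {m : ℤ} {a : A} (ha : a ∈ deg k I A m) : Par 0 m (inA k I A a) :=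
  ⟨by simp, by simp [twist_of_mem 1 ha]⟩

theorem par_dA_of_mem {m : ℤ} {a : A} (ha : a ∈ deg k I A m) : Par 1 m (dA k I A a) :=
  ⟨by simp, by simp [twist_of_mem 1 ha]⟩

theorem par_decomp [CharZero k] {C : Omega k I A → Prop} (add : ∀ x y, C x → C y → C (x + y))
    (h : ∀ p m x, Par p m x → C x) (x : Omega k I A) : C x := by
  have e : x = (4⁻¹ : k) • (x + par k I A x + sgn k I A 1 x + par k I A (sgn k I A 1 x)) +
      (4⁻¹ : k) • (x + par k I A x - sgn k I A 1 x - par k I A (sgn k I A 1 x)) +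
      (4⁻¹ : k) • (x - par k I A x + sgn k I A 1 x - par k I A (sgn k I A 1 x)) +
      (4⁻¹ : k) • (x - par k I A x - sgn k I A 1 x + par k I A (sgn k I A 1 x)) := by
    simp only [← smul_add]
    rw [eq_inv_smul_iff₀ (by norm_num)]
    rw [show (4 : k) = 1 + 1 + 1 + 1 by norm_num]
    simp only [add_smul, one_smul]
    abel
  rw [e]
  refine add _ _ (add _ _ (add _ _ (h 0 0 _ ⟨?_, ?_⟩) (h 0 1 _ ⟨?_, ?_⟩)) (h 1 0 _ ⟨?_, ?_⟩))
    (h 1 1 _ ⟨?_, ?_⟩) <;>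
  · simp only [map_smul, map_add, map_sub, par_par, sgn_sgn, sgn_par, zpow_zero, zpow_one, one_smul,
      neg_smul, ← smul_neg]
    congr 1
    abel

/-! ### The differential, contractions and Lie derivatives -/

variable (k I A) in
/-- The differential `D` of `Ω_R A`: `D (x y) = D x * y + (-1) ^ p * x * D y` for a `p`-form `x`,
`D² = 0` on `A`. -/
def D : Omega k I A →ₗ[k] Omega k I A :=
  der (par k I A) (AlgHom.id k _) (dA k I A) 0
    (fun a b => by simp [dA_mul]) (fun a b => by simp) (fun r => by simp)

/-- The contraction `i_θ` with a super-derivation `θ` of degree `n`: the super-derivation of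
bidegree `(-1, n)` of `Ω_R A` that vanishes on `A` and sends `D a` to `θ a`. -/
def contr {n : ℤ} (θ : sder k I A n) : Omega k I A →ₗ[k] Omega k I A :=
  der ((par k I A).comp (sgn k I A n)) (AlgHom.id k _) 0 ((inA k I A).toLinearMap ∘ₗ θ.1)
    (fun a b => by simp) (fun a b => by simp [sder_mul θ.2]) (fun r => by simp [θ.2.1])

/-- The Lie derivative `L_θ` along a super-derivation `θ` of degree `n`: the super-derivation of
bidegree `(0, n)` of `Ω_R A` that sends `a` to `θ a` and `D a` to `D (θ a)`. -/
def lie {n : ℤ} (θ : sder k I A n) : Omega k I A →ₗ[k] Omega k I A :=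
  der (sgn k I A n) (AlgHom.id k _) ((inA k I A).toLinearMap ∘ₗ θ.1) (dA k I A ∘ₗ θ.1)
    (fun a b => by simp [sder_mul θ.2])
    (fun a b => by simp [sder_mul θ.2, dA_mul]; abel) (fun r => by simp [θ.2.1])

/-- The contraction `i_μ : Ω_R A → Ω_R A ⊗ Ω_R A` with a double derivation `μ` of degree `n`: the
double super-derivation of bidegree `(-1, n)` that vanishes on `A` and sends `D a` to `μ a`. -/
def dcontr {n : ℤ} (μ : dder k I A n) : Omega k I A →ₗ[k] Omega k I A ⊗[k] Omega k I A :=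
  der (Algebra.TensorProduct.includeLeft.comp ((par k I A).comp (sgn k I A n)))
    Algebra.TensorProduct.includeRight 0
    ((Algebra.TensorProduct.map (inA k I A) (inA k I A)).toLinearMap ∘ₗ μ.1)
    (fun a b => by simp)
    (fun a b => by
      rw [LinearMap.comp_apply, dder_mul μ.2, AlgHom.toLinearMap_apply, map_add, map_mul, map_mul]
      simp only [Algebra.TensorProduct.map_tmul, map_one]
      simp
      rfl)
    (fun r => by simp [μ.2.1])

variable (k I A) in
/-- The Koszul sign of an involution `U` with eigenvalues `±1`: the endomorphism of
`Ω_R A ⊗ Ω_R A` that multiplies `x ⊗ y` by `-1` if `U x = -x` and `U y = -y`, and fixes it if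
`U x = x` or `U y = y`. -/
def koszul (U : Omega k I A →ₐ[k] Omega k I A) :
    Omega k I A ⊗[k] Omega k I A →ₗ[k] Omega k I A ⊗[k] Omega k I A :=
  (2⁻¹ : k) • (LinearMap.id + TensorProduct.map U.toLinearMap LinearMap.id +
    TensorProduct.map LinearMap.id U.toLinearMap - TensorProduct.map U.toLinearMap U.toLinearMap)

variable (k I A) in
/-- The flip `β` of `Ω_R A ⊗ Ω_R A`:  `x ⊗ y ↦ (-1) ^ (p * q + m * n) • y ⊗ x` for `x` of
bidegree `(p, m)` and `y` of bidegree `(q, n)`. -/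
def flip : Omega k I A ⊗[k] Omega k I A →ₗ[k] Omega k I A ⊗[k] Omega k I A :=
  (TensorProduct.comm k _ _).toLinearMap ∘ₗ koszul k I A (par k I A) ∘ₗ koszul k I A (sgn k I A 1)

/-- The reduced contraction `ι_μ = m ∘ β ∘ i_μ`. -/
def iota {n : ℤ} (μ : dder k I A n) : Omega k I A →ₗ[k] Omega k I A :=
  LinearMap.mul' k _ ∘ₗ flip k I A ∘ₗ dcontr μ

theorem koszul_tmul [CharZero k] {U : Omega k I A →ₐ[k] Omega k I A} {p q : ℤ} {x y : Omega k I A}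
    (hx : U x = ((-1 : k) ^ p) • x) (hy : U y = ((-1 : k) ^ q) • y) :
    koszul k I A U (x ⊗ₜ y) = ((-1 : k) ^ (p * q)) • x ⊗ₜ[k] y := by
  have h2 : (2 : k) ≠ 0 := two_ne_zero
  simp only [koszul, LinearMap.smul_apply, LinearMap.sub_apply, LinearMap.add_apply,
    LinearMap.id_apply, TensorProduct.map_tmul, AlgHom.toLinearMap_apply, hx, hy,
    TensorProduct.smul_tmul', TensorProduct.tmul_smul, smul_smul]
  rw [inv_smul_eq_iff₀ h2, TensorProduct.smul_tmul', smul_smul]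
  have h : ∀ c d e f : k, 1 + c + d - e = f →
      x ⊗ₜ[k] y + (c • x) ⊗ₜ[k] y + (d • x) ⊗ₜ[k] y - (e • x) ⊗ₜ[k] y = (f • x) ⊗ₜ[k] y := by
    rintro c d e f rfl
    simp only [add_smul, sub_smul, one_smul, TensorProduct.add_tmul, TensorProduct.sub_tmul]
  apply h
  rcases Int.even_or_odd p with hp | hp <;> rcases Int.even_or_odd q with hq | hq
  · rw [hp.neg_one_zpow, hq.neg_one_zpow, (hp.mul_right q).neg_one_zpow]; ring
  · rw [hp.neg_one_zpow, hq.neg_one_zpow, (hp.mul_right q).neg_one_zpow]; ring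
  · rw [hp.neg_one_zpow, hq.neg_one_zpow, (hq.mul_left p).neg_one_zpow]; ring
  · rw [hp.neg_one_zpow, hq.neg_one_zpow, (hp.mul hq).neg_one_zpow]; ring

theorem flip_tmul [CharZero k] {p m q n : ℤ} {x y : Omega k I A} (hx : Par p m x)
    (hy : Par q n y) :
    flip k I A (x ⊗ₜ y) = ((-1 : k) ^ (p * q + m * n)) • y ⊗ₜ[k] x := by
  simp only [flip, LinearMap.comp_apply, koszul_tmul hx.2 hy.2, map_smul, koszul_tmul hx.1 hy.1,
    LinearEquiv.coe_coe, TensorProduct.comm_tmul, smul_smul, sign_mul]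
  rw [add_comm]

end Omega

namespace Omega

variable {k I A}

/-! ### The cyclic quotient -/

theorem der_comm {B : Type*} [Ring B] [Algebra k B] {f g : Omega k I A →ₐ[k] B}
    {d : Omega k I A →ₗ[k] B} (hd : ∀ x y, d (x * y) = d x * g y + f x * d y)
    {U : Omega k I A →ₐ[k] Omega k I A} {U' : B →ₐ[k] B} (c : k)
    (hf : ∀ x, f (U x) = U' (f x)) (hg : ∀ x, g (U x) = U' (g x))
    (h0 : ∀ a, d (U (inA k I A a)) = c • U' (d (inA k I A a)))
    (h1 : ∀ a, d (U (dA k I A a)) = c • U' (d (dA k I A a))) (x : Omega k I A) :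
    d (U x) = c • U' (d x) := by
  induction x using Omega.induction with
  | h0 a => exact h0 a
  | h1 a => exact h1 a
  | add x y hx hy => simp only [map_add, hx, hy, smul_add]
  | mul x y hx hy =>
    rw [map_mul, hd, hd, hx, hy, hf, hg, map_add, map_mul, map_mul, smul_add, smul_mul_assoc,
      mul_smul_comm]

theorem D_mul {p m : ℤ} {x : Omega k I A} (hx : Par p m x) (y : Omega k I A) :
    D k I A (x * y) = D k I A x * y + ((-1 : k) ^ p) • (x * D k I A y) := by
  rw [D, der_mul, hx.1, smul_mul_assoc]; rfl

theorem contr_mul {n : ℤ} (θ : sder k I A n) {p m : ℤ} {x : Omega k I A} (hx : Par p m x)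
    (y : Omega k I A) :
    contr θ (x * y) = contr θ x * y + ((-1 : k) ^ (p + n * m)) • (x * contr θ y) := by
  rw [contr, der_mul, AlgHom.comp_apply, hx.sgn, map_smul, hx.1, smul_smul, sign_mul,
    smul_mul_assoc, add_comm p]; rfl

theorem lie_mul {n : ℤ} (θ : sder k I A n) {p m : ℤ} {x : Omega k I A} (hx : Par p m x)
    (y : Omega k I A) :
    lie θ (x * y) = lie θ x * y + ((-1 : k) ^ (n * m)) • (x * lie θ y) := by
  rw [lie, der_mul, hx.sgn, smul_mul_assoc]; rfl

theorem D_par {p m : ℤ} {x : Omega k I A} (hx : Par p m x) : Par (p + 1) m (D k I A x) := by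
  constructor
  · have h := der_comm (d := D k I A) (der_mul _ _ _ _ _ _ _) (U := par k I A) (U' := par k I A)
      (-1) (fun _ => rfl) (fun _ => rfl) (fun a => by simp [D]) (fun a => by simp [D]) x
    rw [hx.1, map_smul] at h
    rw [← sign_mul, mul_comm, mul_smul, h, smul_smul]
    simp
  · have h := der_comm (d := D k I A) (der_mul _ _ _ _ _ _ _) (U := sgn k I A 1)
      (U' := sgn k I A 1)
      1 (fun _ => (sgn_par _ _ _ _ _).symm) (fun _ => rfl) (fun a => by simp [D])
      (fun a => by simp [D]) x
    rw [hx.2, map_smul, one_smul] at h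
    exact h.symm

theorem contr_par {n : ℤ} (θ : sder k I A n) {p m : ℤ} {x : Omega k I A} (hx : Par p m x) :
    Par (p - 1) (m + n) (contr θ x) := by
  constructor
  · have h := der_comm (d := contr θ) (der_mul _ _ _ _ _ _ _) (U := par k I A) (U' := par k I A)
      (-1) (fun _ => by simp [sgn_par]) (fun _ => rfl) (fun a => by simp [contr])
      (fun a => by simp [contr]) x
    rw [hx.1, map_smul] at h
    rw [sub_eq_add_neg, ← sign_mul, mul_comm, mul_smul, h, smul_smul]
    simp
  · have h := der_comm (d := contr θ) (der_mul _ _ _ _ _ _ _) (U := sgn k I A 1)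
      (U' := sgn k I A 1)
      ((-1) ^ n) (fun x => by
        rcases Int.even_or_odd n with hn | hn
        · simp [sgn_even _ _ _ hn, sgn_par]
        · simp [sgn_odd _ _ _ hn, sgn_par]) (fun _ => rfl) (fun a => by simp [contr])
      (fun a => by simp [contr, sder_twist θ.2]) x
    rw [hx.2, map_smul] at h
    rw [← sign_mul, mul_comm, mul_smul, h, smul_smul, sign_mul,
      Even.neg_one_zpow (⟨n, rfl⟩ : Even (n + n)), one_smul]

theorem lie_par {n : ℤ} (θ : sder k I A n) {p m : ℤ} {x : Omega k I A} (hx : Par p m x) :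
    Par p (m + n) (lie θ x) := by
  constructor
  · have h := der_comm (d := lie θ) (der_mul _ _ _ _ _ _ _) (U := par k I A) (U' := par k I A)
      1 (fun _ => by simp [sgn_par]) (fun _ => rfl) (fun a => by simp [lie])
      (fun a => by simp [lie]) x
    rw [hx.1, map_smul, one_smul] at h
    exact h.symm
  · have h := der_comm (d := lie θ) (der_mul _ _ _ _ _ _ _) (U := sgn k I A 1)
      (U' := sgn k I A 1)
      ((-1) ^ n) (fun x => by
        rcases Int.even_or_odd n with hn | hn
        · simp [sgn_even _ _ _ hn]
        · simp [sgn_odd _ _ _ hn]) (fun _ => rfl) (fun a => by simp [lie, sder_twist θ.2])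
      (fun a => by simp [lie, sder_twist θ.2]) x
    rw [hx.2, map_smul] at h
    rw [← sign_mul, mul_comm, mul_smul, h, smul_smul, sign_mul,
      Even.neg_one_zpow (⟨n, rfl⟩ : Even (n + n)), one_smul]

variable (k I A) in
/-- The subspace `[Ω_R A, Ω_R A]` spanned by the super-commutators
`x y - (-1) ^ (p * q + m * n) y x` for `x` of bidegree `(p, m)` and `y` of bidegree `(q, n)` (form
degree and internal degree; only their parities matter). -/
def comm : Submodule k (Omega k I A) :=
  Submodule.span k {z | ∃ (p m q n : ℤ) (x y : Omega k I A), Par p m x ∧ Par q n y ∧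
    z = x * y - ((-1 : k) ^ (p * q + m * n)) • (y * x)}

theorem map_comm_le {d : Omega k I A →ₗ[k] Omega k I A} {e n : ℤ}
    (hmul : ∀ (p m : ℤ) (x y : Omega k I A), Par p m x →
      d (x * y) = d x * y + ((-1 : k) ^ (e * p + n * m)) • (x * d y))
    (hpar : ∀ (p m : ℤ) (x : Omega k I A), Par p m x → Par (p + e) (m + n) (d x)) :
    comm k I A ≤ (comm k I A).comap d := by
  rw [comm, Submodule.span_le]
  rintro _ ⟨p, m, q, l, x, y, hx, hy, rfl⟩
  have h1 : d x * y - ((-1 : k) ^ ((p + e) * q + (m + n) * l)) • (y * d x) ∈ comm k I A :=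
    Submodule.subset_span ⟨_, _, _, _, _, _, hpar _ _ _ hx, hy, rfl⟩
  have h2 : x * d y - ((-1 : k) ^ (p * (q + e) + m * (l + n))) • (d y * x) ∈ comm k I A :=
    Submodule.subset_span ⟨_, _, _, _, _, _, hx, hpar _ _ _ hy, rfl⟩
  have h3 := add_mem h1 (Submodule.smul_mem _ ((-1 : k) ^ (e * p + n * m)) h2)
  change d _ ∈ comm k I A
  convert h3 using 1
  rw [map_sub, map_smul, hmul _ _ _ _ hx, hmul _ _ _ _ hy]
  simp only [smul_sub, smul_add, smul_smul, sign_mul]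
  rw [sign_congr k (a := p * q + m * l + (e * q + n * l)) (b := (p + e) * q + (m + n) * l)
    ⟨0, by ring⟩, sign_congr k (a := e * p + n * m + (p * (q + e) + m * (l + n)))
    (b := p * q + m * l) ⟨e * p + n * m, by ring⟩]
  abel

/-- The product `m ∘ β`, on pure tensors. -/
theorem mulFlip_tmul [CharZero k] {p m q n : ℤ} {x y : Omega k I A} (hx : Par p m x)
    (hy : Par q n y) : LinearMap.mul' k _ (flip k I A (x ⊗ₜ y)) =
      ((-1 : k) ^ (p * q + m * n)) • (y * x) := by
  rw [flip_tmul hx hy, map_smul, LinearMap.mul'_apply]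

/-- `U ⊗ U` if `q` is odd, the identity if `q` is even. -/
def tpow (U : Omega k I A →ₐ[k] Omega k I A) (q : ℤ) :
    Omega k I A ⊗[k] Omega k I A →ₐ[k] Omega k I A ⊗[k] Omega k I A :=
  open Classical in if Even q then AlgHom.id k _ else Algebra.TensorProduct.map U U

theorem tpow_tmul {U : Omega k I A →ₐ[k] Omega k I A} (q : ℤ) {p p' : ℤ} {x y : Omega k I A}
    (hx : U x = ((-1 : k) ^ p) • x) (hy : U y = ((-1 : k) ^ p') • y) :
    tpow U q (x ⊗ₜ y) = ((-1 : k) ^ ((p + p') * q)) • x ⊗ₜ[k] y := by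
  rcases Int.even_or_odd q with hq | hq
  · simp [tpow, hq, (hq.mul_left (p + p')).neg_one_zpow]
  · rw [tpow, if_neg (Int.not_even_iff_odd.2 hq), Algebra.TensorProduct.map_tmul, hx, hy,
      TensorProduct.smul_tmul_smul, sign_mul, mul_comm (p + p'), zpow_mul, hq.neg_one_zpow]

theorem tpow_apply {U : Omega k I A →ₐ[k] Omega k I A} (q : ℤ) {p : ℤ}
    {z : Omega k I A ⊗[k] Omega k I A}
    (hz : Algebra.TensorProduct.map U U z = ((-1 : k) ^ p) • z) :
    tpow U q z = ((-1 : k) ^ (p * q)) • z := by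
  rcases Int.even_or_odd q with hq | hq
  · simp [tpow, hq, (hq.mul_left p).neg_one_zpow]
  · rw [tpow, if_neg (Int.not_even_iff_odd.2 hq), hz, mul_comm p, zpow_mul, hq.neg_one_zpow]

theorem mulFlip_rotate [CharZero k] {q l : ℤ} {y : Omega k I A} (hy : Par q l y)
    (z : Omega k I A ⊗[k] Omega k I A) :
    LinearMap.mul' k _ (flip k I A (tpow (par k I A) q (tpow (sgn k I A 1) l z) * (1 ⊗ₜ[k] y))) =
      LinearMap.mul' k _ (flip k I A ((y ⊗ₜ[k] 1) * z)) := by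
  induction z using TensorProduct.induction_on with
  | zero => simp
  | add z z' h h' => simp only [map_add, add_mul, mul_add, h, h']
  | tmul x x' =>
    induction x using par_decomp with
    | add x z h h' => simp only [TensorProduct.add_tmul, map_add, add_mul, mul_add, h, h']
    | h p m x hx =>
    induction x' using par_decomp with
    | add x z h h' => simp only [TensorProduct.tmul_add, map_add, add_mul, mul_add, h, h']
    | h p' m' x' hx' =>
    rw [tpow_tmul l hx.2 hx'.2, map_smul, tpow_tmul q hx.1 hx'.1, smul_mul_assoc, smul_mul_assoc,
      Algebra.TensorProduct.tmul_mul_tmul, Algebra.TensorProduct.tmul_mul_tmul, mul_one, one_mul,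
      map_smul, map_smul, map_smul, map_smul, mulFlip_tmul hx (hx'.mul hy),
      mulFlip_tmul (hy.mul hx) hx', smul_smul, smul_smul, sign_mul, sign_mul, mul_assoc]
    congr 1
    exact sign_congr k ⟨p * q + m * l, by ring⟩

theorem mulFlip_rotate' [CharZero k] {q l p m : ℤ} {y : Omega k I A} (hy : Par q l y)
    {z : Omega k I A ⊗[k] Omega k I A}
    (h1 : Algebra.TensorProduct.map (par k I A) (par k I A) z = ((-1 : k) ^ p) • z)
    (h2 : Algebra.TensorProduct.map (sgn k I A 1) (sgn k I A 1) z = ((-1 : k) ^ m) • z) :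
    LinearMap.mul' k _ (flip k I A ((y ⊗ₜ[k] 1) * z)) =
      ((-1 : k) ^ (p * q + m * l)) • LinearMap.mul' k _ (flip k I A (z * (1 ⊗ₜ[k] y))) := by
  rw [← mulFlip_rotate hy, tpow_apply l h2, map_smul, tpow_apply q h1, smul_mul_assoc,
    smul_mul_assoc, map_smul, map_smul, map_smul, map_smul, smul_smul, sign_mul, add_comm]

theorem dcontr_mul_raw {n : ℤ} (μ : dder k I A n) (x y : Omega k I A) : dcontr μ (x * y) =
    dcontr μ x * (Algebra.TensorProduct.includeRight : _ →ₐ[k] Omega k I A ⊗[k] Omega k I A) y +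
      ((Algebra.TensorProduct.includeLeft : _ →ₐ[k] Omega k I A ⊗[k] Omega k I A).comp
        ((par k I A).comp (sgn k I A n))) x * dcontr μ y :=
  der_mul _ _ _ _ _ _ _ x y

theorem dcontr_inA {n : ℤ} (μ : dder k I A n) (a : A) : dcontr μ (inA k I A a) = 0 :=
  der_inA _ _ _ _ _ _ _ a

theorem dcontr_dA {n : ℤ} (μ : dder k I A n) (a : A) : dcontr μ (dA k I A a) =
    Algebra.TensorProduct.map (inA k I A) (inA k I A) (μ.1 a) :=
  der_dA _ _ _ _ _ _ _ a

theorem dcontr_mul {n : ℤ} (μ : dder k I A n) {p m : ℤ} {x : Omega k I A} (hx : Par p m x)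
    (y : Omega k I A) : dcontr μ (x * y) =
      dcontr μ x * (1 ⊗ₜ[k] y) + ((-1 : k) ^ (p + n * m)) • ((x ⊗ₜ[k] 1) * dcontr μ y) := by
  rw [dcontr_mul_raw, AlgHom.comp_apply, AlgHom.comp_apply, hx.sgn, map_smul, hx.1, smul_smul,
    sign_mul, map_smul, smul_mul_assoc, add_comm p]; rfl

theorem dcontr_par {n : ℤ} (μ : dder k I A n) {p m : ℤ} {x : Omega k I A} (hx : Par p m x) :
    Algebra.TensorProduct.map (par k I A) (par k I A) (dcontr μ x) =
      ((-1 : k) ^ (p - 1)) • dcontr μ x := by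
  have hAA : ∀ t : A ⊗[k] A, Algebra.TensorProduct.map (par k I A) (par k I A)
      (Algebra.TensorProduct.map (inA k I A) (inA k I A) t) =
        Algebra.TensorProduct.map (inA k I A) (inA k I A) t := by
    intro t
    induction t using TensorProduct.induction_on with
    | zero => simp
    | add z z' h h' => rw [map_add, map_add, h, h']
    | tmul x x' => simp
  have h := der_comm (dcontr_mul_raw μ) (U := par k I A)
    (U' := Algebra.TensorProduct.map (par k I A) (par k I A))
    (-1) (fun _ => by simp [sgn_par]) (fun _ => by simp) (fun a => by simp [dcontr_inA])
    (fun a => by rw [par_dA, map_neg, neg_smul, one_smul, dcontr_dA, hAA]) x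
  rw [hx.1, map_smul] at h
  rw [sub_eq_add_neg, ← sign_mul, mul_comm, mul_smul, h, smul_smul]
  simp

theorem dcontr_sgn {n : ℤ} (μ : dder k I A n) {p m : ℤ} {x : Omega k I A} (hx : Par p m x) :
    Algebra.TensorProduct.map (sgn k I A 1) (sgn k I A 1) (dcontr μ x) =
      ((-1 : k) ^ (m + n)) • dcontr μ x := by
  have hAA : ∀ t : A ⊗[k] A, Algebra.TensorProduct.map (sgn k I A 1) (sgn k I A 1)
      (Algebra.TensorProduct.map (inA k I A) (inA k I A) t) =
        Algebra.TensorProduct.map (inA k I A) (inA k I A)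
          (Algebra.TensorProduct.map (twist k I A 1) (twist k I A 1) t) := by
    intro t
    induction t using TensorProduct.induction_on with
    | zero => simp
    | add z z' h h' => simp only [map_add, h, h']
    | tmul x x' => simp
  have h := der_comm (dcontr_mul_raw μ) (U := sgn k I A 1)
    (U' := Algebra.TensorProduct.map (sgn k I A 1) (sgn k I A 1))
    ((-1) ^ n) (fun x => by
        rcases Int.even_or_odd n with hn | hn
        · simp [sgn_even _ _ _ hn, sgn_par]
        · simp [sgn_odd _ _ _ hn, sgn_par]) (fun _ => by simp) (fun a => by simp [dcontr_inA])
    (fun a => by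
      rw [sgn_dA, dcontr_dA, dcontr_dA, dder_twist μ.2, map_smul, hAA]) x
  rw [hx.2, map_smul] at h
  rw [← sign_mul, mul_comm, mul_smul, h, smul_smul, sign_mul,
    Even.neg_one_zpow (⟨n, rfl⟩ : Even (n + n)), one_smul]

theorem iota_comm [CharZero k] {n : ℤ} (μ : dder k I A n) :
    comm k I A ≤ LinearMap.ker (iota μ) := by
  rw [comm, Submodule.span_le]
  rintro _ ⟨p, m, q, l, x, y, hx, hy, rfl⟩
  have h1 := mulFlip_rotate' hx (dcontr_par μ hy) (dcontr_sgn μ hy)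
  have h2 := mulFlip_rotate' hy (dcontr_par μ hx) (dcontr_sgn μ hx)
  rw [SetLike.mem_coe, LinearMap.mem_ker, map_sub, map_smul, sub_eq_zero]
  simp only [iota, LinearMap.comp_apply]
  rw [dcontr_mul μ hx, dcontr_mul μ hy]
  simp only [map_add, map_smul, h1, h2, smul_add, smul_smul, sign_mul]
  rw [sign_congr k (a := p + n * m + ((q - 1) * p + (l + n) * m)) (b := p * q + m * l)
    ⟨n * m, by ring⟩,
    sign_congr k (a := p * q + m * l + (q + n * l + ((p - 1) * q + (m + n) * l))) (b := 0)
    ⟨p * q + n * l + m * l, by ring⟩]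
  rw [zpow_zero, one_smul, add_comm]

end Omega

/-- The cyclic quotient `DR_R(A) = Ω_R A / [Ω_R A, Ω_R A]`. -/
abbrev DR : Type _ := Omega k I A ⧸ Omega.comm k I A

namespace DR

/-- The class of a form in `DR_R(A)`. -/
abbrev mk : Omega k I A →ₗ[k] DR k I A := (Omega.comm k I A).mkQ

/-- The differential of `DR_R(A)`. -/
def D : DR k I A →ₗ[k] DR k I A :=
  (Omega.comm k I A).mapQ _ (Omega.D k I A)
    (Omega.map_comm_le (e := 1) (n := 0)
      (fun p m x y hx => by rw [Omega.D_mul hx]; simp)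
      (fun p m x hx => by simpa using Omega.D_par hx))

variable {k I A}

/-- The contraction `i_θ : DR_R(A) → DR_R(A)` with a super-derivation. -/
def contr {n : ℤ} (θ : sder k I A n) : DR k I A →ₗ[k] DR k I A :=
  (Omega.comm k I A).mapQ _ (Omega.contr θ)
    (Omega.map_comm_le (e := -1) (n := n)
      (fun p m x y hx => by
        rw [Omega.contr_mul θ hx, sign_congr k (a := p + n * m) (b := -1 * p + n * m)
          ⟨p, by ring⟩])
      (fun p m x hx => Omega.contr_par θ hx))

/-- The Lie derivative `L_θ : DR_R(A) → DR_R(A)` along a super-derivation. -/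
def lie {n : ℤ} (θ : sder k I A n) : DR k I A →ₗ[k] DR k I A :=
  (Omega.comm k I A).mapQ _ (Omega.lie θ)
    (Omega.map_comm_le (e := 0) (n := n)
      (fun p m x y hx => by rw [Omega.lie_mul θ hx]; simp)
      (fun p m x hx => by simpa using Omega.lie_par θ hx))

/-- The reduced contraction `ι_μ : DR_R(A) → Ω_R A` with a double derivation. -/
def iota [CharZero k] {n : ℤ} (μ : dder k I A n) : DR k I A →ₗ[k] Omega k I A :=
  (Omega.comm k I A).liftQ (Omega.iota μ) (Omega.iota_comm μ)

end DR

variable {k I A}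

theorem Omega.contr_add {n : ℤ} (θ η : sder k I A n) :
    Omega.contr (θ + η) = Omega.contr θ + Omega.contr η :=
  Omega.der_unique (f := (par k I A).comp (sgn k I A n)) (g := AlgHom.id k _)
    (Omega.der_mul _ _ _ _ _ _ _)
    (fun x y => by
      simp only [LinearMap.add_apply, Omega.contr, Omega.der_mul, add_mul, mul_add]; abel)
    (fun a => by simp [Omega.contr]) (fun a => by simp [Omega.contr])

theorem Omega.contr_smul {n : ℤ} (c : k) (θ : sder k I A n) :
    Omega.contr (c • θ) = c • Omega.contr θ :=
  Omega.der_unique (f := (par k I A).comp (sgn k I A n)) (g := AlgHom.id k _)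
    (Omega.der_mul _ _ _ _ _ _ _)
    (fun x y => by
      simp only [LinearMap.smul_apply, Omega.contr, Omega.der_mul, smul_add, smul_mul_assoc,
        mul_smul_comm])
    (fun a => by simp [Omega.contr]) (fun a => by simp [Omega.contr])

theorem Omega.dcontr_add {n : ℤ} (μ ν : dder k I A n) :
    Omega.dcontr (μ + ν) = Omega.dcontr μ + Omega.dcontr ν :=
  Omega.der_unique (Omega.dcontr_mul_raw _)
    (fun x y => by
      simp only [LinearMap.add_apply, Omega.dcontr_mul_raw, add_mul, mul_add]; abel)
    (fun a => by simp [Omega.dcontr_inA])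
    (fun a => by simp only [LinearMap.add_apply, Omega.dcontr_dA, Submodule.coe_add, map_add])

theorem Omega.dcontr_smul {n : ℤ} (c : k) (μ : dder k I A n) :
    Omega.dcontr (c • μ) = c • Omega.dcontr μ :=
  Omega.der_unique (Omega.dcontr_mul_raw _)
    (fun x y => by
      simp only [LinearMap.smul_apply, Omega.dcontr_mul_raw, smul_add, smul_mul_assoc,
        mul_smul_comm])
    (fun a => by simp [Omega.dcontr_inA])
    (fun a => by simp only [LinearMap.smul_apply, Omega.dcontr_dA, Submodule.coe_smul, map_smul])

/-- The map `i^ω : Der_R(A) → DR_R(A)`, `θ ↦ i_θ(ω)`. -/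
def contrForm (ω : DR k I A) : SDer k I A →ₗ[k] DR k I A :=
  DirectSum.toModule k ℤ _ fun n =>
    { toFun := fun θ => DR.contr θ ω
      map_add' := fun θ η => by
        obtain ⟨x, rfl⟩ := Submodule.mkQ_surjective _ ω
        simp [DR.contr, Omega.contr_add]
      map_smul' := fun c θ => by
        obtain ⟨x, rfl⟩ := Submodule.mkQ_surjective _ ω
        simp [DR.contr, Omega.contr_smul] }

/-- The map `ι^ω : 𝔻er_R(A) → Ω_R A`, `μ ↦ ι_μ(ω)`. -/
def iotaForm [CharZero k] (ω : DR k I A) : DDer k I A →ₗ[k] Omega k I A :=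
  DirectSum.toModule k ℤ _ fun n =>
    { toFun := fun μ => DR.iota μ ω
      map_add' := fun θ η => by
        obtain ⟨x, rfl⟩ := Submodule.mkQ_surjective _ ω
        simp [DR.iota, Omega.iota, Omega.dcontr_add]
      map_smul' := fun c θ => by
        obtain ⟨x, rfl⟩ := Submodule.mkQ_surjective _ ω
        simp [DR.iota, Omega.iota, Omega.dcontr_smul] }

variable (k I A)

/-! ### The bigrading of the forms -/

/-- The one-forms of internal degree `n`: those in the span of the `a ⊗ b` with
`a ∈ A_i`, `b ∈ A_j`, `i + j = n`. -/
def omega1Deg (n : ℤ) : Submodule k (Omega1 k I A) :=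
  (Submodule.span k {t : TenR k I A | ∃ i j, i + j = n ∧ ∃ x ∈ deg k I A i, ∃ y ∈ deg k I A j,
    t = tmulR I x y}).comap ((Omega1 k I A).subtype.restrictScalars k)

/-- The `p`-forms of internal degree `n`. -/
def omegaDeg : ℕ → ℤ → Submodule k (Omega k I A)
  | 0, n => (deg k I A n).map (Omega.inA k I A).toLinearMap
  | p + 1, n => Submodule.span k {z | ∃ i j, i + j = n ∧ ∃ x ∈ omegaDeg p i,
      ∃ η ∈ omega1Deg k I A j, z = x * Omega.inOne k I A η}

/-- The subspace `Ω¹_R A` of `Ω_R A`. -/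
def oneForms : Submodule k (Omega k I A) := LinearMap.range (Omega.inOne k I A)

variable {k I A}

/-! ### Symplectic and bisymplectic forms, and the moment map -/

/-- `ω` is a closed element of `DR²_R(A)`, homogeneous of internal degree `c`. -/
def IsClosedTwoForm (c : ℤ) (ω : DR k I A) : Prop :=
  ω ∈ (omegaDeg k I A 2 c).map (DR.mk k I A) ∧ DR.D k I A ω = 0

/-- `ω` is symplectic: `i^ω` is an isomorphism from `Der_R(A)` to `DR¹_R(A)`. -/
def IsSymplectic (ω : DR k I A) : Prop :=
  Set.BijOn (contrForm ω) Set.univ ((oneForms k I A).map (DR.mk k I A))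

/-- `ω` is bisymplectic: `ι^ω` is an isomorphism from `𝔻er_R(A)` to `Ω¹_R A`. -/
def IsBisymplectic [CharZero k] (ω : DR k I A) : Prop :=
  Set.BijOn (iotaForm ω) Set.univ (oneForms k I A)

section Moment

variable [DecidableEq I]

variable (k I A) in
/-- The image in `A` of the indicator function of `i`. -/
def idem (i : I) : A := str k I A (Pi.single i 1)

theorem str_mul_idem (r : I → k) (i : I) : str k I A r * idem k I A i = r i • idem k I A i := by
  rw [idem, ← map_mul, ← map_smul]
  congr 1
  ext j
  by_cases h : j = i
  · subst h; simp
  · simp [h]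

theorem idem_mul_str (r : I → k) (i : I) : idem k I A i * str k I A r = r i • idem k I A i := by
  rw [← str_mul_idem, idem, ← map_mul, ← map_mul, mul_comm]

variable [Fintype I]

variable (k I A) in
/-- The distinguished double derivation `δ : a ↦ a · e - e · a`, where
`e = ∑ i, 1_i ⊗ 1_i ∈ R ⊗ R`. -/
def delta : dder k I A 0 where
  val := ∑ i, ((TensorProduct.mk k A A).flip (idem k I A i) ∘ₗ LinearMap.mulRight k (idem k I A i) -
    TensorProduct.mk k A A (idem k I A i) ∘ₗ LinearMap.mulLeft k (idem k I A i))
  property := by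
    have hi : ∀ i, idem k I A i ∈ deg k I A 0 := fun i => GrAlg.str_mem _
    refine ⟨fun r => ?_, fun m a ha => ?_, fun m a ha b => ?_⟩
    · simp [LinearMap.sum_apply, str_mul_idem, idem_mul_str]
    · rw [LinearMap.sum_apply]
      refine Submodule.sum_mem _ fun i _ => ?_
      refine Submodule.sub_mem _ (Submodule.subset_span ⟨m, 0, by simp, a * idem k I A i, ?_,
        idem k I A i, hi i, rfl⟩) (Submodule.subset_span ⟨0, m, by simp, idem k I A i, hi i,
        idem k I A i * a, ?_, rfl⟩)
      · simpa using SetLike.mul_mem_graded ha (hi i)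
      · simpa using SetLike.mul_mem_graded (hi i) ha
    · simp only [LinearMap.sum_apply, Finset.sum_mul, Finset.mul_sum, Finset.smul_sum,
        ← Finset.sum_add_distrib]
      refine Finset.sum_congr rfl fun i _ => ?_
      simp [sub_mul, mul_sub, mul_assoc]

/-- `w ∈ A` represents `μ_nc(ω) ∈ (A / R)^R`: the class of `w` in `A / R` commutes with `R`, and it
is the unique class with `D w = ι_δ(ω)`. -/
def RepresentsMoment [CharZero k] (ω : DR k I A) (w : A) : Prop :=
  (∀ r, str k I A r * w - w * str k I A r ∈ (str k I A).range) ∧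
    ∀ a, Omega.dA k I A a = DR.iota (delta k I A) ω ↔ a - w ∈ (str k I A).range

/-! ### Relative Ginzburg dg algebras -/

/-- The conditions on the triple `(A, ω, ξ)`, with `c` the degree of `ω` and `w` a representative of
`μ_nc(ω)`, under which the relative Ginzburg dg algebra `𝔇(A, ω, ξ)` is defined. -/
structure IsGinzburgTriple [CharZero k] (c : ℤ) (ω : DR k I A) (ξ : sder k I A 1) (w : A) :
    Prop where
  nonpos : ∀ n, 0 < n → deg k I A n = ⊥
  finiteType : Algebra.FiniteType k A
  projective : Module.Projective (Env k A) (Omega1 k I A)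
  generated : Submodule.span (Env k A)
    {η : Omega1 k I A | ∃ n, c ≤ n ∧ n ≤ 0 ∧ η ∈ omega1Deg k I A n} = ⊤
  closed : IsClosedTwoForm c ω
  bisymplectic : IsBisymplectic ω
  sq_zero : ∀ a, ξ.1 (ξ.1 a) = 0
  lie_zero : DR.lie ξ ω = 0
  moment : RepresentsMoment ω w
  moment_deg : w ∈ deg k I A c
  moment_zero : ξ.1 w = 0

end Moment

/-! ### Free products over `R` -/

variable (k I A)

/-- The relations that define `A *_R R[t]` as a quotient of the tensor algebra of the `k`-module
`A ⊕ R[t]`. -/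
inductive FreeProd.Rel : TensorAlgebra k (A × Polynomial (I → k)) →
    TensorAlgebra k (A × Polynomial (I → k)) → Prop
  | one : Rel (TensorAlgebra.ι k (1, 0)) 1
  | mul_left (a b : A) : Rel (TensorAlgebra.ι k (a * b, 0))
      (TensorAlgebra.ι k (a, 0) * TensorAlgebra.ι k (b, 0))
  | mul_right (f g : Polynomial (I → k)) : Rel (TensorAlgebra.ι k (0, f * g))
      (TensorAlgebra.ι k (0, f) * TensorAlgebra.ι k (0, g))
  | amalg (r : I → k) : Rel (TensorAlgebra.ι k (str k I A r, 0))
      (TensorAlgebra.ι k (0, Polynomial.C r))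

/-- The free product `A *_R R[t]` of `R`-algebras: the universal algebra that receives algebra
homomorphisms from `A` and from the polynomial ring `R[t]` which agree on `R`. -/
def FreeProd : Type _ := RingQuot (FreeProd.Rel k I A)

instance : Ring (FreeProd k I A) := inferInstanceAs (Ring (RingQuot _))
instance : Algebra k (FreeProd k I A) := inferInstanceAs (Algebra k (RingQuot _))

namespace FreeProd

/-- The canonical map from `A`. -/
def inl (a : A) : FreeProd k I A := RingQuot.mkAlgHom k (Rel k I A) (TensorAlgebra.ι k (a, 0))

/-- The element `t`. -/
def t : FreeProd k I A := RingQuot.mkAlgHom k (Rel k I A) (TensorAlgebra.ι k (0, Polynomial.X))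

/-- The degree `n` part of `A *_R R[t]`, where `A` keeps its grading and `t` has degree `e`: the
span of the products of homogeneous generators of total degree `n`. -/
def degree (e n : ℤ) : Submodule k (FreeProd k I A) :=
  Submodule.span k {x | ∃ l : List (FreeProd k I A × ℤ),
    (∀ y ∈ l, (∃ a ∈ deg k I A y.2, y.1 = inl k I A a) ∨ (y.1 = t k I A ∧ y.2 = e)) ∧
    (l.map Prod.snd).sum = n ∧ x = (l.map Prod.fst).prod}

end FreeProd

variable {k I A}

/-- `φ` is an isomorphism of dg `R`-algebras from the free product `A *_R R[t]`, graded with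
`t` in degree `c - 1` and with the differential given by `a ↦ ξ a` and `t ↦ w`, to the graded
`R`-algebra `G` with differential `d` (a super-derivation of degree `1` over `R` of square zero, hence
determined by its values on generators). -/
structure IsGinzburgIso {G : Type*} [Ring G] [Algebra k G] [GrAlg k I G] (c : ℤ)
    (ξ : sder k I A 1) (w : A) (d : G →ₗ[k] G) (φ : FreeProd k I A ≃ₐ[k] G) : Prop where
  map_str : ∀ r, φ (FreeProd.inl k I A (str k I A r)) = str k I G r
  map_degree : ∀ n, (FreeProd.degree k I A (c - 1) n).map φ.toLinearMap = deg k I G n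
  superder : d ∈ sder k I G 1
  sq_zero : ∀ x, d (d x) = 0
  d_inl : ∀ a, d (φ (FreeProd.inl k I A a)) = φ (FreeProd.inl k I A (ξ.1 a))
  d_t : d (φ (FreeProd.t k I A)) = φ (FreeProd.inl k I A w)

end General

/-! ### Quivers and path algebras -/

/-- A quiver with vertex set `V` and arrow set `E`. -/
structure FinQuiver (V : Type v) (E : Type w) where
  src : E → V
  tgt : E → V

/-- A quiver whose arrows carry integral degrees. -/
structure GrQuiver (V : Type v) (E : Type w) extends FinQuiver V E where
  deg : E → ℤ

section PathAlgebra

variable (k : Type u) [Field k] {V : Type v} {E : Type w} [Fintype V] (Q : GrQuiver V E)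

/-- The relations of the path algebra: the constant paths are orthogonal idempotents with sum `1`,
and `e_{t(a)} a = a = a e_{s(a)}`; products are composed from right to left. -/
inductive PathAlg.Rel : FreeAlgebra k (V ⊕ E) → FreeAlgebra k (V ⊕ E) → Prop
  | sum : Rel (∑ i : V, FreeAlgebra.ι k (Sum.inl i)) 1
  | idem (i : V) : Rel (FreeAlgebra.ι k (Sum.inl i) * FreeAlgebra.ι k (Sum.inl i))
      (FreeAlgebra.ι k (Sum.inl i))
  | orth (i j : V) (h : i ≠ j) : Rel (FreeAlgebra.ι k (Sum.inl i) * FreeAlgebra.ι k (Sum.inl j)) 0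
  | tgt (a : E) : Rel (FreeAlgebra.ι k (Sum.inl (Q.tgt a)) * FreeAlgebra.ι k (Sum.inr a))
      (FreeAlgebra.ι k (Sum.inr a))
  | src (a : E) : Rel (FreeAlgebra.ι k (Sum.inr a) * FreeAlgebra.ι k (Sum.inl (Q.src a)))
      (FreeAlgebra.ι k (Sum.inr a))

/-- The path algebra of a (graded) quiver. -/
def PathAlg : Type (max u v w) := RingQuot (PathAlg.Rel k Q)

instance : Ring (PathAlg k Q) := inferInstanceAs (Ring (RingQuot _))
instance : Algebra k (PathAlg k Q) := inferInstanceAs (Algebra k (RingQuot _))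

namespace PathAlg

/-- The projection from the free algebra. -/
def proj : FreeAlgebra k (V ⊕ E) →ₐ[k] PathAlg k Q := RingQuot.mkAlgHom k (Rel k Q)

theorem proj_rel {x y : FreeAlgebra k (V ⊕ E)} (h : Rel k Q x y) : proj k Q x = proj k Q y :=
  RingQuot.mkAlgHom_rel k h

/-- The constant path `e_i`. -/
def vert (i : V) : PathAlg k Q := proj k Q (FreeAlgebra.ι k (Sum.inl i))

/-- An arrow, as an element of the path algebra. -/
def arrow (a : E) : PathAlg k Q := proj k Q (FreeAlgebra.ι k (Sum.inr a))

theorem sum_vert : ∑ i, vert k Q i = 1 := by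
  simpa [vert] using proj_rel k Q Rel.sum

theorem vert_mul_self (i : V) : vert k Q i * vert k Q i = vert k Q i := by
  simpa [vert] using proj_rel k Q (Rel.idem i)

theorem vert_mul_of_ne {i j : V} (h : i ≠ j) : vert k Q i * vert k Q j = 0 := by
  simpa [vert] using proj_rel k Q (Rel.orth i j h)

theorem tgt_mul (a : E) : vert k Q (Q.tgt a) * arrow k Q a = arrow k Q a := by
  simpa [vert, arrow] using proj_rel k Q (Rel.tgt a)

theorem mul_src (a : E) : arrow k Q a * vert k Q (Q.src a) = arrow k Q a := by
  simpa [vert, arrow] using proj_rel k Q (Rel.src a)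

theorem arrow_mul_of_ne {a : E} {i : V} (h : Q.src a ≠ i) : arrow k Q a * vert k Q i = 0 := by
  rw [← mul_src, mul_assoc, vert_mul_of_ne k Q h, mul_zero]

section Lift

variable {k Q} {B : Type*} [Ring B] [Algebra k B] (e : V → B) (x : E → B)
  (hsum : ∑ i, e i = 1) (hidem : ∀ i, e i * e i = e i) (horth : ∀ i j, i ≠ j → e i * e j = 0)
  (htgt : ∀ a, e (Q.tgt a) * x a = x a) (hsrc : ∀ a, x a * e (Q.src a) = x a)

/-- The universal property of the path algebra. -/
def lift : PathAlg k Q →ₐ[k] B :=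
  RingQuot.liftAlgHom k ⟨FreeAlgebra.lift k (Sum.elim e x), by
    rintro _ _ (_ | i | ⟨i, j, h⟩ | a | a)
    · simp [hsum]
    · simp [hidem]
    · simp [horth i j h]
    · simp [htgt]
    · simp [hsrc]⟩

@[simp]
theorem lift_vert (i : V) : lift (Q := Q) e x hsum hidem horth htgt hsrc (vert k Q i) = e i := by
  simp only [lift, vert, proj]
  erw [RingQuot.liftAlgHom_mkAlgHom_apply]
  simp

@[simp]
theorem lift_arrow (a : E) : lift (Q := Q) e x hsum hidem horth htgt hsrc (arrow k Q a) = x a := by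
  simp only [lift, arrow, proj]
  erw [RingQuot.liftAlgHom_mkAlgHom_apply]
  simp

theorem hom_ext {f g : PathAlg k Q →ₐ[k] B} (hv : ∀ i, f (vert k Q i) = g (vert k Q i))
    (ha : ∀ a, f (arrow k Q a) = g (arrow k Q a)) : f = g := by
  refine RingQuot.ringQuot_ext' k f g (FreeAlgebra.hom_ext (funext fun i => ?_))
  rcases i with i | a
  · exact hv i
  · exact ha a

end Lift

/-- The product of a list of arrows. -/
def word (l : List E) : PathAlg k Q := (l.map (arrow k Q)).prod

/-- The degree `n` part of the path algebra: the span of the paths whose arrows have total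
degree `n`. -/
def grading (n : ℤ) : Submodule k (PathAlg k Q) :=
  Submodule.span k {x | ∃ (i : V) (l : List E), (l.map Q.deg).sum = n ∧ x = vert k Q i * word k Q l}

variable {k Q}

theorem vert_mul_word_mem (i : V) (l : List E) :
    vert k Q i * word k Q l ∈ grading k Q (l.map Q.deg).sum :=
  Submodule.subset_span ⟨i, l, rfl, rfl⟩

theorem word_mem (l : List E) : word k Q l ∈ grading k Q (l.map Q.deg).sum := by
  rw [← one_mul (word k Q l), ← sum_vert, Finset.sum_mul]
  exact Submodule.sum_mem _ fun i _ => vert_mul_word_mem i l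

theorem vert_mem (i : V) : vert k Q i ∈ grading k Q 0 := by
  simpa [word] using vert_mul_word_mem (k := k) (Q := Q) i []

theorem arrow_mem (a : E) : arrow k Q a ∈ grading k Q (Q.deg a) := by
  simpa [word] using word_mem (k := k) (Q := Q) [a]

instance : SetLike.GradedMonoid (grading k Q) where
  one_mem := by
    rw [← sum_vert]
    exact Submodule.sum_mem _ fun i _ => vert_mem i
  mul_mem := by
    intro m n x y hx hy
    refine Submodule.span_induction₂ (p := fun x y _ _ => x * y ∈ grading k Q (m + n))
      ?_ ?_ ?_ ?_ ?_ ?_ ?_ hx hy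
    · rintro _ _ ⟨i, l, rfl, rfl⟩ ⟨j, l', rfl, rfl⟩
      have hll : vert k Q i * word k Q (l ++ l') ∈ grading k Q ((l.map Q.deg).sum +
          (l'.map Q.deg).sum) := by
        simpa using vert_mul_word_mem (k := k) (Q := Q) i (l ++ l')
      have e : vert k Q i * word k Q l * (vert k Q j * word k Q l') =
          vert k Q i * (word k Q l * vert k Q j) * word k Q l' := by simp only [mul_assoc]
      rw [e]
      induction l using List.reverseRecOn with
      | nil =>
        by_cases h : i = j
        · subst h
          simpa [word, vert_mul_self] using hll
        · simp [word, vert_mul_of_ne k Q h]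
      | append_singleton l a _ =>
        by_cases h : Q.src a = j
        · subst h
          simpa [word, mul_assoc, mul_src] using hll
        · simp [word, mul_assoc, arrow_mul_of_ne k Q h]
    · simp
    · simp
    · intro x y z _ _ _ h h'
      rw [add_mul]; exact add_mem h h'
    · intro x y z _ _ _ h h'
      rw [mul_add]; exact add_mem h h'
    · intro c x y _ _ h
      rw [smul_mul_assoc]; exact Submodule.smul_mem _ _ h
    · intro c x y _ _ h
      rw [mul_smul_comm]; exact Submodule.smul_mem _ _ h

theorem of_mul_of' {m n p : ℤ} {x y z : PathAlg k Q} (hx : x ∈ grading k Q m)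
    (hy : y ∈ grading k Q n) (hz : z ∈ grading k Q p) (h : m + n = p) (e : x * y = z) :
    DirectSum.of (fun n => grading k Q n) m ⟨x, hx⟩ *
      DirectSum.of (fun n => grading k Q n) n ⟨y, hy⟩ =
      DirectSum.of (fun n => grading k Q n) p ⟨z, hz⟩ := by
  subst h e
  rw [DirectSum.of_mul_of]
  rfl

theorem of_zero' {m : ℤ} (h : (0 : PathAlg k Q) ∈ grading k Q m) :
    DirectSum.of (fun n => grading k Q n) m ⟨0, h⟩ = 0 :=
  map_zero (DirectSum.of (fun n => grading k Q n) m)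

variable (k Q) in
/-- The decomposition of the path algebra into its homogeneous components. -/
def decomp : PathAlg k Q →ₐ[k] ⨁ n, grading k Q n :=
  lift (fun i => DirectSum.of (fun n => grading k Q n) 0 ⟨vert k Q i, vert_mem i⟩)
    (fun a => DirectSum.of (fun n => grading k Q n) (Q.deg a) ⟨arrow k Q a, arrow_mem a⟩)
    (by
      rw [← map_sum, DirectSum.one_def]
      congr 1
      ext
      simp [sum_vert])
    (fun i => of_mul_of' _ _ _ (by simp) (vert_mul_self k Q i))
    (fun i j h => (of_mul_of' _ _ (zero_mem _) (zero_add 0) (vert_mul_of_ne k Q h)).trans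
      (of_zero' _))
    (fun a => of_mul_of' _ _ _ (by simp) (tgt_mul k Q a))
    (fun a => of_mul_of' _ _ _ (by simp) (mul_src k Q a))

theorem decomp_word (l : List E) : decomp k Q (word k Q l) =
    DirectSum.of (fun n => grading k Q n) (l.map Q.deg).sum ⟨word k Q l, word_mem l⟩ := by
  induction l with
  | nil => simp [word]; rfl
  | cons a l ih =>
    have h1 : decomp k Q (word k Q (a :: l)) = decomp k Q (arrow k Q a) * decomp k Q (word k Q l) := by
      rw [← map_mul]; simp [word]
    rw [h1, ih, decomp, lift_arrow]
    exact of_mul_of' _ _ _ (by simp) (by simp [word])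

instance : GradedAlgebra (grading k Q) :=
  GradedAlgebra.ofAlgHom _ (decomp k Q)
    (hom_ext (fun i => by simp [decomp]) (fun a => by simp [decomp]))
    (by
      rintro n ⟨x, hx⟩
      refine Submodule.span_induction (p := fun x hx => decomp k Q x =
        DirectSum.of (fun n => grading k Q n) n ⟨x, hx⟩) ?_ ?_ ?_ ?_ hx
      · rintro _ ⟨i, l, rfl, rfl⟩
        rw [map_mul, decomp_word, decomp, lift_vert]
        exact of_mul_of' _ _ _ (by simp) rfl
      · rw [map_zero]; exact (map_zero _).symm
      · intro x y hx hy h h'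
        rw [map_add, h, h', ← map_add]; rfl
      · intro c x hx h
        rw [map_smul, h, ← DirectSum.lof_eq_of k, ← map_smul]; rfl)

variable (k Q) in
/-- The inclusion of `R = kV`, `r ↦ ∑ i, r i • e_i`. -/
def ofFun : (V → k) →ₐ[k] PathAlg k Q :=
  AlgHom.ofLinearMap
    { toFun := fun r => ∑ i, r i • vert k Q i
      map_add' := fun r r' => by simp [add_smul, Finset.sum_add_distrib]
      map_smul' := fun c r => by simp [Finset.smul_sum, mul_smul] }
    (by simp [sum_vert])
    (fun r r' => by
      classical
      simp only [LinearMap.coe_mk, AddHom.coe_mk, Finset.sum_mul_sum]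
      refine Finset.sum_congr rfl fun i _ => ?_
      rw [Finset.sum_eq_single i]
      · simp [vert_mul_self, smul_smul, mul_comm]
      · intro j _ h
        simp [vert_mul_of_ne k Q h.symm]
      · simp)

/-- The path algebra as a graded algebra over `R = kV`. -/
instance : GrAlg k V (PathAlg k Q) where
  str := ofFun k Q
  deg := grading k Q
  str_mem _ := Submodule.sum_mem _ fun i _ => Submodule.smul_mem _ _ (vert_mem i)

end PathAlg

end PathAlgebra

section PathDerivations

variable {k : Type u} [Field k] {V : Type v} {E : Type w} [Fintype V] {Q : GrQuiver V E}

namespace PathAlg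

theorem induction {p : PathAlg k Q → Prop} (hv : ∀ i, p (vert k Q i)) (ha : ∀ a, p (arrow k Q a))
    (hs : ∀ c : k, p (algebraMap k _ c)) (add : ∀ x y, p x → p y → p (x + y))
    (mul : ∀ x y, p x → p y → p (x * y)) (x) : p x := by
  let S : Subalgebra k (PathAlg k Q) :=
    { carrier := {x | p x}
      add_mem' := fun hx hy => add _ _ hx hy
      mul_mem' := fun hx hy => mul _ _ hx hy
      algebraMap_mem' := hs }
  let L : PathAlg k Q →ₐ[k] S := lift (fun i => ⟨vert k Q i, hv i⟩) (fun a => ⟨arrow k Q a, ha a⟩)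
    (Subtype.ext (by simpa using sum_vert k Q)) (fun i => Subtype.ext (vert_mul_self k Q i))
    (fun i j h => Subtype.ext (vert_mul_of_ne k Q h)) (fun a => Subtype.ext (tgt_mul k Q a))
    (fun a => Subtype.ext (mul_src k Q a))
  have : S.val.comp L = AlgHom.id k _ := hom_ext (fun i => by simp [L]) (fun a => by simp [L])
  have hx := DFunLike.congr_fun this x
  simp only [AlgHom.comp_apply, AlgHom.id_apply] at hx
  rw [← hx]
  exact (L x).2

section Der

variable {B : Type*} [Ring B] [Algebra k B] (f g : PathAlg k Q →ₐ[k] B) (x : E → B)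

/-- The matrix homomorphism `y ↦ !![f y, d y; 0, g y]` that defines the derivation below. -/
def derMat : PathAlg k Q →ₐ[k] Matrix (Fin 2) (Fin 2) B :=
  lift (fun i => !![f (vert k Q i), 0; 0, g (vert k Q i)])
    (fun a => !![f (arrow k Q a), f (vert k Q (Q.tgt a)) * x a * g (vert k Q (Q.src a));
      0, g (arrow k Q a)])
    (by
      have h : ∀ i : V, (!![f (vert k Q i), 0; 0, g (vert k Q i)] : Matrix (Fin 2) (Fin 2) B) =
          Omega.triLin f.toLinearMap 0 g.toLinearMap (vert k Q i) := fun i => by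
        simp [Omega.triLin]
      simp only [h, ← map_sum, sum_vert]
      ext i j
      fin_cases i <;> fin_cases j <;> simp [Omega.triLin])
    (fun i => by
      ext i j
      fin_cases i <;> fin_cases j <;> simp [← map_mul, vert_mul_self])
    (fun i j h => by
      ext i j
      fin_cases i <;> fin_cases j <;> simp [← map_mul, vert_mul_of_ne k Q h])
    (fun a => by
      ext i j
      fin_cases i <;> fin_cases j <;>
        simp [← mul_assoc, ← map_mul, vert_mul_self, tgt_mul])
    (fun a => by
      ext i j
      fin_cases i <;> fin_cases j <;>
        simp [mul_assoc, ← map_mul, vert_mul_self, mul_src])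

/-- The unique linear map `d` with `d (y z) = d y * g z + f y * d z` that vanishes on the constant
paths and sends each arrow `a` to `e_{t(a)} x_a e_{s(a)}`. -/
def der : PathAlg k Q →ₗ[k] B :=
  (Matrix.entryLinearMap k B (0 : Fin 2) (1 : Fin 2)) ∘ₗ (derMat f g x).toLinearMap

theorem derMat_apply (y : PathAlg k Q) : derMat f g x y = !![f y, der f g x y; 0, g y] := by
  have key : ∀ y, derMat f g x y 0 0 = f y ∧ derMat f g x y 1 0 = 0 ∧
      derMat f g x y 1 1 = g y := by
    intro y
    induction y using PathAlg.induction with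
    | hv a => simp [derMat]
    | ha a => simp [derMat]
    | hs c => simp [Matrix.algebraMap_matrix_apply]
    | add x y hx hy => simp [hx, hy]
    | mul x y hx hy => simp [hx, hy, Matrix.mul_apply, Fin.sum_univ_two]
  obtain ⟨k1, k2, k3⟩ := key y
  ext i j
  fin_cases i <;> fin_cases j <;> simp [k1, k2, k3, der]

@[simp]
theorem der_vert (i : V) : der f g x (vert k Q i) = 0 := by simp [der, derMat]

@[simp]
theorem der_arrow (a : E) : der f g x (arrow k Q a) =
    f (vert k Q (Q.tgt a)) * x a * g (vert k Q (Q.src a)) := by simp [der, derMat]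

theorem der_mul (y z : PathAlg k Q) :
    der f g x (y * z) = der f g x y * g z + f y * der f g x z := by
  have h := map_mul (derMat f g x) y z
  have h' := congrFun (congrFun h 0) 1
  simp only [derMat_apply] at h'
  simpa [Matrix.mul_apply, Fin.sum_univ_two, add_comm] using h'

theorem der_algebraMap (c : k) : der f g x (algebraMap k _ c) = 0 := by
  have h : der f g x 1 = 0 := by simpa using der_mul f g x 1 1
  rw [Algebra.algebraMap_eq_smul_one, map_smul, h, smul_zero]

end Der

/-- The homomorphism of path algebras induced by a morphism of quivers that is the identity on
vertices. -/
def map {E' : Type*} {Q' : GrQuiver V E'} (h : E → E') (hsrc : ∀ a, Q'.src (h a) = Q.src a)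
    (htgt : ∀ a, Q'.tgt (h a) = Q.tgt a) : PathAlg k Q →ₐ[k] PathAlg k Q' :=
  lift (vert k Q') (fun a => arrow k Q' (h a)) (sum_vert k Q') (vert_mul_self k Q')
    (fun _ _ hij => vert_mul_of_ne k Q' hij) (fun a => by rw [← htgt, tgt_mul])
    (fun a => by rw [← hsrc, mul_src])

theorem map_vert {E' : Type*} {Q' : GrQuiver V E'} (h : E → E')
    (hsrc : ∀ a, Q'.src (h a) = Q.src a) (htgt : ∀ a, Q'.tgt (h a) = Q.tgt a) (i : V) :
    map (k := k) h hsrc htgt (vert k Q i) = vert k Q' i := by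
  simp [map]

section Cyclic

/-- The double derivation of the path algebra with `a ↦ e_{t(a)} ⊗ e_{s(a)}` that vanishes on
all other arrows. -/
def partialDer [DecidableEq E] (a : E) : PathAlg k Q →ₗ[k] PathAlg k Q ⊗[k] PathAlg k Q :=
  der Algebra.TensorProduct.includeLeft Algebra.TensorProduct.includeRight
    (fun b => if b = a then 1 else 0)

/-- The cyclic derivative with respect to the arrow `a`; see `cyclicDer_word`. -/
def cyclicDer [DecidableEq E] (a : E) : PathAlg k Q →ₗ[k] PathAlg k Q :=
  LinearMap.mul' k _ ∘ₗ (TensorProduct.comm k _ _).toLinearMap ∘ₗ partialDer a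

theorem mul_comm_rotate (z : PathAlg k Q ⊗[k] PathAlg k Q) (y : PathAlg k Q) :
    LinearMap.mul' k _ (TensorProduct.comm k _ _ (z * (1 ⊗ₜ[k] y))) =
      LinearMap.mul' k _ (TensorProduct.comm k _ _ ((y ⊗ₜ[k] 1) * z)) := by
  induction z using TensorProduct.induction_on with
  | zero => simp
  | add z z' h h' => simp only [add_mul, mul_add, map_add, h, h']
  | tmul x x' => simp [mul_assoc]

theorem cyclicDer_mul_comm [DecidableEq E] (a : E) (x y : PathAlg k Q) :
    cyclicDer a (x * y) = cyclicDer a (y * x) := by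
  simp only [cyclicDer, LinearMap.comp_apply, LinearEquiv.coe_coe, partialDer, der_mul, map_add,
    Algebra.TensorProduct.includeLeft_apply, Algebra.TensorProduct.includeRight_apply,
    mul_comm_rotate]
  rw [add_comm]

theorem partialDer_word [DecidableEq E] (a : E) (l : List E) : partialDer (k := k) (Q := Q) a (word k Q l) =
    ∑ j : Fin l.length, if l[j] = a then (word k Q (l.take j) * vert k Q (Q.tgt a)) ⊗ₜ[k]
      (vert k Q (Q.src a) * word k Q (l.drop (j + 1))) else 0 := by
  induction l with
  | nil =>
    have h := der_algebraMap (Q := Q) (Algebra.TensorProduct.includeLeft :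
      _ →ₐ[k] PathAlg k Q ⊗[k] PathAlg k Q) Algebra.TensorProduct.includeRight
      (fun b => if b = a then 1 else 0) 1
    simpa [word, partialDer] using h
  | cons b l ih =>
    have e : word k Q (b :: l) = arrow k Q b * word k Q l := by simp [word]
    have h : partialDer (k := k) (Q := Q) a (arrow k Q b * word k Q l) =
        partialDer a (arrow k Q b) * (1 ⊗ₜ[k] word k Q l) +
          (arrow k Q b ⊗ₜ[k] 1) * partialDer a (word k Q l) := der_mul _ _ _ _ _
    rw [e, h, ih, Finset.mul_sum]
    simp only [List.length_cons]
    rw [Fin.sum_univ_succ]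
    congr 1
    · by_cases hb : b = a
      · subst hb
        simp [partialDer, word]
      · simp [partialDer, hb]
    · refine Finset.sum_congr rfl fun j _ => ?_
      have e' : word k Q (b :: l.take j) = arrow k Q b * word k Q (l.take j) := by simp [word]
      by_cases hb : l[(j : ℕ)] = a
      · simp [hb, e', mul_assoc]
      · simp [hb]

/-- The cyclic derivative of a word `a_n ⋯ a_1` is the sum, over the positions `j` with `a_j = a`,
of `a_{j-1} ⋯ a_1 a_n ⋯ a_{j+1}` (understood as a path from `t(a)` to `s(a)`). -/
theorem cyclicDer_word [DecidableEq E] (a : E) (l : List E) : cyclicDer (k := k) (Q := Q) a (word k Q l) =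
    ∑ j : Fin l.length, if l[j] = a then vert k Q (Q.src a) * word k Q (l.drop (j + 1)) *
      (word k Q (l.take j) * vert k Q (Q.tgt a)) else 0 := by
  simp only [cyclicDer, LinearMap.comp_apply, partialDer_word, map_sum]
  refine Finset.sum_congr rfl fun j _ => ?_
  split_ifs <;> simp

theorem cyclicDer_vert [DecidableEq E] (a : E) (i : V) : cyclicDer a (vert k Q i) = 0 := by
  simp [cyclicDer, partialDer]

end Cyclic

end PathAlg

end PathDerivations

/-! ### Quivers with potential -/

section Potential

variable {V : Type v} {E : Type w}

/-- `Q`, with all arrows in degree `0`. -/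
def FinQuiver.plain (Q : FinQuiver V E) : GrQuiver V E where
  src := Q.src
  tgt := Q.tgt
  deg := 0

/-- The double quiver: `Sum.inl a` is the arrow `a` in degree `0`, `Sum.inr a` is the reverse arrow
`a*` in degree `-1`. -/
def FinQuiver.double (Q : FinQuiver V E) : GrQuiver V (E ⊕ E) where
  src := Sum.elim Q.src Q.tgt
  tgt := Sum.elim Q.tgt Q.src
  deg := Sum.elim 0 (-1)

/-- The double quiver together with the loops `t_i = Sum.inr i` in degree `-2`. -/
def FinQuiver.hat (Q : FinQuiver V E) : GrQuiver V ((E ⊕ E) ⊕ V) where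
  src := Sum.elim Q.double.src id
  tgt := Sum.elim Q.double.tgt id
  deg := Sum.elim Q.double.deg (-2)

variable (k : Type u) [Field k] [Fintype V] (Q : FinQuiver V E)

/-- The subspace `[kQ, kQ]`. -/
def commutators : Submodule k (PathAlg k Q.plain) :=
  Submodule.span k {z | ∃ x y, z = x * y - y * x}

/-- Potentials: the elements of `kQ / [kQ, kQ]`. -/
abbrev Potential : Type _ := PathAlg k Q.plain ⧸ commutators k Q

/-- The class of an element of `kQ` in `kQ / [kQ, kQ]`. -/
abbrev Potential.mk : PathAlg k Q.plain →ₗ[k] Potential k Q := (commutators k Q).mkQ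

/-- The inclusion of `kQ` into the path algebra of the double quiver. -/
def toDouble : PathAlg k Q.plain →ₐ[k] PathAlg k Q.double :=
  PathAlg.map Sum.inl (fun _ => rfl) (fun _ => rfl)

/-- The inclusion of `kQ` into the path algebra of `Q.hat`. -/
def toHat : PathAlg k Q.plain →ₐ[k] PathAlg k Q.hat :=
  PathAlg.map (fun a => Sum.inl (Sum.inl a)) (fun _ => rfl) (fun _ => rfl)

variable {k Q} in
/-- The derivative `∂W/∂a` of a potential. -/
def Potential.deriv [DecidableEq E] (a : E) : Potential k Q →ₗ[k] PathAlg k Q.plain :=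
  (commutators k Q).liftQ (PathAlg.cyclicDer a) (by
    rw [commutators, Submodule.span_le]
    rintro _ ⟨x, y, rfl⟩
    simp [PathAlg.cyclicDer_mul_comm a x y])

/-- The arrow `a`, in the path algebra of the double quiver. -/
def arr (a : E) : PathAlg k Q.double := PathAlg.arrow k Q.double (Sum.inl a)

/-- The arrow `a*`, in the path algebra of the double quiver. -/
def arrStar (a : E) : PathAlg k Q.double := PathAlg.arrow k Q.double (Sum.inr a)

/-- The arrow `a`, in `Γ`. -/
def hatArr (a : E) : PathAlg k Q.hat := PathAlg.arrow k Q.hat (Sum.inl (Sum.inl a))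

/-- The arrow `a*`, in `Γ`. -/
def hatStar (a : E) : PathAlg k Q.hat := PathAlg.arrow k Q.hat (Sum.inl (Sum.inr a))

/-- The loop `t_i`, in `Γ`. -/
def hatLoop (i : V) : PathAlg k Q.hat := PathAlg.arrow k Q.hat (Sum.inr i)

variable [Fintype E]

variable {k Q} in
/-- The differential of `Γ_{Q,W}`, the path algebra of `Q.hat`: the super-derivation of degree `1` over
`R` with `a ↦ 0`, `a* ↦ ∂W/∂a` and `t_i ↦ e_i (∑ [a, a*]) e_i`. -/
def gammaD [DecidableEq E] (W : Potential k Q) : PathAlg k Q.hat →ₗ[k] PathAlg k Q.hat :=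
  PathAlg.der (twist k V (PathAlg k Q.hat) 1) (AlgHom.id k _)
    (Sum.elim (Sum.elim 0 fun a => toHat k Q (W.deriv a))
      fun _ => ∑ a, (hatArr k Q a * hatStar k Q a - hatStar k Q a * hatArr k Q a))

/-- The two-form `ω = ∑ D(a*) D(a)` on the path algebra of the double quiver. -/
def quiverForm : DR k V (PathAlg k Q.double) :=
  DR.mk k V _ (∑ a, Omega.dA k V _ (arrStar k Q a) * Omega.dA k V _ (arr k Q a))

/-- The element `w = ∑ [a, a*]` of the path algebra of the double quiver. -/
def quiverMoment : PathAlg k Q.double :=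
  ∑ a, (arr k Q a * arrStar k Q a - arrStar k Q a * arr k Q a)

end Potential

/-! ### The values of the differential on generators -/

section Values

variable {V : Type v} {E : Type w} {k : Type u} [Field k] [Fintype V]

theorem PathAlg.twist_vert {Q : GrQuiver V E} (n : ℤ) (i : V) :
    twist k V (PathAlg k Q) n (PathAlg.vert k Q i) = PathAlg.vert k Q i := by
  rw [twist_of_mem n (m := 0) (PathAlg.vert_mem i)]; simp

variable [DecidableEq E]

theorem PathAlg.cyclicDer_sandwich {Q : GrQuiver V E} (a : E) (x : PathAlg k Q) :
    vert k Q (Q.src a) * cyclicDer a x * vert k Q (Q.tgt a) = cyclicDer a x := by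
  let K : PathAlg k Q ⊗[k] PathAlg k Q →ₗ[k] PathAlg k Q ⊗[k] PathAlg k Q :=
    TensorProduct.map (LinearMap.mulRight k (vert k Q (Q.tgt a)))
      (LinearMap.mulLeft k (vert k Q (Q.src a)))
  have hr : ∀ z y, K (z * (1 ⊗ₜ[k] y)) = K z * (1 ⊗ₜ[k] y) := by
    intro z y
    induction z using TensorProduct.induction_on with
    | zero => simp
    | add z z' h h' => simp only [add_mul, map_add, h, h']
    | tmul x x' => simp [K, mul_assoc]
  have hl : ∀ z y, K ((y ⊗ₜ[k] 1) * z) = (y ⊗ₜ[k] 1) * K z := by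
    intro z y
    induction z using TensorProduct.induction_on with
    | zero => simp
    | add z z' h h' => simp only [mul_add, map_add, h, h']
    | tmul x x' => simp [K, mul_assoc]
  have hK : K (partialDer a x) = partialDer a x := by
    induction x using PathAlg.induction with
    | hv i => simp [partialDer]
    | ha b =>
      by_cases hb : b = a
      · subst hb; simp [partialDer, K, vert_mul_self]
      · simp [partialDer, hb]
    | hs c => simp [partialDer, der_algebraMap]
    | add x y hx hy => simp only [map_add, hx, hy]
    | mul x y hx hy =>
      have h : partialDer (k := k) (Q := Q) a (x * y) =
        partialDer a x * (1 ⊗ₜ[k] y) + (x ⊗ₜ[k] 1) * partialDer a y := der_mul _ _ _ _ _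
      rw [h, map_add, hr, hl, hx, hy]
  have hm : ∀ z, LinearMap.mul' k _ (TensorProduct.comm k _ _ (K z)) = vert k Q (Q.src a) *
      LinearMap.mul' k _ (TensorProduct.comm k _ _ z) * vert k Q (Q.tgt a) := by
    intro z
    induction z using TensorProduct.induction_on with
    | zero => simp
    | add z z' h h' => simp only [mul_add, add_mul, map_add, h, h']
    | tmul x x' => simp [K, mul_assoc]
  have h := hm (partialDer a x)
  rw [hK] at h
  exact h.symm

variable {Q : FinQuiver V E} [Fintype E] (W : Potential k Q)

theorem gammaD_arr (a : E) : gammaD W (hatArr k Q a) = 0 :=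
  (PathAlg.der_arrow _ _ _ _).trans (by simp)

theorem gammaD_star (a : E) : gammaD W (hatStar k Q a) = toHat k Q (W.deriv a) := by
  refine (PathAlg.der_arrow _ _ _ _).trans ?_
  rw [PathAlg.twist_vert]
  obtain ⟨x, rfl⟩ := Submodule.mkQ_surjective _ W
  have h1 : ∀ i, PathAlg.vert k Q.hat i = toHat k Q (PathAlg.vert k Q.plain i) := fun i =>
    (PathAlg.map_vert _ _ _ i).symm
  have h := congrArg (toHat k Q) (PathAlg.cyclicDer_sandwich (Q := Q.plain) a x)
  rw [map_mul, map_mul, ← h1, ← h1] at h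
  exact h

theorem gammaD_loop (i : V) : gammaD W (hatLoop k Q i) = PathAlg.vert k Q.hat i *
    (∑ a, (hatArr k Q a * hatStar k Q a - hatStar k Q a * hatArr k Q a)) *
      PathAlg.vert k Q.hat i := by
  refine (PathAlg.der_arrow _ _ _ _).trans ?_
  rw [PathAlg.twist_vert]
  rfl

end Values
end NCForms

end

noncomputable section

namespace NCForms

universe u v w

/-! ### Homogeneous components, contractions and one-forms for a general graded algebra. -/

section General

variable {k : Type u} {I : Type v} {A : Type w} [Field k] [Ring A] [Algebra k A] [GrAlg k I A]

/-! A path algebra is generated by its constant paths and arrows. A derivation over `R` kills the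
constant paths, so it is determined by its values on arrows, and these can be prescribed freely up
to multiplication by the idempotents at the two ends. Dually, the `D b` with `b` an arrow generate
the relative one-forms, subject only to `D b = e_{t(b)} (D b) e_{s(b)}`. Almost every statement is
thus reduced to a computation on arrows (`leibniz_ext`, `span_dOne_arrow`).

Nondegeneracy. The form pairs `a` with `a*`: in `ι_μ(ω)` the coefficient of `D a` is, up to flip and
sign, `μ(a*)`, and the coefficient of `D a*` is minus `μ(a)`. The double derivations dual to the
arrows (`coDer`) read these coefficients off, which gives injectivity; prescribing `μ` on one arrow
gives surjectivity onto the generators `p (D b) q`. The same argument works for `i_θ(ω)` in `DR¹`,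
where cyclicity moves all coefficients to the left of `D b`. Since derivations form a direct sum
over degrees, sums of homogeneous values are separated by degree at the end
(`eq_zero_of_sum_eq_zero`).

The vector field. In the cyclic quotient `D W = ∑ (∂W/∂a) D a` (`mk_dA_toDouble`), so the derivation
`a ↦ 0`, `a* ↦ ∂W/∂a` is the Hamiltonian one. Its square is zero because it maps `a*` into `kQ`,
which it kills. It preserves `ω` because `L_ξ(ω)` is the differential of `D W`.

The moment map. Evaluating `δ` on arrows gives `ι_δ(ω) = D w` (`iota_delta_quiverForm`), and `w` is
unique modulo `R` because the kernel of `D` on a path algebra is `R` (`dA_eq_zero_iff`). Moreover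
`ξ(w) = ∑ [a, ∂W/∂a]`, which vanishes by `sum_arrow_commutator_cyclicDer`: write `δ` as the sum of
the inner commutators of the `∂_a` with `a` and multiply the tensor factors in reversed order.

The dg algebra. The path algebra of `Q.hat` and the free product have matching universal properties,
with `t = ∑ t_i` and `t_i = e_i t`. The differential restricts to `ξ` on the double quiver, and `d²
t_i = e_i ξ(w) e_i = 0`. -/

theorem twist_mem (n : ℤ) {m : ℤ} {a : A} (ha : a ∈ deg k I A m) :
    twist k I A n a ∈ deg k I A m := by
  rw [twist_of_mem n ha]
  exact Submodule.smul_mem _ _ ha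

theorem twist_twist (n : ℤ) (a : A) : twist k I A n (twist k I A n a) = a := by
  rcases Int.even_or_odd n with hn | hn
  · simp [twist_even hn]
  · rw [twist_odd hn, twist_one_twist_one]

variable (k I A) in
/-- The homogeneous components of an element of `A`, as a finitely supported function. -/
def components : A →ₗ[k] (ℤ →₀ A) :=
  (DirectSum.toModule k ℤ (ℤ →₀ A) fun n =>
    Finsupp.lsingle n ∘ₗ (deg k I A n).subtype) ∘ₗ
      (DirectSum.decomposeLinearEquiv (deg k I A)).toLinearMap

theorem components_of_mem {n : ℤ} {a : A} (ha : a ∈ deg k I A n) :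
    components k I A a = Finsupp.single n a := by
  have h : DirectSum.decompose (deg k I A) a = DirectSum.lof k ℤ (fun m => deg k I A m) n ⟨a, ha⟩ :=
    DirectSum.decompose_of_mem _ ha
  simp only [components, LinearMap.comp_apply, LinearEquiv.coe_coe,
    DirectSum.decomposeLinearEquiv_apply, h, DirectSum.toModule_lof]
  rfl

variable (k I A) in
/-- The homogeneous components of an element of `A ⊗ A`, for the total degree. -/
def tenComponents : A ⊗[k] A →ₗ[k] (ℤ →₀ A ⊗[k] A) :=
  Finsupp.lmapDomain (A ⊗[k] A) k (fun p : ℤ × ℤ => p.1 + p.2) ∘ₗ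
    (finsuppTensorFinsupp k k A A ℤ ℤ).toLinearMap ∘ₗ
      TensorProduct.map (components k I A) (components k I A)

/-- `degTen` is only given as a span, with no decomposition attached. This supplies what is needed
of one: a linear map that tells elements of different total degrees apart. -/
theorem tenComponents_of_mem {n : ℤ} {t : A ⊗[k] A} (ht : t ∈ degTen k I A n) :
    tenComponents k I A t = Finsupp.single n t := by
  refine Submodule.span_induction ?_ ?_ ?_ ?_ ht
  · rintro _ ⟨i, j, rfl, x, hx, y, hy, rfl⟩
    simp [tenComponents, components_of_mem hx, components_of_mem hy,
      finsuppTensorFinsupp_single, Finsupp.mapDomain_single]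
  · simp
  · intro x y _ _ hx hy
    simp [hx, hy]
  · intro c x _ hx
    simp [hx]

/-- A family of homogeneous elements of distinct degrees whose sum vanishes is zero. -/
theorem eq_zero_of_sum_eq_zero {X : Type*} [AddCommGroup X] [Module k X]
    (C : X →ₗ[k] (ℤ →₀ X)) (x : ℤ → X) (s : Finset ℤ) (N : ℤ) (hx : ∀ n ∈ s, C (x n) =
      Finsupp.single (n + N) (x n)) (h : ∑ n ∈ s, x n = 0) (n : ℤ) (hn : n ∈ s) : x n = 0 := by
  -- Only the `n`-th summand has a component in degree `n + N`. In the applications `x n` is the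
  -- value of a derivation of degree `n` on an arrow of degree `N`.
  have h1 := congrArg (fun z => C z (n + N)) h
  simp only [map_sum, map_zero, Finsupp.coe_zero, Pi.zero_apply] at h1
  rw [Finset.sum_congr rfl hx, Finsupp.finsetSum_apply, Finset.sum_eq_single n] at h1
  · simpa using h1
  · intro m _ hm
    rw [Finsupp.single_eq_of_ne]
    simpa using hm.symm
  · exact fun h => absurd hn h

namespace Omega

variable (k I A) in
/-- The projection of `Ω_R A` to `A`. -/
def toA : Omega k I A →ₐ[k] A := lift (AlgHom.id k A) 0 (by simp) (by simp)

@[simp] theorem toA_inA (a : A) : toA k I A (inA k I A a) = a := lift_inA _ _ _ _ a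

theorem inA_injective : Function.Injective (inA k I A) :=
  Function.LeftInverse.injective toA_inA

theorem map_inA_injective :
    Function.Injective (Algebra.TensorProduct.map (inA k I A) (inA k I A)) := by
  refine Function.LeftInverse.injective (g := Algebra.TensorProduct.map (toA k I A) (toA k I A))
    fun t => ?_
  rw [← AlgHom.comp_apply, ← Algebra.TensorProduct.map_comp]
  have : (toA k I A).comp (inA k I A) = AlgHom.id k A := AlgHom.ext toA_inA
  rw [this, Algebra.TensorProduct.map_id, AlgHom.id_apply]

/-- The Koszul sign is symmetric in the two factors, so flipping twice squares it. `par_decomp`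
reduces the claim to factors of definite parity. -/
theorem flip_flip [CharZero k] (z : Omega k I A ⊗[k] Omega k I A) :
    flip k I A (flip k I A z) = z := by
  induction z using TensorProduct.induction_on with
  | zero => simp
  | add z z' h h' => simp only [map_add, h, h']
  | tmul x y =>
    induction x using par_decomp with
    | add x z h h' => simp only [TensorProduct.add_tmul, map_add, h, h']
    | h p m x hx =>
    induction y using par_decomp with
    | add x z h h' => simp only [TensorProduct.tmul_add, map_add, h, h']
    | h q n y hy =>
    rw [flip_tmul hx hy, map_smul, flip_tmul hy hx, smul_smul, sign_mul,
      sign_congr k (b := 0) ⟨p * q + m * n, by ring⟩, zpow_zero, one_smul]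

theorem flip_injective [CharZero k] : Function.Injective (flip k I A) :=
  Function.LeftInverse.injective flip_flip

theorem inOne_smul (p q : A) (η : Omega1 k I A) :
    inOne k I A ((p ⊗ₜ[k] MulOpposite.op q : Env k A) • η) =
      inA k I A p * inOne k I A η * inA k I A q :=
  BimodTA.inM_smul k A _ p q η

@[simp] theorem D_inA (a : A) : D k I A (inA k I A a) = dA k I A a := by simp [D]
@[simp] theorem D_dA (a : A) : D k I A (dA k I A a) = 0 := by simp [D]
@[simp] theorem contr_dA {n : ℤ} (θ : sder k I A n) (a : A) :
    contr θ (dA k I A a) = inA k I A (θ.1 a) := by simp [contr]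
@[simp] theorem lie_dA {n : ℤ} (θ : sder k I A n) (a : A) :
    lie θ (dA k I A a) = dA k I A (θ.1 a) := by simp [lie]

theorem map_sgn_map_inA (t : A ⊗[k] A) : Algebra.TensorProduct.map (sgn k I A 1) (sgn k I A 1)
    (Algebra.TensorProduct.map (inA k I A) (inA k I A) t) =
      Algebra.TensorProduct.map (inA k I A) (inA k I A)
        (Algebra.TensorProduct.map (twist k I A 1) (twist k I A 1) t) := by
  induction t using TensorProduct.induction_on with
  | zero => simp
  | add z z' h h' => simp only [map_add, h, h']
  | tmul x x' => simp

theorem map_par_map_inA (t : A ⊗[k] A) : Algebra.TensorProduct.map (par k I A) (par k I A)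
    (Algebra.TensorProduct.map (inA k I A) (inA k I A) t) =
      Algebra.TensorProduct.map (inA k I A) (inA k I A) t := by
  induction t using TensorProduct.induction_on with
  | zero => simp
  | add z z' h h' => simp only [map_add, h, h']
  | tmul x x' => simp

/-- The linear map `A ⊗ A → Ω¹_R A`, `x ⊗ y ↦ ± y (D b) x`. -/
def insert (b : A) : A ⊗[k] A →ₗ[k] Omega k I A :=
  LinearMap.mul' k _ ∘ₗ flip k I A ∘ₗ LinearMap.mulRight k (1 ⊗ₜ[k] dA k I A b) ∘ₗ
    (Algebra.TensorProduct.map (inA k I A) (inA k I A)).toLinearMap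

theorem insert_apply (b : A) (t : A ⊗[k] A) : insert (I := I) b t = LinearMap.mul' k _
    (flip k I A (Algebra.TensorProduct.map (inA k I A) (inA k I A) t * (1 ⊗ₜ[k] dA k I A b))) :=
  rfl

/-- The sign comes from moving `x` past `y (D b)`; the form degrees do not contribute, because `x`
is a zero-form. -/
theorem insert_tmul [CharZero k] {i j m : ℤ} {b x y : A} (hb : b ∈ deg k I A m)
    (hx : x ∈ deg k I A i) (hy : y ∈ deg k I A j) : insert (I := I) b (x ⊗ₜ[k] y) =
      ((-1 : k) ^ (i * (j + m))) • (inA k I A y * dA k I A b * inA k I A x) := by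
  rw [insert_apply, Algebra.TensorProduct.map_tmul, Algebra.TensorProduct.tmul_mul_tmul, mul_one,
    mulFlip_tmul (par_inA_of_mem hx) ((par_inA_of_mem hy).mul (par_dA_of_mem hb))]
  simp

/-- The contraction of `D b * D c` with a double derivation. -/
theorem iota_dA_mul_dA [CharZero k] {n m m' : ℤ} (μ : dder k I A n) {b c : A}
    (hb : b ∈ deg k I A m) (hc : c ∈ deg k I A m') : iota μ (dA k I A b * dA k I A c) =
      insert c (μ.1 b) - ((-1 : k) ^ (m * m')) • insert b (μ.1 c) := by
  have h1 : Algebra.TensorProduct.map (sgn k I A 1) (sgn k I A 1)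
      (Algebra.TensorProduct.map (inA k I A) (inA k I A) (μ.1 c)) = ((-1 : k) ^ (m' + n)) •
        Algebra.TensorProduct.map (inA k I A) (inA k I A) (μ.1 c) := by
    rw [map_sgn_map_inA, degTen_twist (μ.2.2.1 _ _ hc), map_smul]
  -- In the second Leibniz term `D b` multiplies the left tensor factor. Since `m ∘ β` is cyclically
  -- invariant up to sign, it can be carried to the right factor, where the term becomes an
  -- `insert`. The value of `μ` on `c` has form degree `0`, hence `p := 0`.
  have h2 := mulFlip_rotate' (p := 0) (par_dA_of_mem hb)
    (by rw [map_par_map_inA]; simp) h1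
  rw [iota, LinearMap.comp_apply, LinearMap.comp_apply, dcontr_mul μ (par_dA_of_mem hb),
    dcontr_dA, dcontr_dA, map_add, map_add, map_smul, map_smul, h2, smul_smul, sign_mul,
    ← insert_apply, ← insert_apply, sub_eq_add_neg, ← neg_smul]
  congr 2
  -- The degree `n` of the derivation enters only through an even number; the summand `1`, from the
  -- form degree of `D b`, gives the minus sign.
  rw [show 1 + n * m + (0 * 1 + (m' + n) * m) = 1 + (2 * (n * m) + m * m') by ring,
    ← sign_mul, zpow_one, neg_one_mul, sign_congr k (b := m * m') ⟨n * m, by ring⟩]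

end Omega

theorem DR.mk_comm {p m q n : ℤ} {x y : Omega k I A} (hx : Omega.Par p m x)
    (hy : Omega.Par q n y) :
    DR.mk k I A (x * y) = ((-1 : k) ^ (p * q + m * n)) • DR.mk k I A (y * x) := by
  rw [← map_smul, ← sub_eq_zero, ← map_sub]
  exact (Submodule.Quotient.mk_eq_zero _).2 (Submodule.subset_span ⟨p, m, q, n, x, y, hx, hy, rfl⟩)

@[simp] theorem DR.D_mk (x : Omega k I A) :
    DR.D k I A (DR.mk k I A x) = DR.mk k I A (Omega.D k I A x) := rfl

@[simp] theorem DR.contr_mk {n : ℤ} (θ : sder k I A n) (x : Omega k I A) :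
    DR.contr θ (DR.mk k I A x) = DR.mk k I A (Omega.contr θ x) := rfl

@[simp] theorem DR.lie_mk {n : ℤ} (θ : sder k I A n) (x : Omega k I A) :
    DR.lie θ (DR.mk k I A x) = DR.mk k I A (Omega.lie θ x) := rfl

@[simp] theorem DR.iota_mk [CharZero k] {n : ℤ} (μ : dder k I A n) (x : Omega k I A) :
    DR.iota μ (DR.mk k I A x) = Omega.iota μ x := rfl

theorem contrForm_lof (ω : DR k I A) {n : ℤ} (θ : sder k I A n) :
    contrForm ω (DirectSum.lof k ℤ _ n θ) = DR.contr θ ω := by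
  simp [contrForm, DirectSum.toModule_lof]

theorem iotaForm_lof [CharZero k] (ω : DR k I A) {n : ℤ} (μ : dder k I A n) :
    iotaForm ω (DirectSum.lof k ℤ _ n μ) = DR.iota μ ω := by
  simp [iotaForm, DirectSum.toModule_lof]

/-- The contraction of `D b * D c` with a super-derivation, in `DR_R(A)`. -/
theorem DR.contr_dA_mul_dA {n m m' : ℤ} (θ : sder k I A n) {b c : A}
    (hb : b ∈ deg k I A m) (hc : c ∈ deg k I A m') :
    DR.contr θ (DR.mk k I A (Omega.dA k I A b * Omega.dA k I A c)) =
      DR.mk k I A (Omega.inA k I A (θ.1 b) * Omega.dA k I A c) -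
        ((-1 : k) ^ (m * m')) • DR.mk k I A (Omega.inA k I A (θ.1 c) * Omega.dA k I A b) := by
  -- Cyclicity turns `(D b) θ(c)` into a multiple of `θ(c) (D b)`, so that both terms have their
  -- coefficient on the left.
  have h := DR.mk_comm (Omega.par_dA_of_mem hb) (Omega.par_inA_of_mem (θ.2.2.1 _ _ hc))
  rw [DR.contr_mk, Omega.contr_mul θ (Omega.par_dA_of_mem hb), Omega.contr_dA, Omega.contr_dA,
    map_add, map_smul, h, smul_smul, sign_mul, sub_eq_add_neg, ← neg_smul]
  congr 2
  rw [show 1 + n * m + (1 * 0 + m * (m' + n)) = 1 + (2 * (n * m) + m * m') by ring,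
    ← sign_mul, zpow_one, neg_one_mul, sign_congr k (b := m * m') ⟨n * m, by ring⟩]

theorem dOne_mem_omega1Deg {n : ℤ} {a : A} (ha : a ∈ deg k I A n) :
    dOne k I A a ∈ omega1Deg k I A n := by
  have h1 : (1 : A) ∈ deg k I A 0 := SetLike.GradedOne.one_mem
  change tmulR (k := k) I a 1 - tmulR I 1 a ∈ Submodule.span k _
  exact Submodule.sub_mem _ (Submodule.subset_span ⟨n, 0, by simp, a, ha, 1, h1, rfl⟩)
    (Submodule.subset_span ⟨0, n, by simp, 1, h1, a, ha, rfl⟩)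

theorem dA_mul_dA_mem_omegaDeg {m n : ℤ} {a b : A} (ha : a ∈ deg k I A m)
    (hb : b ∈ deg k I A n) :
    Omega.dA k I A a * Omega.dA k I A b ∈ omegaDeg k I A 2 (m + n) := by
  have h1 : (1 : A) ∈ deg k I A 0 := SetLike.GradedOne.one_mem
  refine Submodule.subset_span ⟨m, n, rfl, _, ?_, _, dOne_mem_omega1Deg hb, rfl⟩
  -- Forms are built by right multiplication starting from zero-forms, so `D a` has to be read as `1
  -- * D a`.
  refine Submodule.subset_span ⟨0, m, zero_add m, 1, ⟨1, h1, by simp⟩, _, dOne_mem_omega1Deg ha, ?_⟩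
  rw [one_mul]; rfl

/-- The bimodule homomorphism `Ω¹_R A → A ⊗ A` defined by a double derivation without signs. -/
theorem exists_hom_of_doubleDerivation {d : A →ₗ[k] A ⊗[k] A}
    (hd : ∀ a b, d (a * b) = d a * (1 ⊗ₜ[k] b) + (a ⊗ₜ[k] 1) * d b)
    (hR : ∀ r, d (str k I A r) = 0) : ∃ s : Omega1 k I A →ₗ[Env k A] Env k A,
      ∀ a, s (dOne k I A a) = (MulOpposite.opLinearEquiv k).toLinearMap.lTensor A (d a) := by
  -- The universal property available for `Ω¹` has algebras as targets. The outer bimodule `A ⊗ A`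
  -- is therefore placed in the upper right corner of a triangular matrix algebra, with `A` embedded
  -- diagonally as `a ⊗ 1` and `1 ⊗ a`.
  let F : A →ₐ[k] Matrix (Fin 2) (Fin 2) (A ⊗[k] A) := Omega.triAlg
    Algebra.TensorProduct.includeLeft Algebra.TensorProduct.includeRight 0 (by simp)
  let G : A →ₗ[k] Matrix (Fin 2) (Fin 2) (A ⊗[k] A) := Omega.triLin 0 d 0
  have hG : ∀ a b, G (a * b) = G a * F b + F a * G b := by
    intro a b
    ext i j
    fin_cases i <;> fin_cases j <;>
      simp [F, G, Omega.triAlg, Omega.triLin, hd]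
  have hG0 : ∀ r, G (str k I A r) = 0 := by
    intro r
    ext i j
    fin_cases i <;> fin_cases j <;> simp [G, Omega.triLin, hR]
  let s : Omega1 k I A →ₗ[k] Env k A := (MulOpposite.opLinearEquiv k).toLinearMap.lTensor A ∘ₗ
    Matrix.entryLinearMap k (A ⊗[k] A) (0 : Fin 2) (1 : Fin 2) ∘ₗ Omega.liftOne F G hG hG0
  have hs : ∀ a b x, s ((a ⊗ₜ[k] MulOpposite.op b : Env k A) • dOne k I A x) =
      (a ⊗ₜ[k] MulOpposite.op b : Env k A) •
        (MulOpposite.opLinearEquiv k).toLinearMap.lTensor A (d x) := by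
    intro a b x
    have h : (F a * G x * F b) 0 1 = (a ⊗ₜ[k] 1) * d x * (1 ⊗ₜ[k] b) := by
      simp [F, G, Omega.triAlg, Omega.triLin, Matrix.mul_apply, Fin.sum_univ_two]
    simp only [s, LinearMap.comp_apply, Omega.liftOne_smul, Matrix.entryLinearMap_apply, h]
    induction d x using TensorProduct.induction_on with
    | zero => simp
    | add z z' h h' => simp only [mul_add, add_mul, map_add, h, h', smul_add]
    | tmul y z => simp
  -- So far `s` is only `k`-linear. Linearity over the enveloping algebra is checked on the
  -- multiples of the `D x`, which span the one-forms.
  have hsmul : ∀ (z : Env k A) (η : Omega1 k I A), s (z • η) = z • s η := by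
    intro z η
    induction η using omega1_induction with
    | add x y hx hy => simp only [smul_add, map_add, hx, hy]
    | zero => simp
    | mem x y =>
      have e := (mul_smul z ((1 : A) ⊗ₜ[k] MulOpposite.op y : Env k A) (dOne k I A x)).symm
      refine (congrArg s e).trans ?_
      rw [hs, smul_smul]
      generalize z * (1 ⊗ₜ[k] MulOpposite.op y) = z'
      induction z' using TensorProduct.induction_on with
      | zero => exact (congrArg s (zero_smul (Env k A) (dOne k I A x))).trans (by simp)
      | add z z' h h' =>
        exact (congrArg s (add_smul z z' (dOne k I A x))).trans (by rw [map_add, h, h', add_smul])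
      | tmul a b => exact hs a b.unop x
  refine ⟨{ s with map_smul' := hsmul }, fun a => ?_⟩
  have h := hs 1 1 a
  rw [MulOpposite.op_one, ← Algebra.TensorProduct.one_def, one_smul, one_smul] at h
  exact h

end General

/-! ### Derivations and relative one-forms of a path algebra. -/

section PathAlgebras

variable {k : Type u} [Field k] {V : Type v} {E : Type w} [Fintype V] {Q : GrQuiver V E}

namespace PathAlg

theorem str_single [DecidableEq V] (i : V) :
    str k V (PathAlg k Q) (Pi.single i 1) = vert k Q i := by
  change ∑ j, (Pi.single i (1 : k) : V → k) j • vert k Q j = _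
  rw [Finset.sum_eq_single i]
  · simp
  · intro j _ h; simp [h]
  · simp

theorem str_apply (r : V → k) : str k V (PathAlg k Q) r = ∑ i, r i • vert k Q i := rfl

theorem vert_mem_range (i : V) : vert k Q i ∈ (str k V (PathAlg k Q)).range := by
  classical
  exact ⟨Pi.single i 1, str_single i⟩

theorem apply_vert_eq_zero {X : Type*} [AddCommGroup X] [Module k X] {d : PathAlg k Q →ₗ[k] X}
    (h : ∀ r, d (str k V _ r) = 0) (i : V) : d (vert k Q i) = 0 := by
  obtain ⟨r, hr⟩ := vert_mem_range (k := k) (Q := Q) i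
  rw [← hr]
  exact h r

theorem apply_str_eq_zero {X : Type*} [AddCommGroup X] [Module k X] {d : PathAlg k Q →ₗ[k] X}
    (h : ∀ i, d (vert k Q i) = 0) (r : V → k) : d (str k V _ r) = 0 := by
  simp [str_apply, h]

theorem arrow_mem_deg (a : E) : arrow k Q a ∈ deg k V (PathAlg k Q) (Q.deg a) := arrow_mem a

theorem vert_mem_deg (i : V) : vert k Q i ∈ deg k V (PathAlg k Q) 0 := vert_mem i

theorem sandwich_mem {n : ℤ} {x : PathAlg k Q} (hx : x ∈ deg k V (PathAlg k Q) n) (i j : V) :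
    vert k Q i * x * vert k Q j ∈ deg k V (PathAlg k Q) n := by
  simpa using SetLike.mul_mem_graded (SetLike.mul_mem_graded (vert_mem_deg i) hx)
    (vert_mem_deg (k := k) (Q := Q) j)

section Der

variable {B : Type*} [Ring B] [Algebra k B]

/-- The Leibniz rule forces `d 1 = d 1 + d 1`, so scalars are killed and the set of agreement is a
subalgebra. This is the main tool for identities: both sides are shown to be derivations along the
same pair and are compared on arrows. -/
theorem leibniz_ext {f g : PathAlg k Q →ₐ[k] B} {d d' : PathAlg k Q →ₗ[k] B}
    (hd : ∀ x y, d (x * y) = d x * g y + f x * d y)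
    (hd' : ∀ x y, d' (x * y) = d' x * g y + f x * d' y)
    (hv : ∀ i, d (vert k Q i) = d' (vert k Q i)) (ha : ∀ a, d (arrow k Q a) = d' (arrow k Q a)) :
    d = d' := by
  ext x
  induction x using PathAlg.induction with
  | hv i => exact hv i
  | ha a => exact ha a
  | hs c =>
    have h : d 1 = 0 := by simpa using hd 1 1
    have h' : d' 1 = 0 := by simpa using hd' 1 1
    rw [Algebra.algebraMap_eq_smul_one, map_smul, map_smul, h, h']
  | add x y hx hy => simp [hx, hy]
  | mul x y hx hy => rw [hd, hd', hx, hy]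

/-- A derivation along `f` and `g` is homogeneous of degree `n` if it is so on arrows. -/
theorem der_mem {f g : PathAlg k Q →ₐ[k] B} {x : E → B} {n : ℤ} (S : ℤ → Submodule k B)
    (hg : ∀ i m, ∀ y ∈ S i, ∀ z ∈ deg k V (PathAlg k Q) m, y * g z ∈ S (i + m))
    (hf : ∀ i m, ∀ y ∈ S i, ∀ z ∈ deg k V (PathAlg k Q) m, f z * y ∈ S (m + i))
    (hx : ∀ a, x a ∈ S (Q.deg a + n)) {m : ℤ} {y : PathAlg k Q}
    (hy : y ∈ deg k V (PathAlg k Q) m) : der f g x y ∈ S (m + n) := by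
  refine Submodule.span_induction ?_ ?_ ?_ ?_ hy
  · rintro _ ⟨i, l, rfl, rfl⟩
    rw [der_mul, der_vert, zero_mul, zero_add]
    -- The constant path in front of the word is killed by the derivation, so only the word matters;
    -- the induction peels off its first arrow.
    have h : der f g x (word k Q l) ∈ S ((l.map Q.deg).sum + n) := by
      clear hy
      induction l with
      | nil =>
        have h := der_algebraMap f g x 1
        rw [map_one] at h
        simp [word, h]
      | cons a l ih =>
        have e : word k Q (a :: l) = arrow k Q a * word k Q l := by simp [word]
        rw [e, der_mul, List.map_cons, List.sum_cons]
        refine add_mem ?_ ?_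
        · have h3 := hg _ _ _ (hf _ _ _ (hx a) _ (vert_mem (Q.tgt a))) _ (vert_mem (Q.src a))
          have h4 := hg _ _ _ h3 _ (word_mem l)
          rw [der_arrow]
          convert h4 using 2
          ring
        · convert hf _ _ _ ih _ (arrow_mem a) using 2
          ring
    simpa using hf _ _ _ h _ (vert_mem i)
  · simp
  · intro x y _ _ hx hy
    rw [map_add]; exact add_mem hx hy
  · intro c x _ hx
    rw [map_smul]; exact Submodule.smul_mem _ _ hx

end Der

theorem degTen_mul_right {i m : ℤ} {y : PathAlg k Q ⊗[k] PathAlg k Q}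
    (hy : y ∈ degTen k V (PathAlg k Q) i) {z : PathAlg k Q} (hz : z ∈ deg k V (PathAlg k Q) m) :
    y * (1 ⊗ₜ[k] z) ∈ degTen k V (PathAlg k Q) (i + m) := by
  refine Submodule.span_induction ?_ ?_ ?_ ?_ hy
  · rintro _ ⟨i, j, rfl, x, hx, y, hy, rfl⟩
    rw [Algebra.TensorProduct.tmul_mul_tmul, mul_one]
    exact Submodule.subset_span ⟨i, j + m, by ring, x, hx, _, SetLike.mul_mem_graded hy hz, rfl⟩
  · simp
  · intro x y _ _ hx hy
    rw [add_mul]; exact add_mem hx hy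
  · intro c x _ hx
    rw [smul_mul_assoc]; exact Submodule.smul_mem _ _ hx

theorem degTen_mul_left {i m : ℤ} {y : PathAlg k Q ⊗[k] PathAlg k Q}
    (hy : y ∈ degTen k V (PathAlg k Q) i) {z : PathAlg k Q} (hz : z ∈ deg k V (PathAlg k Q) m) :
    (z ⊗ₜ[k] 1) * y ∈ degTen k V (PathAlg k Q) (m + i) := by
  refine Submodule.span_induction ?_ ?_ ?_ ?_ hy
  · rintro _ ⟨i, j, rfl, x, hx, y, hy, rfl⟩
    rw [Algebra.TensorProduct.tmul_mul_tmul, one_mul]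
    exact Submodule.subset_span ⟨m + i, j, by ring, _, SetLike.mul_mem_graded hz hx, y, hy, rfl⟩
  · simp
  · intro x y _ _ hx hy
    rw [mul_add]; exact add_mem hx hy
  · intro c x _ hx
    rw [mul_smul_comm]; exact Submodule.smul_mem _ _ hx

/-- The super-derivation of degree `n` with prescribed values on arrows. -/
def sderOf (n : ℤ) (x : E → PathAlg k Q)
    (hx : ∀ a, x a ∈ deg k V (PathAlg k Q) (Q.deg a + n)) : sder k V (PathAlg k Q) n where
  val := der (twist k V _ n) (AlgHom.id k _) x
  property := by
    refine ⟨apply_str_eq_zero (der_vert _ _ _), fun m a ha => ?_, fun m a ha b => ?_⟩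
    · exact der_mem (deg k V _) (fun i m y hy z hz => SetLike.mul_mem_graded hy hz)
        (fun i m y hy z hz => SetLike.mul_mem_graded (twist_mem n hz) hy) hx ha
    · rw [der_mul, twist_of_mem n ha, smul_mul_assoc]; rfl

theorem sderOf_arrow (n : ℤ) (x : E → PathAlg k Q)
    (hx : ∀ a, x a ∈ deg k V (PathAlg k Q) (Q.deg a + n)) (a : E) :
    (sderOf n x hx).1 (arrow k Q a) = vert k Q (Q.tgt a) * x a * vert k Q (Q.src a) := by
  refine (der_arrow _ _ _ a).trans ?_
  rw [twist_of_mem n (vert_mem_deg _)]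
  simp

/-- The double derivation of degree `n` with prescribed values on arrows. -/
def dderOf (n : ℤ) (x : E → PathAlg k Q ⊗[k] PathAlg k Q)
    (hx : ∀ a, x a ∈ degTen k V (PathAlg k Q) (Q.deg a + n)) : dder k V (PathAlg k Q) n where
  val := der (Algebra.TensorProduct.includeLeft.comp (twist k V _ n))
    Algebra.TensorProduct.includeRight x
  property := by
    refine ⟨apply_str_eq_zero (der_vert _ _ _), fun m a ha => ?_, fun m a ha b => ?_⟩
    · exact der_mem (degTen k V _) (fun i m y hy z hz => degTen_mul_right hy hz)
        (fun i m y hy z hz => degTen_mul_left hy (twist_mem n hz)) hx ha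
    · rw [der_mul, AlgHom.comp_apply, twist_of_mem n ha, map_smul, smul_mul_assoc]; rfl

theorem dderOf_arrow (n : ℤ) (x : E → PathAlg k Q ⊗[k] PathAlg k Q)
    (hx : ∀ a, x a ∈ degTen k V (PathAlg k Q) (Q.deg a + n)) (a : E) :
    (dderOf n x hx).1 (arrow k Q a) =
      (vert k Q (Q.tgt a) ⊗ₜ[k] 1) * x a * (1 ⊗ₜ[k] vert k Q (Q.src a)) := by
  refine (der_arrow _ _ _ a).trans ?_
  rw [AlgHom.comp_apply, twist_of_mem n (vert_mem_deg _)]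
  simp

theorem sder_ext {n : ℤ} {θ η : sder k V (PathAlg k Q) n}
    (h : ∀ a, θ.1 (arrow k Q a) = η.1 (arrow k Q a)) : θ = η :=
  Subtype.ext (leibniz_ext (g := AlgHom.id k _) (sder_mul θ.2) (sder_mul η.2)
    (fun i => by rw [apply_vert_eq_zero θ.2.1, apply_vert_eq_zero η.2.1]) h)

theorem dder_ext {n : ℤ} {μ ν : dder k V (PathAlg k Q) n}
    (h : ∀ a, μ.1 (arrow k Q a) = ν.1 (arrow k Q a)) : μ = ν :=
  Subtype.ext (leibniz_ext (f := Algebra.TensorProduct.includeLeft.comp (twist k V _ n))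
    (g := Algebra.TensorProduct.includeRight) (dder_mul μ.2) (dder_mul ν.2)
    (fun i => by rw [apply_vert_eq_zero μ.2.1, apply_vert_eq_zero ν.2.1]) h)

/-- Constant paths are killed, so applying `θ` to `e_{t(a)} a = a` and to `a e_{s(a)} = a` gives the
two idempotents. Hence the compression built into `sderOf` excludes no derivation. -/
theorem sder_arrow {n : ℤ} (θ : sder k V (PathAlg k Q) n) (a : E) :
    vert k Q (Q.tgt a) * θ.1 (arrow k Q a) * vert k Q (Q.src a) = θ.1 (arrow k Q a) := by
  have h1 := sder_mul θ.2 (vert k Q (Q.tgt a)) (arrow k Q a)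
  have h2 := sder_mul θ.2 (arrow k Q a) (vert k Q (Q.src a))
  rw [tgt_mul, apply_vert_eq_zero θ.2.1, twist_vert, zero_mul, zero_add] at h1
  rw [mul_src, apply_vert_eq_zero θ.2.1, mul_zero, add_zero] at h2
  rw [← h1, ← h2]

theorem dder_arrow {n : ℤ} (μ : dder k V (PathAlg k Q) n) (a : E) :
    (vert k Q (Q.tgt a) ⊗ₜ[k] 1) * μ.1 (arrow k Q a) * (1 ⊗ₜ[k] vert k Q (Q.src a)) =
      μ.1 (arrow k Q a) := by
  have h1 := dder_mul μ.2 (vert k Q (Q.tgt a)) (arrow k Q a)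
  have h2 := dder_mul μ.2 (arrow k Q a) (vert k Q (Q.src a))
  rw [tgt_mul, apply_vert_eq_zero μ.2.1, twist_vert, zero_mul, zero_add] at h1
  rw [mul_src, apply_vert_eq_zero μ.2.1, mul_zero, add_zero] at h2
  rw [← h1, ← h2]

/-- An odd super-derivation whose square vanishes on arrows has square zero. -/
theorem sder_sq_zero (θ : sder k V (PathAlg k Q) 1)
    (h : ∀ a, θ.1 (θ.1 (arrow k Q a)) = 0) (x : PathAlg k Q) : θ.1 (θ.1 x) = 0 := by
  induction x using PathAlg.induction with
  | hv i => rw [apply_vert_eq_zero θ.2.1, map_zero]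
  | ha a => exact h a
  | hs c =>
    have h := θ.2.1 (algebraMap k _ c)
    rw [AlgHom.commutes] at h
    rw [h, map_zero]
  | add x y hx hy => rw [map_add, map_add, hx, hy, add_zero]
  | mul x y hx hy =>
    -- The two mixed terms cancel, because an odd derivation anticommutes with the parity
    -- automorphism; this is the sign in `sder_twist`.
    rw [sder_mul θ.2, map_add, sder_mul θ.2, sder_mul θ.2, hx, hy, sder_twist θ.2]
    simp

/-! ### One-forms on a path algebra -/

theorem dOne_vert (i : V) : dOne k V (PathAlg k Q) (vert k Q i) = 0 :=
  apply_vert_eq_zero (dOne_str k V _) i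

theorem dA_vert (i : V) : Omega.dA k V (PathAlg k Q) (vert k Q i) = 0 :=
  apply_vert_eq_zero (Omega.dA_str k V _) i

theorem dA_arrow (a : E) : Omega.inA k V _ (vert k Q (Q.tgt a)) *
    Omega.dA k V (PathAlg k Q) (arrow k Q a) * Omega.inA k V _ (vert k Q (Q.src a)) =
      Omega.dA k V (PathAlg k Q) (arrow k Q a) := by
  have h1 := Omega.dA_mul k V _ (vert k Q (Q.tgt a)) (arrow k Q a)
  have h2 := Omega.dA_mul k V _ (arrow k Q a) (vert k Q (Q.src a))
  rw [tgt_mul, dA_vert, zero_mul, zero_add] at h1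
  rw [mul_src, dA_vert, mul_zero, add_zero] at h2
  rw [← h1, ← h2]

/-- The elements whose differential lies in the span are closed under products by the Leibniz rule,
and `D` kills constant paths and scalars. -/
theorem span_dOne_arrow : Submodule.span (Env k (PathAlg k Q))
    (Set.range fun a : E => dOne k V (PathAlg k Q) (arrow k Q a)) = ⊤ := by
  rw [eq_top_iff]
  rintro x -
  have key : ∀ a, dOne k V (PathAlg k Q) a ∈ Submodule.span (Env k (PathAlg k Q))
      (Set.range fun a : E => dOne k V (PathAlg k Q) (arrow k Q a)) := by
    intro a
    induction a using PathAlg.induction with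
    | hv i => rw [dOne_vert]; exact zero_mem _
    | ha a => exact Submodule.subset_span ⟨a, rfl⟩
    | hs c =>
      have := dOne_str k V (PathAlg k Q) (algebraMap k _ c)
      rw [AlgHom.commutes] at this
      rw [this]; exact zero_mem _
    | add x y hx hy => rw [map_add]; exact add_mem hx hy
    | mul x y hx hy =>
      rw [dOne_mul]
      exact add_mem (Submodule.smul_mem _ _ hx) (Submodule.smul_mem _ _ hy)
  induction x using omega1_induction with
  | add x y hx hy => exact add_mem hx hy
  | zero => exact zero_mem _
  | mem a b => exact Submodule.smul_mem _ _ (key a)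

/-- The one-forms are spanned by the `p (D a) q`, with `a` an arrow and `p`, `q` homogeneous. -/
theorem oneForms_le {S : Submodule k (Omega k V (PathAlg k Q))}
    (h : ∀ (a : E) (i j : ℤ), ∀ p ∈ deg k V (PathAlg k Q) i, ∀ q ∈ deg k V (PathAlg k Q) j,
      Omega.inA k V _ p * Omega.dA k V _ (arrow k Q a) * Omega.inA k V _ q ∈ S) :
    oneForms k V (PathAlg k Q) ≤ S := by
  rintro _ ⟨η, rfl⟩
  have hη : η ∈ Submodule.span (Env k (PathAlg k Q))
    (Set.range fun a : E => dOne k V (PathAlg k Q) (arrow k Q a)) := by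
    rw [span_dOne_arrow]; trivial
  -- `S` is only a `k`-subspace, while the span is one of bimodules. Quantifying over all multiples
  -- of `η` makes the property stable under the bimodule action.
  suffices ∀ z : Env k (PathAlg k Q), Omega.inOne k V _ (z • η) ∈ S by simpa using this 1
  refine Submodule.span_induction ?_ ?_ ?_ ?_ hη
  · rintro _ ⟨a, rfl⟩ z
    induction z using TensorProduct.induction_on with
    | zero =>
      refine (congrArg (Omega.inOne k V _ · ∈ S) (zero_smul (Env k (PathAlg k Q)) _)).mpr ?_
      rw [map_zero]; exact zero_mem _
    | add z z' h h' =>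
      refine (congrArg (Omega.inOne k V _ · ∈ S) (add_smul z z' _)).mpr ?_
      rw [map_add]; exact add_mem h h'
    | tmul p q =>
      induction q using MulOpposite.rec' with
      | _ q =>
      rw [Omega.inOne_smul]
      change Omega.inA k V _ p * Omega.dA k V _ (arrow k Q a) * Omega.inA k V _ q ∈ S
      induction p using DirectSum.Decomposition.inductionOn (deg k V (PathAlg k Q)) with
      | zero => simp
      | add p p' hp hp' => rw [map_add, add_mul, add_mul]; exact add_mem hp hp'
      | @homogeneous i p =>
      induction q using DirectSum.Decomposition.inductionOn (deg k V (PathAlg k Q)) with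
      | zero => simp
      | add p p' hp hp' => rw [map_add, mul_add]; exact add_mem hp hp'
      | @homogeneous j q => exact h a i j p p.2 q q.2
  · simp
  · intro x y _ _ hx hy z
    rw [smul_add, map_add]; exact add_mem (hx z) (hy z)
  · intro c x _ hx z
    rw [smul_smul]; exact hx _

theorem mul_dA_mul_mem_oneForms (p q a : PathAlg k Q) :
    Omega.inA k V _ p * Omega.dA k V _ a * Omega.inA k V _ q ∈ oneForms k V (PathAlg k Q) :=
  ⟨_, Omega.inOne_smul p q (dOne k V _ a)⟩

/-! ### The kernel of `D` -/

variable (k Q) in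
/-- The augmentation, which sends all arrows to `0`. -/
def augment : PathAlg k Q →ₐ[k] PathAlg k Q :=
  lift (vert k Q) 0 (sum_vert k Q) (vert_mul_self k Q) (fun _ _ h => vert_mul_of_ne k Q h)
    (by simp) (by simp)

theorem augment_mem (x : PathAlg k Q) : augment k Q x ∈ (str k V (PathAlg k Q)).range := by
  induction x using PathAlg.induction with
  | hv i => rw [augment, lift_vert]; exact vert_mem_range i
  | ha a => rw [augment, lift_arrow]; exact zero_mem _
  | hs c => rw [AlgHom.commutes]; exact Subalgebra.algebraMap_mem _ _
  | add x y hx hy => rw [map_add]; exact add_mem hx hy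
  | mul x y hx hy => rw [map_mul]; exact mul_mem hx hy

theorem augment_str (r : V → k) :
    augment k Q (str k V (PathAlg k Q) r) = str k V (PathAlg k Q) r := by
  simp [str_apply, augment]

/-- With `ε` the augmentation, `x ↦ x - ε x` is a derivation along the pair `(id, ε)`, since `xy -
ε(x) ε(y) = (x - ε x) ε(y) + x (y - ε y)`, and it vanishes on `R`. It therefore factors through `D`,
so `D x = 0` forces `x = ε x`, which lies in `R`. This is what makes the moment map unique modulo
`R`. -/
theorem dA_eq_zero_iff {x : PathAlg k Q} :
    Omega.dA k V (PathAlg k Q) x = 0 ↔ x ∈ (str k V (PathAlg k Q)).range := by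
  refine ⟨fun h => ?_, ?_⟩
  · let F : PathAlg k Q →ₐ[k] Matrix (Fin 2) (Fin 2) (PathAlg k Q) :=
      Omega.triAlg (AlgHom.id k _) (augment k Q) 0 (by simp)
    let G : PathAlg k Q →ₗ[k] Matrix (Fin 2) (Fin 2) (PathAlg k Q) :=
      Omega.triLin 0 (LinearMap.id - (augment k Q).toLinearMap) 0
    have hG : ∀ a b, G (a * b) = G a * F b + F a * G b := by
      intro a b
      ext i j
      fin_cases i <;> fin_cases j <;>
        simp [F, G, Omega.triAlg, Omega.triLin, sub_mul, mul_sub]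
    have hR : ∀ r, G (str k V _ r) = 0 := by
      intro r
      ext i j
      fin_cases i <;> fin_cases j <;> simp [G, Omega.triLin, augment_str]
    have h1 := Omega.lift_dA F G hG hR x
    rw [h, map_zero] at h1
    have h2 : 0 = x - augment k Q x := by simpa [G, Omega.triLin] using congrFun (congrFun h1 0) 1
    rw [eq_of_sub_eq_zero h2.symm]
    exact augment_mem x
  · rintro ⟨r, rfl⟩
    exact Omega.dA_str k V _ r

/-! ### Finiteness and projectivity -/

theorem finiteType [Finite E] : Algebra.FiniteType k (PathAlg k Q) :=
  Algebra.FiniteType.of_surjective (proj k Q) (RingQuot.mkAlgHom_surjective k _)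

theorem deg_eq_bot (hQ : ∀ a, Q.deg a ≤ 0) {n : ℤ} (hn : 0 < n) :
    deg k V (PathAlg k Q) n = ⊥ := by
  refine Submodule.span_eq_bot.2 ?_
  rintro _ ⟨i, l, h, rfl⟩
  have : (l.map Q.deg).sum ≤ 0 := by
    clear h
    induction l with
    | nil => simp
    | cons a l ih =>
      rw [List.map_cons, List.sum_cons]
      exact add_nonpos (hQ a) ih
  omega

/-- The one-forms are a direct summand of a free bimodule with one generator per arrow. The map back
sends the generators to the `D a`, and it is split by the bimodule maps induced by the partial
double derivations: `D b` goes to `e_{t(b)} ⊗ e_{s(b)}` in coordinate `b`, and this element fixes `D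
b`. -/
theorem omega1_projective [Fintype E] [DecidableEq E] :
    Module.Projective (Env k (PathAlg k Q)) (Omega1 k V (PathAlg k Q)) := by
  have h : ∀ b : E, ∃ s : Omega1 k V (PathAlg k Q) →ₗ[Env k (PathAlg k Q)] Env k (PathAlg k Q),
      ∀ a, s (dOne k V _ a) =
        (MulOpposite.opLinearEquiv k).toLinearMap.lTensor (PathAlg k Q) (partialDer b a) :=
    fun b => exists_hom_of_doubleDerivation (der_mul _ _ _) (apply_str_eq_zero (der_vert _ _ _))
  choose s hs using h
  refine Module.Projective.of_split (LinearMap.pi s)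
    (Fintype.linearCombination (Env k (PathAlg k Q)) fun a => dOne k V _ (arrow k Q a)) ?_
  refine LinearMap.ext_on span_dOne_arrow ?_
  rintro _ ⟨a, rfl⟩
  rw [LinearMap.comp_apply, Fintype.linearCombination_apply, Finset.sum_eq_single a]
  · have h1 := dOne_mul k V _ (vert k Q (Q.tgt a)) (arrow k Q a)
    have h2 := dOne_mul k V _ (arrow k Q a) (vert k Q (Q.src a))
    rw [tgt_mul, dOne_vert, smul_zero, zero_add] at h1
    rw [mul_src, dOne_vert, smul_zero, add_zero] at h2
    have h3 : (vert k Q (Q.tgt a) ⊗ₜ[k] MulOpposite.op (vert k Q (Q.src a)) :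
        Env k (PathAlg k Q)) • dOne k V _ (arrow k Q a) = dOne k V _ (arrow k Q a) := by
      have e := mul_smul (vert k Q (Q.tgt a) ⊗ₜ[k] 1 : Env k (PathAlg k Q))
        (1 ⊗ₜ[k] MulOpposite.op (vert k Q (Q.src a))) (dOne k V _ (arrow k Q a))
      rw [Algebra.TensorProduct.tmul_mul_tmul, mul_one, one_mul] at e
      exact e.trans ((congrArg _ h2.symm).trans h1.symm)
    simpa [hs, partialDer] using h3
  · intro b _ hb
    have h0 : s b (dOne k V _ (arrow k Q a)) = 0 := by simp [hs, partialDer, hb.symm]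
    rw [LinearMap.pi_apply, h0]
    exact zero_smul (Env k (PathAlg k Q)) (dOne k V _ (arrow k Q b))
  · simp

end PathAlg

end PathAlgebras

/-! ### Double derivations dual to arrows, and the coefficients of one-forms. -/

section Coordinates

variable {k : Type u} [Field k] {V : Type v} {E : Type w} [Fintype V] {Q : GrQuiver V E}

namespace PathAlg

theorem insert_mem_oneForms [CharZero k] (b : E) (t : PathAlg k Q ⊗[k] PathAlg k Q) :
    Omega.insert (arrow k Q b) t ∈ oneForms k V (PathAlg k Q) := by
  induction t using TensorProduct.induction_on with
  | zero => rw [map_zero]; exact zero_mem _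
  | add z z' h h' => rw [map_add]; exact add_mem h h'
  | tmul x y =>
    induction x using DirectSum.Decomposition.inductionOn (deg k V (PathAlg k Q)) with
    | zero => simp
    | add p p' hp hp' => rw [TensorProduct.add_tmul, map_add]; exact add_mem hp hp'
    | @homogeneous i x =>
    induction y using DirectSum.Decomposition.inductionOn (deg k V (PathAlg k Q)) with
    | zero => simp
    | add p p' hp hp' => rw [TensorProduct.tmul_add, map_add]; exact add_mem hp hp'
    | @homogeneous j y =>
    rw [Omega.insert_tmul (arrow_mem_deg b) x.2 y.2]
    exact Submodule.smul_mem _ _ (mul_dA_mul_mem_oneForms _ _ _)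

/-- Write `D b` as `e_{t(b)} (D b) e_{s(b)}` and move the right idempotent around the cycle; having
bidegree zero, it costs no sign. Only the part of `x` from `t(b)` to `s(b)` is therefore seen in the
cyclic quotient. -/
theorem mk_mul_dA_sandwich (b : E) {l : ℤ} {x : PathAlg k Q}
    (hx : x ∈ deg k V (PathAlg k Q) l) :
    DR.mk k V _ (Omega.inA k V _ x * Omega.dA k V _ (arrow k Q b)) =
      DR.mk k V _ (Omega.inA k V _ (vert k Q (Q.src b) * x * vert k Q (Q.tgt b)) *
        Omega.dA k V _ (arrow k Q b)) := by
  have h := DR.mk_comm (((Omega.par_inA_of_mem hx).mul (Omega.par_inA_of_mem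
    (vert_mem_deg (Q.tgt b)))).mul (Omega.par_dA_of_mem (arrow_mem_deg b)))
    (Omega.par_inA_of_mem (vert_mem_deg (Q.src b)))
  rw [mul_zero, mul_zero, add_zero, zpow_zero, one_smul] at h
  conv_lhs => rw [← dA_arrow b]
  simp only [map_mul, mul_assoc] at h ⊢
  exact h

variable [DecidableEq E]

variable (k Q) in
/-- The double super-derivation dual to the arrow `b`. -/
def coDer (b : E) : dder k V (PathAlg k Q) (-Q.deg b) :=
  dderOf (-Q.deg b) (fun a => if a = b then 1 else 0) (fun a => by
    split_ifs with h
    · have h1 : (1 : PathAlg k Q) ∈ deg k V (PathAlg k Q) 0 := SetLike.GradedOne.one_mem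
      exact Submodule.subset_span ⟨0, 0, by simp [h], 1, h1, 1, h1, rfl⟩
    · exact zero_mem _)

theorem coDer_self (b : E) : (coDer k Q b).1 (arrow k Q b) =
    vert k Q (Q.tgt b) ⊗ₜ[k] vert k Q (Q.src b) := by
  rw [coDer, dderOf_arrow]; simp

theorem coDer_of_ne {a b : E} (h : a ≠ b) : (coDer k Q b).1 (arrow k Q a) = 0 := by
  rw [coDer, dderOf_arrow]; simp [h]

theorem dcontr_coDer_insert_of_ne [CharZero k] {a b : E} (h : a ≠ b)
    (t : PathAlg k Q ⊗[k] PathAlg k Q) :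
    Omega.dcontr (coDer k Q b) (Omega.insert (arrow k Q a) t) = 0 := by
  induction t using TensorProduct.induction_on with
  | zero => simp
  | add z z' h h' => simp only [map_add, h, h', add_zero]
  | tmul x y =>
    induction x using DirectSum.Decomposition.inductionOn (deg k V (PathAlg k Q)) with
    | zero => simp
    | add p p' hp hp' => simp only [TensorProduct.add_tmul, map_add, hp, hp', add_zero]
    | @homogeneous i x =>
    induction y using DirectSum.Decomposition.inductionOn (deg k V (PathAlg k Q)) with
    | zero => simp
    | add p p' hp hp' => simp only [TensorProduct.tmul_add, map_add, hp, hp', add_zero]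
    | @homogeneous j y =>
    rw [Omega.insert_tmul (arrow_mem_deg a) x.2 y.2, map_smul,
      Omega.dcontr_mul _ ((Omega.par_inA_of_mem y.2).mul (Omega.par_dA_of_mem (arrow_mem_deg a))),
      Omega.dcontr_mul _ (Omega.par_inA_of_mem y.2), Omega.dcontr_inA, Omega.dcontr_inA,
      Omega.dcontr_dA, coDer_of_ne h]
    simp

/-- Together with `dcontr_coDer_insert_of_ne`, this says that contraction with the dual of `b`
extracts the coefficient of `D b`. Apart from the invertible flip and twists, the only loss is the
compression by the end idempotents, which is harmless for values of double derivations by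
`dder_arrow`. -/
theorem dcontr_coDer_insert_self [CharZero k] (b : E) (t : PathAlg k Q ⊗[k] PathAlg k Q) :
    Omega.dcontr (coDer k Q b) (Omega.insert (arrow k Q b) t) =
      Omega.flip k V _ (Algebra.TensorProduct.map (Omega.inA k V (PathAlg k Q))
        (Omega.inA k V (PathAlg k Q)) (Algebra.TensorProduct.map
          (twist k V (PathAlg k Q) (Q.deg b)) (twist k V (PathAlg k Q) (Q.deg b)) ((vert k Q (Q.src b) ⊗ₜ[k] 1) * t * (1 ⊗ₜ[k] vert k Q (Q.tgt b))))) := by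
  induction t using TensorProduct.induction_on with
  | zero => simp
  | add z z' h h' => simp only [map_add, mul_add, add_mul, h, h']
  | tmul x y =>
    induction x using DirectSum.Decomposition.inductionOn (deg k V (PathAlg k Q)) with
    | zero => simp
    | add p p' hp hp' =>
      simp only [TensorProduct.add_tmul, map_add, mul_add, add_mul, hp, hp']
    | @homogeneous i x =>
    induction y using DirectSum.Decomposition.inductionOn (deg k V (PathAlg k Q)) with
    | zero => simp
    | add p p' hp hp' =>
      simp only [TensorProduct.tmul_add, map_add, mul_add, add_mul, hp, hp']
    | @homogeneous j y =>
    have hx : vert k Q (Q.src b) * x ∈ deg k V (PathAlg k Q) i := by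
      simpa using SetLike.mul_mem_graded (vert_mem_deg (Q.src b)) x.2
    have hy : y * vert k Q (Q.tgt b) ∈ deg k V (PathAlg k Q) j := by
      simpa using SetLike.mul_mem_graded y.2 (vert_mem_deg (Q.tgt b))
    rw [Omega.insert_tmul (arrow_mem_deg b) x.2 y.2, map_smul,
      Omega.dcontr_mul _ ((Omega.par_inA_of_mem y.2).mul (Omega.par_dA_of_mem (arrow_mem_deg b))),
      Omega.dcontr_mul _ (Omega.par_inA_of_mem y.2), Omega.dcontr_inA, Omega.dcontr_inA,
      Omega.dcontr_dA, coDer_self, Algebra.TensorProduct.tmul_mul_tmul,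
      Algebra.TensorProduct.tmul_mul_tmul, one_mul, mul_one, Algebra.TensorProduct.map_tmul,
      Algebra.TensorProduct.map_tmul, twist_of_mem _ hx, twist_of_mem _ hy, Algebra.TensorProduct.map_tmul, map_smul, map_smul,
      TensorProduct.smul_tmul_smul, map_smul, Omega.flip_tmul (Omega.par_inA_of_mem hx)
      (Omega.par_inA_of_mem hy), smul_smul, sign_mul, sign_mul]
    simp only [zero_mul, mul_zero, smul_zero, add_zero, zero_add, smul_mul_assoc,
      Algebra.TensorProduct.tmul_mul_tmul, one_mul, mul_one, ← map_mul, smul_smul, sign_mul]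
    congr 1
    -- On the left, `insert` contributes `i * (j + deg b)` and the Leibniz rule `-deg b * j`; on the
    -- right, the flip contributes `i * j` and the twists `deg b * (i + j)`. The parities agree.
    exact sign_congr k ⟨-Q.deg b * j, by ring⟩

theorem iota_coDer_of_ne [CharZero k] {a b : E} (h : a ≠ b) (x : PathAlg k Q) :
    Omega.iota (coDer k Q b) (Omega.inA k V _ x * Omega.dA k V _ (arrow k Q a)) = 0 := by
  rw [Omega.iota, LinearMap.comp_apply, LinearMap.comp_apply, Omega.dcontr_mul_raw,
    Omega.dcontr_inA, Omega.dcontr_dA, coDer_of_ne h]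
  simp

/-- The counterpart of `dcontr_coDer_insert_self` for classes in `DR¹`. The reduced contraction is
well defined on the cyclic quotient, so it shows that the compressed coefficient of `D b` depends
only on the class. -/
theorem iota_coDer_self [CharZero k] (b : E) (x : PathAlg k Q) :
    Omega.iota (coDer k Q b) (Omega.inA k V _ x * Omega.dA k V _ (arrow k Q b)) =
      Omega.inA k V _ (twist k V _ (-Q.deg b) (vert k Q (Q.src b) * x * vert k Q (Q.tgt b))) := by
  induction x using DirectSum.Decomposition.inductionOn (deg k V (PathAlg k Q)) with
  | zero => simp
  | add p p' hp hp' => simp only [map_add, mul_add, add_mul, hp, hp']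
  | @homogeneous j x =>
  have hx : x * vert k Q (Q.tgt b) ∈ deg k V (PathAlg k Q) j := by
    simpa using SetLike.mul_mem_graded x.2 (vert_mem_deg (Q.tgt b))
  rw [twist_of_mem _ (sandwich_mem x.2 _ _), Omega.iota, LinearMap.comp_apply,
    LinearMap.comp_apply, Omega.dcontr_mul _ (Omega.par_inA_of_mem x.2), Omega.dcontr_inA,
    Omega.dcontr_dA, coDer_self, Algebra.TensorProduct.map_tmul,
    Algebra.TensorProduct.tmul_mul_tmul, one_mul, ← map_mul, zero_mul, zero_add, zero_add,
    map_smul, map_smul, Omega.mulFlip_tmul (Omega.par_inA_of_mem hx)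
      (Omega.par_inA_of_mem (vert_mem_deg _)), ← map_mul, map_smul, mul_assoc]
  simp

end PathAlg

end Coordinates

/-! ### End points and degrees of the arrows of the double quiver. -/

section DoubleArrows

variable {V : Type v} {E : Type w} {Q : FinQuiver V E}

theorem src_inl (a : E) : Q.double.src (Sum.inl a) = Q.src a := rfl
theorem src_inr (a : E) : Q.double.src (Sum.inr a) = Q.tgt a := rfl
theorem tgt_inl (a : E) : Q.double.tgt (Sum.inl a) = Q.tgt a := rfl
theorem tgt_inr (a : E) : Q.double.tgt (Sum.inr a) = Q.src a := rfl
theorem deg_inl (a : E) : Q.double.deg (Sum.inl a) = 0 := rfl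
theorem deg_inr (a : E) : Q.double.deg (Sum.inr a) = -1 := rfl

end DoubleArrows

/-! ### Closedness and nondegeneracy of the two-form. -/

section Double

variable {V : Type v} {E : Type w} {k : Type u} [Field k] [Fintype V] {Q : FinQuiver V E}

open PathAlg

theorem arr_mem (a : E) : arr k Q a ∈ deg k V (PathAlg k Q.double) 0 :=
  arrow_mem_deg (Q := Q.double) (Sum.inl a)

theorem arrStar_mem (a : E) : arrStar k Q a ∈ deg k V (PathAlg k Q.double) (-1) :=
  arrow_mem_deg (Q := Q.double) (Sum.inr a)

/-- The flip and the twist are involutions, and the inclusion of `A ⊗ A` has a retraction. So the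
expression returned by coefficient extraction determines the coefficient. -/
theorem flip_map_twist_injective [CharZero k] (n : ℤ) : Function.Injective fun t =>
    Omega.flip k V _ (Algebra.TensorProduct.map (Omega.inA k V (PathAlg k Q.double))
      (Omega.inA k V (PathAlg k Q.double)) (Algebra.TensorProduct.map
        (twist k V (PathAlg k Q.double) n) (twist k V (PathAlg k Q.double) n) t)) := by
  refine Omega.flip_injective.comp (Omega.map_inA_injective.comp ?_)
  refine Function.LeftInverse.injective (g := Algebra.TensorProduct.map
        (twist k V (PathAlg k Q.double) n) (twist k V (PathAlg k Q.double) n)) fun t => ?_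
  rw [← AlgHom.comp_apply, ← Algebra.TensorProduct.map_comp]
  have : (twist k V (PathAlg k Q.double) n).comp (twist k V (PathAlg k Q.double) n) =
      AlgHom.id k _ := AlgHom.ext (twist_twist n)
  rw [this, Algebra.TensorProduct.map_id, AlgHom.id_apply]

variable [Fintype E]

theorem quiverForm_closed : IsClosedTwoForm (-1) (quiverForm k Q) := by
  refine ⟨⟨_, Submodule.sum_mem _ fun a _ => ?_, rfl⟩, ?_⟩
  · simpa using dA_mul_dA_mem_omegaDeg (arrStar_mem a) (arr_mem (k := k) (Q := Q) a)
  · rw [quiverForm, DR.D_mk, map_sum, Finset.sum_eq_zero, map_zero]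
    intro a _
    rw [Omega.D_mul (Omega.par_dA_of_mem (arrStar_mem a))]
    simp

/-- No Koszul sign is left: the one in `iota_dA_mul_dA` has exponent `(-1) * 0`, because `a` has
degree `0`. -/
theorem iota_quiverForm [CharZero k] {n : ℤ} (μ : dder k V (PathAlg k Q.double) n) :
    DR.iota μ (quiverForm k Q) = ∑ a, (Omega.insert (arr k Q a) (μ.1 (arrStar k Q a)) -
      Omega.insert (arrStar k Q a) (μ.1 (arr k Q a))) := by
  rw [quiverForm, DR.iota_mk, map_sum]
  refine Finset.sum_congr rfl fun a _ => ?_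
  rw [Omega.iota_dA_mul_dA μ (arrStar_mem a) (arr_mem a)]
  simp

theorem contr_quiverForm {n : ℤ} (θ : sder k V (PathAlg k Q.double) n) :
    DR.contr θ (quiverForm k Q) = DR.mk k V _
      (∑ a, (Omega.inA k V _ (θ.1 (arrStar k Q a)) * Omega.dA k V _ (arr k Q a) -
        Omega.inA k V _ (θ.1 (arr k Q a)) * Omega.dA k V _ (arrStar k Q a))) := by
  rw [quiverForm, map_sum, map_sum, map_sum]
  refine Finset.sum_congr rfl fun a _ => ?_
  rw [DR.contr_dA_mul_dA θ (arrStar_mem a) (arr_mem a)]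
  simp

/-! ### Bisymplecticity -/

/-- `D a` occurs in `ι_μ(ω)` only through the insertion of `μ(a*)`. The end points match because
`a*` runs from `t(a)` to `s(a)`, so the compression around `D a` is the one that `μ(a*)` already
satisfies. -/
theorem dcontr_inl_iota_quiverForm [CharZero k] [DecidableEq E] {n : ℤ}
    (μ : dder k V (PathAlg k Q.double) n) (a : E) :
    Omega.dcontr (coDer k Q.double (Sum.inl a)) (DR.iota μ (quiverForm k Q)) =
      Omega.flip k V _ (Algebra.TensorProduct.map (Omega.inA k V (PathAlg k Q.double))
        (Omega.inA k V (PathAlg k Q.double)) (Algebra.TensorProduct.map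
          (twist k V (PathAlg k Q.double) 0) (twist k V (PathAlg k Q.double) 0)
            (μ.1 (arrStar k Q a)))) := by
  rw [iota_quiverForm, map_sum, Finset.sum_eq_single a]
  · have h1 := dcontr_coDer_insert_self (k := k) (Q := Q.double) (Sum.inl a)
      (μ.1 (arrow k Q.double (Sum.inr a)))
    have h2 := dcontr_coDer_insert_of_ne (k := k) (Q := Q.double) (a := Sum.inr a)
      (b := Sum.inl a) (by simp) (μ.1 (arrow k Q.double (Sum.inl a)))
    rw [map_sub, arr, arrStar, h1, h2, sub_zero]
    have h3 := dder_arrow μ (Sum.inr a)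
    rw [src_inr, tgt_inr] at h3
    rw [src_inl, tgt_inl, deg_inl, h3]
  · intro c _ hc
    have h1 := dcontr_coDer_insert_of_ne (k := k) (Q := Q.double) (a := Sum.inl c)
      (b := Sum.inl a) (by simpa using hc) (μ.1 (arrow k Q.double (Sum.inr c)))
    have h2 := dcontr_coDer_insert_of_ne (k := k) (Q := Q.double) (a := Sum.inr c)
      (b := Sum.inl a) (by simp) (μ.1 (arrow k Q.double (Sum.inl c)))
    rw [map_sub, arr, arrStar, h1, h2, sub_zero]
  · simp

theorem dcontr_inr_iota_quiverForm [CharZero k] [DecidableEq E] {n : ℤ}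
    (μ : dder k V (PathAlg k Q.double) n) (a : E) :
    Omega.dcontr (coDer k Q.double (Sum.inr a)) (DR.iota μ (quiverForm k Q)) =
      -Omega.flip k V _ (Algebra.TensorProduct.map (Omega.inA k V (PathAlg k Q.double))
        (Omega.inA k V (PathAlg k Q.double)) (Algebra.TensorProduct.map
          (twist k V (PathAlg k Q.double) (-1)) (twist k V (PathAlg k Q.double) (-1))
            (μ.1 (arr k Q a)))) := by
  rw [iota_quiverForm, map_sum, Finset.sum_eq_single a]
  · have h1 := dcontr_coDer_insert_self (k := k) (Q := Q.double) (Sum.inr a)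
      (μ.1 (arrow k Q.double (Sum.inl a)))
    have h2 := dcontr_coDer_insert_of_ne (k := k) (Q := Q.double) (a := Sum.inl a)
      (b := Sum.inr a) (by simp) (μ.1 (arrow k Q.double (Sum.inr a)))
    rw [map_sub, arr, arrStar, h1, h2, zero_sub]
    have h3 := dder_arrow μ (Sum.inl a)
    rw [src_inl, tgt_inl] at h3
    rw [src_inr, tgt_inr, deg_inr, h3]
  · intro c _ hc
    have h1 := dcontr_coDer_insert_of_ne (k := k) (Q := Q.double) (a := Sum.inl c)
      (b := Sum.inr a) (by simp) (μ.1 (arrow k Q.double (Sum.inr c)))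
    have h2 := dcontr_coDer_insert_of_ne (k := k) (Q := Q.double) (a := Sum.inr c)
      (b := Sum.inr a) (by simpa using hc) (μ.1 (arrow k Q.double (Sum.inl c)))
    rw [map_sub, arr, arrStar, h1, h2, sub_zero]
  · simp

/-- For `x` in the kernel, extracting coefficients shows that the values of the homogeneous parts of
`x` on each arrow sum to zero. These values have different degrees, so each of them vanishes, and a
double derivation that vanishes on arrows is zero. -/
theorem iotaForm_quiverForm_injective [CharZero k] :
    Function.Injective (iotaForm (quiverForm k Q)) := by
  classical
  -- The kernel criterion for injectivity needs negation. It is taken from the scalar action, over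
  -- the additive monoid structure already in use.
  let _ : AddCommGroup (DDer k V (PathAlg k Q.double)) := Module.addCommMonoidToAddCommGroup k
  refine (injective_iff_map_eq_zero (iotaForm (quiverForm k Q))).2 fun x hx => ?_
  have h0 : ∑ n ∈ DFinsupp.support x, DR.iota (x n) (quiverForm k Q) = 0 := by
    rw [← hx]
    conv_rhs => rw [← DirectSum.sum_support_of x, map_sum]
    exact Finset.sum_congr rfl fun n _ => (iotaForm_lof _ _).symm
  have hs : ∀ a, ∑ n ∈ DFinsupp.support x, (x n).1 (arrStar k Q a) = 0 := by
    intro a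
    apply flip_map_twist_injective (k := k) (Q := Q) 0
    have h := congrArg (Omega.dcontr (coDer k Q.double (Sum.inl a))) h0
    rw [map_sum, map_zero, Finset.sum_congr rfl fun n _ => dcontr_inl_iota_quiverForm (x n) a] at h
    simpa only [map_sum, map_zero] using h
  have ha : ∀ a, ∑ n ∈ DFinsupp.support x, (x n).1 (arr k Q a) = 0 := by
    intro a
    apply flip_map_twist_injective (k := k) (Q := Q) (-1)
    have h := congrArg (Omega.dcontr (coDer k Q.double (Sum.inr a))) h0
    rw [map_sum, map_zero, Finset.sum_congr rfl fun n _ => dcontr_inr_iota_quiverForm (x n) a,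
      Finset.sum_neg_distrib, neg_eq_zero] at h
    simpa only [map_sum, map_zero] using h
  refine DFinsupp.ext fun n => ?_
  by_cases hn : n ∈ DFinsupp.support x
  · refine dder_ext fun b => ?_
    change (x n).1 (arrow k Q.double b) = 0
    rcases b with a | a
    -- The shift is the degree of the arrow: `0` for `a`, and `-1` for `a*` below.
    · exact eq_zero_of_sum_eq_zero (tenComponents k V _) (fun n => (x n).1 (arr k Q a)) _ 0
        (fun m _ => tenComponents_of_mem (by
          rw [add_comm]; exact (x m).2.2.1 _ _ (arr_mem a))) (ha a) n hn
    · exact eq_zero_of_sum_eq_zero (tenComponents k V _) (fun n => (x n).1 (arrStar k Q a)) _ (-1)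
        (fun m _ => tenComponents_of_mem (by
          rw [add_comm]; exact (x m).2.2.1 _ _ (arrStar_mem a))) (hs a) n hn
  · simpa using hn

/-- For surjectivity, `p (D a) q` is up to sign the image of the double derivation sending `a*` to
the compressed `q ⊗ p` and killing all other arrows. For `p (D a*) q` the roles of `a` and `a*` are
exchanged and the value changes sign. -/
theorem quiverForm_bisymplectic [CharZero k] [DecidableEq E] :
    IsBisymplectic (quiverForm k Q) := by
  refine ⟨?_, iotaForm_quiverForm_injective.injOn, ?_⟩
  · intro x _
    induction x using DirectSum.induction_on with
    | zero => rw [map_zero]; exact zero_mem _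
    | add x y hx hy => rw [map_add]; exact add_mem (hx trivial) (hy trivial)
    | of n μ =>
      have h := iotaForm_lof (quiverForm k Q) μ
      rw [iota_quiverForm] at h
      refine (congrArg (· ∈ oneForms k V (PathAlg k Q.double)) h).mpr ?_
      exact Submodule.sum_mem _ fun a _ => sub_mem (insert_mem_oneForms _ _)
        (insert_mem_oneForms _ _)
  · rw [Set.SurjOn, Set.image_univ, ← LinearMap.coe_range]
    refine oneForms_le fun b i j p hp q hq => ?_
    have hqp : q ⊗ₜ[k] p ∈ degTen k V (PathAlg k Q.double) (i + j) :=
      Submodule.subset_span ⟨j, i, add_comm _ _, q, hq, p, hp, rfl⟩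
    have hq' := SetLike.mul_mem_graded (vert_mem_deg (Q.double.src b)) hq
    have hp' := SetLike.mul_mem_graded hp (vert_mem_deg (Q.double.tgt b))
    rw [zero_add] at hq'
    rw [add_zero] at hp'
    -- `dderOf` returns compressed values. Inserting one of them around `D b` gives the same form as
    -- inserting `q ⊗ p`, since `D b` absorbs its end idempotents.
    have key : Omega.insert (arrow k Q.double b) ((vert k Q.double (Q.double.src b) ⊗ₜ[k] 1) *
        (q ⊗ₜ[k] p) * (1 ⊗ₜ[k] vert k Q.double (Q.double.tgt b))) =
          ((-1 : k) ^ (j * (i + Q.double.deg b))) • (Omega.inA k V _ p *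
            Omega.dA k V _ (arrow k Q.double b) * Omega.inA k V _ q) := by
      rw [Algebra.TensorProduct.tmul_mul_tmul, Algebra.TensorProduct.tmul_mul_tmul, mul_one,
        one_mul, Omega.insert_tmul (arrow_mem_deg b) hq' hp', ← dA_arrow b]
      simp only [map_mul, mul_assoc]
      simp only [← mul_assoc, ← map_mul, vert_mul_self]
    suffices ((-1 : k) ^ (j * (i + Q.double.deg b))) • (Omega.inA k V _ p *
        Omega.dA k V _ (arrow k Q.double b) * Omega.inA k V _ q) ∈
          LinearMap.range (iotaForm (quiverForm k Q)) by
      have h := Submodule.smul_mem _ ((-1 : k) ^ (j * (i + Q.double.deg b))) this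
      rwa [smul_smul, sign_mul, Even.neg_one_zpow ⟨_, rfl⟩, one_smul] at h
    rw [← key]
    rcases b with a | a
    -- The value on `a*`, which has degree `-1`, must have degree `i + j`; this accounts for the `+
    -- 1`.
    · let μ : dder k V (PathAlg k Q.double) (i + j + 1) :=
        dderOf (i + j + 1) (Pi.single (Sum.inr a) (q ⊗ₜ[k] p)) (fun c => by
          by_cases hc : c = Sum.inr a
          · subst hc
            rw [Pi.single_eq_same, deg_inr]
            convert hqp using 2
            ring
          · rw [Pi.single_eq_of_ne hc]; exact zero_mem _)
      have hμ : ∀ c, μ.1 (arrow k Q.double c) = _ := dderOf_arrow _ _ _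
      refine ⟨DirectSum.lof k ℤ _ _ μ, ?_⟩
      rw [iotaForm_lof, iota_quiverForm, Finset.sum_eq_single a]
      · rw [arr, arrStar, hμ, hμ, Pi.single_eq_same, Pi.single_eq_of_ne (by simp)]
        simp [src_inl, src_inr, tgt_inl, tgt_inr]
      · intro c _ hc
        rw [arr, arrStar, hμ, hμ, Pi.single_eq_of_ne (by simpa using hc),
          Pi.single_eq_of_ne (by simp)]
        simp
      · simp
    · let μ : dder k V (PathAlg k Q.double) (i + j) :=
        dderOf (i + j) (Pi.single (Sum.inl a) (-(q ⊗ₜ[k] p))) (fun c => by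
          by_cases hc : c = Sum.inl a
          · subst hc
            rw [Pi.single_eq_same, deg_inl, zero_add]
            exact neg_mem hqp
          · rw [Pi.single_eq_of_ne hc]; exact zero_mem _)
      have hμ : ∀ c, μ.1 (arrow k Q.double c) = _ := dderOf_arrow _ _ _
      refine ⟨DirectSum.lof k ℤ _ _ μ, ?_⟩
      rw [iotaForm_lof, iota_quiverForm, Finset.sum_eq_single a]
      · rw [arr, arrStar, hμ, hμ, Pi.single_eq_same, Pi.single_eq_of_ne (by simp)]
        simp [src_inl, src_inr, tgt_inl, tgt_inr]
      · intro c _ hc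
        rw [arr, arrStar, hμ, hμ, Pi.single_eq_of_ne (by simp),
          Pi.single_eq_of_ne (by simpa using hc)]
        simp
      · simp

/-! ### Symplecticity -/

/-- The dual of `a` picks out the coefficient of `D a` in `i_θ(ω)`, which is `θ(a*)`. The twist
exponent `-0` is the degree of that dual derivation; it is `-(-1)` for the dual of `a*` in the next
lemma. -/
theorem iota_inl_contr_quiverForm [CharZero k] [DecidableEq E] {n : ℤ}
    (θ : sder k V (PathAlg k Q.double) n) (a : E) :
    DR.iota (coDer k Q.double (Sum.inl a)) (DR.contr θ (quiverForm k Q)) =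
      Omega.inA k V _ (twist k V (PathAlg k Q.double) (-0) (θ.1 (arrStar k Q a))) := by
  rw [contr_quiverForm, DR.iota_mk, map_sum, Finset.sum_eq_single a]
  · have h1 := iota_coDer_self (k := k) (Q := Q.double) (Sum.inl a)
      (θ.1 (arrow k Q.double (Sum.inr a)))
    have h2 := iota_coDer_of_ne (k := k) (Q := Q.double) (a := Sum.inr a)
      (b := Sum.inl a) (by simp) (θ.1 (arrow k Q.double (Sum.inl a)))
    rw [map_sub, arr, arrStar, h1, h2, sub_zero]
    have h3 := sder_arrow θ (Sum.inr a)
    rw [src_inr, tgt_inr] at h3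
    rw [src_inl, tgt_inl, deg_inl, h3]
  · intro c _ hc
    have h1 := iota_coDer_of_ne (k := k) (Q := Q.double) (a := Sum.inl c)
      (b := Sum.inl a) (by simpa using hc) (θ.1 (arrow k Q.double (Sum.inr c)))
    have h2 := iota_coDer_of_ne (k := k) (Q := Q.double) (a := Sum.inr c)
      (b := Sum.inl a) (by simp) (θ.1 (arrow k Q.double (Sum.inl c)))
    rw [map_sub, arr, arrStar, h1, h2, sub_zero]
  · simp

theorem iota_inr_contr_quiverForm [CharZero k] [DecidableEq E] {n : ℤ}
    (θ : sder k V (PathAlg k Q.double) n) (a : E) :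
    DR.iota (coDer k Q.double (Sum.inr a)) (DR.contr θ (quiverForm k Q)) =
      -Omega.inA k V _ (twist k V (PathAlg k Q.double) (-(-1)) (θ.1 (arr k Q a))) := by
  rw [contr_quiverForm, DR.iota_mk, map_sum, Finset.sum_eq_single a]
  · have h1 := iota_coDer_self (k := k) (Q := Q.double) (Sum.inr a)
      (θ.1 (arrow k Q.double (Sum.inl a)))
    have h2 := iota_coDer_of_ne (k := k) (Q := Q.double) (a := Sum.inl a)
      (b := Sum.inr a) (by simp) (θ.1 (arrow k Q.double (Sum.inr a)))
    rw [map_sub, arr, arrStar, h1, h2, zero_sub]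
    have h3 := sder_arrow θ (Sum.inl a)
    rw [src_inl, tgt_inl] at h3
    rw [src_inr, tgt_inr, deg_inr, h3]
  · intro c _ hc
    have h1 := iota_coDer_of_ne (k := k) (Q := Q.double) (a := Sum.inl c)
      (b := Sum.inr a) (by simp) (θ.1 (arrow k Q.double (Sum.inr c)))
    have h2 := iota_coDer_of_ne (k := k) (Q := Q.double) (a := Sum.inr c)
      (b := Sum.inr a) (by simpa using hc) (θ.1 (arrow k Q.double (Sum.inl c)))
    rw [map_sub, arr, arrStar, h1, h2, sub_zero]
  · simp

/-- The argument is that of `iotaForm_quiverForm_injective`, with reduced contractions in place of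
double ones and values in `A` instead of `A ⊗ A`. -/
theorem contrForm_quiverForm_injective [CharZero k] :
    Function.Injective (contrForm (quiverForm k Q)) := by
  classical
  let _ : AddCommGroup (SDer k V (PathAlg k Q.double)) := Module.addCommMonoidToAddCommGroup k
  refine (injective_iff_map_eq_zero (contrForm (quiverForm k Q))).2 fun x hx => ?_
  have h0 : ∑ n ∈ DFinsupp.support x, DR.contr (x n) (quiverForm k Q) = 0 := by
    rw [← hx]
    conv_rhs => rw [← DirectSum.sum_support_of x, map_sum]
    exact Finset.sum_congr rfl fun n _ => (contrForm_lof _ _).symm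
  have hinj : ∀ n, Function.Injective fun t =>
      Omega.inA k V _ (twist k V (PathAlg k Q.double) n t) := fun n =>
    Omega.inA_injective.comp (Function.LeftInverse.injective (twist_twist n))
  have hs : ∀ a, ∑ n ∈ DFinsupp.support x, (x n).1 (arrStar k Q a) = 0 := by
    intro a
    apply hinj (-0)
    have h := congrArg (DR.iota (coDer k Q.double (Sum.inl a))) h0
    rw [map_sum, map_zero, Finset.sum_congr rfl fun n _ => iota_inl_contr_quiverForm (x n) a] at h
    simpa only [map_sum, map_zero] using h
  have ha : ∀ a, ∑ n ∈ DFinsupp.support x, (x n).1 (arr k Q a) = 0 := by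
    intro a
    apply hinj (-(-1))
    have h := congrArg (DR.iota (coDer k Q.double (Sum.inr a))) h0
    rw [map_sum, map_zero, Finset.sum_congr rfl fun n _ => iota_inr_contr_quiverForm (x n) a,
      Finset.sum_neg_distrib, neg_eq_zero] at h
    simpa only [map_sum, map_zero] using h
  refine DFinsupp.ext fun n => ?_
  by_cases hn : n ∈ DFinsupp.support x
  · refine sder_ext fun b => ?_
    change (x n).1 (arrow k Q.double b) = 0
    rcases b with a | a
    · exact eq_zero_of_sum_eq_zero (components k V _) (fun n => (x n).1 (arr k Q a)) _ 0
        (fun m _ => components_of_mem (by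
          rw [add_comm]; exact (x m).2.2.1 _ _ (arr_mem a))) (ha a) n hn
    · exact eq_zero_of_sum_eq_zero (components k V _) (fun n => (x n).1 (arrStar k Q a)) _ (-1)
        (fun m _ => components_of_mem (by
          rw [add_comm]; exact (x m).2.2.1 _ _ (arrStar_mem a))) (hs a) n hn
  · simpa using hn

/-- The preimage is the derivation supported on the partner of `b`, with value `x` or `-x`. The
compression performed by `sderOf` does not change the class, by `mk_mul_dA_sandwich`. -/
theorem mem_range_contrForm [DecidableEq E] (b : E ⊕ E) {l : ℤ} {x : PathAlg k Q.double}
    (hx : x ∈ deg k V (PathAlg k Q.double) l) :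
    DR.mk k V _ (Omega.inA k V _ x * Omega.dA k V _ (arrow k Q.double b)) ∈
      LinearMap.range (contrForm (quiverForm k Q)) := by
  rw [mk_mul_dA_sandwich b hx]
  rcases b with a | a
  · let θ : sder k V (PathAlg k Q.double) (l + 1) :=
      sderOf (l + 1) (Pi.single (Sum.inr a) x) (fun c => by
        by_cases hc : c = Sum.inr a
        · subst hc
          rw [Pi.single_eq_same, deg_inr]
          convert hx using 2
          ring
        · rw [Pi.single_eq_of_ne hc]; exact zero_mem _)
    have hθ : ∀ c, θ.1 (arrow k Q.double c) = _ := sderOf_arrow _ _ _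
    refine ⟨DirectSum.lof k ℤ _ _ θ, ?_⟩
    rw [contrForm_lof, contr_quiverForm, Finset.sum_eq_single a]
    · rw [arr, arrStar, hθ, hθ, Pi.single_eq_same, Pi.single_eq_of_ne (by simp)]
      simp [src_inl, src_inr, tgt_inl, tgt_inr]
    · intro c _ hc
      rw [arr, arrStar, hθ, hθ, Pi.single_eq_of_ne (by simpa using hc),
        Pi.single_eq_of_ne (by simp)]
      simp
    · simp
  · let θ : sder k V (PathAlg k Q.double) l :=
      sderOf l (Pi.single (Sum.inl a) (-x)) (fun c => by
        by_cases hc : c = Sum.inl a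
        · subst hc
          rw [Pi.single_eq_same, deg_inl, zero_add]
          exact neg_mem hx
        · rw [Pi.single_eq_of_ne hc]; exact zero_mem _)
    have hθ : ∀ c, θ.1 (arrow k Q.double c) = _ := sderOf_arrow _ _ _
    refine ⟨DirectSum.lof k ℤ _ _ θ, ?_⟩
    rw [contrForm_lof, contr_quiverForm, Finset.sum_eq_single a]
    · rw [arr, arrStar, hθ, hθ, Pi.single_eq_same, Pi.single_eq_of_ne (by simp)]
      simp [src_inl, src_inr, tgt_inl, tgt_inr]
    · intro c _ hc
      rw [arr, arrStar, hθ, hθ, Pi.single_eq_of_ne (by simp),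
        Pi.single_eq_of_ne (by simpa using hc)]
      simp
    · simp

theorem quiverForm_symplectic [CharZero k] [DecidableEq E] : IsSymplectic (quiverForm k Q) := by
  refine ⟨?_, contrForm_quiverForm_injective.injOn, ?_⟩
  · intro x _
    induction x using DirectSum.induction_on with
    | zero => rw [map_zero]; exact zero_mem _
    | add x y hx hy => rw [map_add]; exact add_mem (hx trivial) (hy trivial)
    | of n θ =>
      have h := contrForm_lof (quiverForm k Q) θ
      rw [contr_quiverForm] at h
      refine (congrArg (· ∈ (oneForms k V (PathAlg k Q.double)).map (DR.mk k V _)) h).mpr ?_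
      refine ⟨_, Submodule.sum_mem _ fun a _ => sub_mem ?_ ?_, rfl⟩
      · simpa using mul_dA_mul_mem_oneForms (θ.1 (arrStar k Q a)) 1 (arr k Q a)
      · simpa using mul_dA_mul_mem_oneForms (θ.1 (arr k Q a)) 1 (arrStar k Q a)
  · rw [Set.SurjOn, Set.image_univ, ← LinearMap.coe_range, SetLike.coe_subset_coe,
      Submodule.map_le_iff_le_comap]
    refine oneForms_le fun b i j p hp q hq => ?_
    -- Moving `q` around the cycle turns `p (D b) q` into a multiple of `(q p) (D b)`, so one-sided
    -- coefficients suffice.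
    rw [Submodule.mem_comap, DR.mk_comm ((Omega.par_inA_of_mem hp).mul (Omega.par_dA_of_mem
      (arrow_mem_deg b))) (Omega.par_inA_of_mem hq), ← mul_assoc, ← map_mul]
    exact Submodule.smul_mem _ _ (mem_range_contrForm b (SetLike.mul_mem_graded hq hp))

end Double

/-! ### The distinguished double derivation and the commutator identity for cyclic derivatives. -/

section Moment

variable {k : Type u} [Field k] {V : Type v} {E : Type w} [Fintype V] {Q : GrQuiver V E}

namespace PathAlg

/-- For `x` based at `j` on both sides, the two products are `x` if `i = j` and vanish otherwise. It
is applied to the closed paths `a a*` and `a* a`. -/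
theorem vert_mul_comm {x : PathAlg k Q} {j : V} (hl : vert k Q j * x = x)
    (hr : x * vert k Q j = x) (i : V) : vert k Q i * x = x * vert k Q i := by
  by_cases h : i = j
  · subst h; rw [hl, hr]
  · rw [← hl, ← mul_assoc, vert_mul_of_ne k Q h, hl, ← hr, mul_assoc,
      vert_mul_of_ne k Q (Ne.symm h), zero_mul, mul_zero]

theorem str_mul_comm {x : PathAlg k Q} (h : ∀ i, vert k Q i * x = x * vert k Q i) (r : V → k) :
    str k V _ r * x = x * str k V _ r := by
  simp only [str_apply, Finset.sum_mul, Finset.mul_sum, smul_mul_assoc, mul_smul_comm, h]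

theorem sum_vert_mul_vert {x : PathAlg k Q} (h : ∀ i, vert k Q i * x = x * vert k Q i) :
    ∑ i, vert k Q i * x * vert k Q i = x := by
  simp only [h, mul_assoc, vert_mul_self]
  rw [← Finset.mul_sum, sum_vert, mul_one]

theorem tgt_mul_of_ne {a : E} {i : V} (h : i ≠ Q.tgt a) : vert k Q i * arrow k Q a = 0 := by
  rw [← tgt_mul, ← mul_assoc, vert_mul_of_ne k Q h, zero_mul]

theorem delta_apply [DecidableEq V] (x : PathAlg k Q) : (delta k V (PathAlg k Q)).1 x =
    ∑ i, ((x * vert k Q i) ⊗ₜ[k] vert k Q i - vert k Q i ⊗ₜ[k] (vert k Q i * x)) := by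
  simp [delta, LinearMap.sum_apply, idem, str_single]

theorem delta_arrow [DecidableEq V] (a : E) : (delta k V (PathAlg k Q)).1 (arrow k Q a) =
    arrow k Q a ⊗ₜ[k] vert k Q (Q.src a) - vert k Q (Q.tgt a) ⊗ₜ[k] arrow k Q a := by
  rw [delta_apply, Finset.sum_sub_distrib, Finset.sum_eq_single (Q.src a),
    Finset.sum_eq_single (Q.tgt a), mul_src, tgt_mul]
  · intro i _ hi
    rw [tgt_mul_of_ne hi, TensorProduct.tmul_zero]
  · simp
  · intro i _ hi
    rw [arrow_mul_of_ne k Q (Ne.symm hi), TensorProduct.zero_tmul]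
  · simp

variable [DecidableEq E] [Fintype E]

/-- The sum of the double derivations dual to the arrows, with the arrows inserted. -/
theorem sum_partialDer [DecidableEq V] (x : PathAlg k Q) :
    ∑ a, (TensorProduct.map (LinearMap.mulRight k (arrow k Q a)) LinearMap.id (partialDer a x) -
      TensorProduct.map LinearMap.id (LinearMap.mulLeft k (arrow k Q a)) (partialDer a x)) =
      (delta k V (PathAlg k Q)).1 x := by
  -- `T a` is the commutator with `a` for the inner bimodule structure. It commutes with the outer
  -- structure, so `T a` composed with `∂_a` is again a double derivation. The sum can then be
  -- compared with `δ` on arrows, where only the term of the given arrow survives.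
  let T : E → PathAlg k Q ⊗[k] PathAlg k Q →ₗ[k] PathAlg k Q ⊗[k] PathAlg k Q := fun a =>
    TensorProduct.map (LinearMap.mulRight k (arrow k Q a)) LinearMap.id -
      TensorProduct.map LinearMap.id (LinearMap.mulLeft k (arrow k Q a))
  have hT : ∀ a z y, T a (z * (1 ⊗ₜ[k] y)) = T a z * (1 ⊗ₜ[k] y) := by
    intro a z y
    induction z using TensorProduct.induction_on with
    | zero => simp
    | add z z' h h' => simp only [add_mul, map_add, h, h']
    | tmul p q => simp [T, mul_assoc, sub_mul]
  have hT' : ∀ a z y, T a ((y ⊗ₜ[k] 1) * z) = (y ⊗ₜ[k] 1) * T a z := by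
    intro a z y
    induction z using TensorProduct.induction_on with
    | zero => simp
    | add z z' h h' => simp only [mul_add, map_add, h, h']
    | tmul p q => simp [T, mul_assoc, mul_sub]
  have key : ∑ a, T a ∘ₗ partialDer a = (delta k V (PathAlg k Q)).1 := by
    refine leibniz_ext (f := Algebra.TensorProduct.includeLeft)
      (g := Algebra.TensorProduct.includeRight) (fun x y => ?_) (fun x y => ?_) (fun i => ?_)
      (fun a => ?_)
    · simp only [LinearMap.sum_apply, LinearMap.comp_apply, Finset.sum_mul, Finset.mul_sum,
        ← Finset.sum_add_distrib]
      refine Finset.sum_congr rfl fun a _ => ?_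
      rw [partialDer, der_mul, map_add, Algebra.TensorProduct.includeLeft_apply,
        Algebra.TensorProduct.includeRight_apply, hT, hT']
    · have h := dder_mul (delta k V (PathAlg k Q)).2 x y
      rwa [twist_even (by simp)] at h
    · rw [apply_vert_eq_zero (delta k V (PathAlg k Q)).2.1]
      simp [LinearMap.sum_apply, partialDer]
    · rw [delta_arrow, LinearMap.sum_apply, Finset.sum_eq_single a]
      · simp [T, partialDer, tgt_mul, mul_src]
      · intro b _ hb
        simp [partialDer, hb.symm]
      · simp
  have h := DFunLike.congr_fun key x
  simpa [LinearMap.sum_apply, T] using h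

/-- Multiply the tensor factors of `sum_partialDer` in reversed order. Each `∂_a x` becomes the
cyclic derivative and its inner commutator an ordinary one, while `δ(x)` becomes `∑ (e_i x e_i - e_i
x e_i) = 0`. -/
theorem sum_arrow_commutator_cyclicDer (x : PathAlg k Q) :
    ∑ a, (arrow k Q a * cyclicDer a x - cyclicDer a x * arrow k Q a) = 0 := by
  classical
  have h := congrArg (LinearMap.mul' k _ ∘ₗ (TensorProduct.comm k _ _).toLinearMap)
    (sum_partialDer x)
  have h1 : ∀ (a : E) z, LinearMap.mul' k _ (TensorProduct.comm k _ _ (TensorProduct.map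
      (LinearMap.mulRight k (arrow k Q a)) LinearMap.id z)) =
        LinearMap.mul' k _ (TensorProduct.comm k _ _ z) * arrow k Q a := by
    intro a z
    induction z using TensorProduct.induction_on with
    | zero => simp
    | add z z' h h' => simp only [add_mul, map_add, h, h']
    | tmul p q => simp [mul_assoc]
  have h2 : ∀ (a : E) z, LinearMap.mul' k _ (TensorProduct.comm k _ _ (TensorProduct.map
      LinearMap.id (LinearMap.mulLeft k (arrow k Q a)) z)) =
        arrow k Q a * LinearMap.mul' k _ (TensorProduct.comm k _ _ z) := by
    intro a z
    induction z using TensorProduct.induction_on with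
    | zero => simp
    | add z z' h h' => simp only [mul_add, map_add, h, h']
    | tmul p q => simp [mul_assoc]
  have h3 : ∑ a, (cyclicDer a x * arrow k Q a - arrow k Q a * cyclicDer a x) = 0 := by
    rw [delta_apply] at h
    simpa [h1, h2, cyclicDer, mul_assoc] using h
  rw [← neg_eq_zero, ← Finset.sum_neg_distrib]
  simpa using h3

end PathAlg

end Moment

/-! ### The moment map and the derivation attached to the potential. -/

section DoubleQuiver

variable {V : Type v} {E : Type w} {k : Type u} [Field k] [Fintype V] {Q : FinQuiver V E}

open PathAlg

theorem toDouble_vert (i : V) : toDouble k Q (vert k Q.plain i) = vert k Q.double i :=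
  map_vert _ _ _ i

theorem toDouble_arrow (a : E) : toDouble k Q (arrow k Q.plain a) = arr k Q a := by
  simp [toDouble, PathAlg.map, arr]

theorem toDouble_mem (x : PathAlg k Q.plain) :
    toDouble k Q x ∈ deg k V (PathAlg k Q.double) 0 := by
  induction x using PathAlg.induction with
  | hv i => rw [toDouble_vert]; exact vert_mem_deg i
  | ha a => rw [toDouble_arrow]; exact arr_mem a
  | hs c => rw [AlgHom.commutes]; exact SetLike.algebraMap_mem_graded _ c
  | add x y hx hy => rw [map_add]; exact add_mem hx hy
  | mul x y hx hy => rw [map_mul]; simpa using SetLike.mul_mem_graded hx hy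

theorem arr_mul_arrStar_mem (a : E) :
    arr k Q a * arrStar k Q a ∈ deg k V (PathAlg k Q.double) (-1) := by
  simpa using SetLike.mul_mem_graded (arr_mem a) (arrStar_mem (k := k) (Q := Q) a)

theorem arrStar_mul_arr_mem (a : E) :
    arrStar k Q a * arr k Q a ∈ deg k V (PathAlg k Q.double) (-1) := by
  simpa using SetLike.mul_mem_graded (arrStar_mem a) (arr_mem (k := k) (Q := Q) a)

theorem tgt_mul_arr (a : E) : vert k Q.double (Q.tgt a) * arr k Q a = arr k Q a :=
  tgt_mul k Q.double (Sum.inl a)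

theorem arr_mul_src (a : E) : arr k Q a * vert k Q.double (Q.src a) = arr k Q a :=
  mul_src k Q.double (Sum.inl a)

theorem src_mul_arrStar (a : E) : vert k Q.double (Q.src a) * arrStar k Q a = arrStar k Q a :=
  tgt_mul k Q.double (Sum.inr a)

theorem arrStar_mul_tgt (a : E) : arrStar k Q a * vert k Q.double (Q.tgt a) = arrStar k Q a :=
  mul_src k Q.double (Sum.inr a)

theorem tgt_mul_dA (b : E ⊕ E) : Omega.inA k V _ (vert k Q.double (Q.double.tgt b)) *
    Omega.dA k V _ (arrow k Q.double b) = Omega.dA k V _ (arrow k Q.double b) := by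
  conv_lhs => rw [← dA_arrow b]
  simp only [← mul_assoc, ← map_mul, vert_mul_self]
  exact dA_arrow b

theorem dA_mul_src (b : E ⊕ E) : Omega.dA k V _ (arrow k Q.double b) *
    Omega.inA k V _ (vert k Q.double (Q.double.src b)) =
      Omega.dA k V _ (arrow k Q.double b) := by
  conv_lhs => rw [← dA_arrow b]
  simp only [mul_assoc, ← map_mul, vert_mul_self]
  simpa only [mul_assoc] using dA_arrow b

theorem generated_quiver : Submodule.span (Env k (PathAlg k Q.double))
    {η : Omega1 k V (PathAlg k Q.double) | ∃ n, -1 ≤ n ∧ n ≤ 0 ∧ η ∈ omega1Deg k V _ n} = ⊤ := by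
  rw [eq_top_iff, ← span_dOne_arrow]
  refine Submodule.span_mono ?_
  rintro _ ⟨b, rfl⟩
  refine ⟨Q.double.deg b, ?_, ?_, dOne_mem_omega1Deg (arrow_mem_deg b)⟩ <;>
  rcases b with a | a <;> simp [deg_inl, deg_inr]

/-- The linear map `x ⊗ y ↦ x (D a) y`. -/
def sandwichD (a : E) :
    PathAlg k Q.plain ⊗[k] PathAlg k Q.plain →ₗ[k] Omega k V (PathAlg k Q.double) :=
  LinearMap.mul' k _ ∘ₗ TensorProduct.map
    (LinearMap.mulRight k (Omega.dA k V _ (arr k Q a)) ∘ₗ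
      ((Omega.inA k V _).comp (toDouble k Q)).toLinearMap)
    ((Omega.inA k V _).comp (toDouble k Q)).toLinearMap

/-- Everything coming from `kQ` has internal degree `0`, so the right-hand factor moves to the front
of the cycle without sign. This is how a partial double derivative becomes a cyclic derivative. -/
theorem mk_sandwichD (a : E) (z : PathAlg k Q.plain ⊗[k] PathAlg k Q.plain) :
    DR.mk k V _ (sandwichD a z) = DR.mk k V _ (Omega.inA k V _ (toDouble k Q
      (LinearMap.mul' k _ (TensorProduct.comm k _ _ z))) * Omega.dA k V _ (arr k Q a)) := by
  induction z using TensorProduct.induction_on with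
  | zero => simp
  | add z z' h h' => simp only [add_mul, map_add, h, h']
  | tmul p q =>
    have h := DR.mk_comm ((Omega.par_inA_of_mem (toDouble_mem p)).mul
      (Omega.par_dA_of_mem (arr_mem a))) (Omega.par_inA_of_mem (toDouble_mem q))
    rw [mul_zero, mul_zero, add_zero, zpow_zero, one_smul, ← mul_assoc, ← map_mul, ← map_mul] at h
    simpa [sandwichD] using h

section Hamiltonian

variable [DecidableEq E]

/-! ### The Hamiltonian vector field of the potential -/

/-- The super-derivation with `a ↦ 0` and `a* ↦ ∂W/∂a`. -/
def hamiltonian (W : Potential k Q) : sder k V (PathAlg k Q.double) 1 :=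
  sderOf 1 (Sum.elim 0 fun a => toDouble k Q (W.deriv a)) (fun b => by
    rcases b with a | a
    · exact zero_mem _
    · rw [deg_inr]; exact toDouble_mem _)

variable (W : Potential k Q)

theorem hamiltonian_arr (a : E) : (hamiltonian W).1 (arr k Q a) = 0 :=
  (sderOf_arrow _ _ _ _).trans (by simp)

/-- The idempotents introduced by `sderOf` disappear, because a cyclic derivative with respect to
`a` already consists of paths from `t(a)` to `s(a)`. -/
theorem hamiltonian_arrStar (a : E) :
    (hamiltonian W).1 (arrStar k Q a) = toDouble k Q (W.deriv a) := by
  refine (sderOf_arrow _ _ _ _).trans ?_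
  obtain ⟨x, rfl⟩ := Submodule.mkQ_surjective _ W
  have h := congrArg (toDouble k Q) (cyclicDer_sandwich (Q := Q.plain) a x)
  rw [map_mul, map_mul, toDouble_vert, toDouble_vert] at h
  exact h

theorem hamiltonian_toDouble (x : PathAlg k Q.plain) :
    (hamiltonian W).1 (toDouble k Q x) = 0 := by
  induction x using PathAlg.induction with
  | hv i => rw [toDouble_vert, apply_vert_eq_zero (hamiltonian W).2.1]
  | ha a => rw [toDouble_arrow, hamiltonian_arr]
  | hs c =>
    have h := (hamiltonian W).2.1 (algebraMap k _ c)
    rw [AlgHom.commutes] at h ⊢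
    exact h
  | add x y hx hy => rw [map_add, map_add, hx, hy, add_zero]
  | mul x y hx hy => rw [map_mul, sder_mul (hamiltonian W).2, hx, hy, zero_mul, mul_zero, add_zero]

/-- It suffices to look at arrows: `a` is killed at once, and `a*` is sent into the image of `kQ`,
which `hamiltonian_toDouble` kills. -/
theorem hamiltonian_sq_zero (x : PathAlg k Q.double) :
    (hamiltonian W).1 ((hamiltonian W).1 x) = 0 := by
  refine sder_sq_zero _ (fun b => ?_) x
  rcases b with a | a
  · exact (congrArg _ (hamiltonian_arr W a)).trans (map_zero _)
  · exact (congrArg _ (hamiltonian_arrStar W a)).trans (hamiltonian_toDouble W _)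

end Hamiltonian

variable [Fintype E]

theorem quiverMoment_mem : quiverMoment k Q ∈ deg k V (PathAlg k Q.double) (-1) :=
  Submodule.sum_mem _ fun a _ => sub_mem (arr_mul_arrStar_mem a) (arrStar_mul_arr_mem a)

theorem vert_mul_quiverMoment (i : V) :
    vert k Q.double i * quiverMoment k Q = quiverMoment k Q * vert k Q.double i := by
  rw [quiverMoment, Finset.mul_sum, Finset.sum_mul]
  refine Finset.sum_congr rfl fun a _ => ?_
  rw [mul_sub, sub_mul, vert_mul_comm (j := Q.tgt a), vert_mul_comm (j := Q.src a)]
  · rw [← mul_assoc, src_mul_arrStar]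
  · rw [mul_assoc, arr_mul_src]
  · rw [← mul_assoc, tgt_mul_arr]
  · rw [mul_assoc, arrStar_mul_tgt]

/-- Inserting `δ(a*)` around `D a` gives `(D a) a* - a* (D a)`, and inserting `δ(a)` around `D a*`
gives `(D a*) a - a (D a*)`. Their difference is the Leibniz expansion of `D [a, a*]`. In each of
the four terms either the moved factor or what it passes has degree zero, so no sign appears. -/
theorem iota_delta_quiverForm [CharZero k] [DecidableEq V] :
    DR.iota (delta k V (PathAlg k Q.double)) (quiverForm k Q) =
      Omega.dA k V _ (quiverMoment k Q) := by
  rw [iota_quiverForm, quiverMoment, map_sum]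
  refine Finset.sum_congr rfl fun a _ => ?_
  have h1 := delta_arrow (k := k) (Q := Q.double) (Sum.inl a)
  have h2 := delta_arrow (k := k) (Q := Q.double) (Sum.inr a)
  have e1 := tgt_mul_dA (k := k) (Q := Q) (Sum.inl a)
  have e2 := tgt_mul_dA (k := k) (Q := Q) (Sum.inr a)
  have e3 := dA_mul_src (k := k) (Q := Q) (Sum.inl a)
  have e4 := dA_mul_src (k := k) (Q := Q) (Sum.inr a)
  rw [src_inl, tgt_inl] at h1
  rw [src_inr, tgt_inr] at h2
  rw [tgt_inl] at e1
  rw [tgt_inr] at e2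
  rw [src_inl] at e3
  rw [src_inr] at e4
  change _ = arr k Q a ⊗ₜ[k] _ - _ ⊗ₜ[k] arr k Q a at h1
  change _ = arrStar k Q a ⊗ₜ[k] _ - _ ⊗ₜ[k] arrStar k Q a at h2
  change _ * Omega.dA k V _ (arr k Q a) = Omega.dA k V _ (arr k Q a) at e1
  change _ * Omega.dA k V _ (arrStar k Q a) = Omega.dA k V _ (arrStar k Q a) at e2
  change Omega.dA k V _ (arr k Q a) * _ = Omega.dA k V _ (arr k Q a) at e3
  change Omega.dA k V _ (arrStar k Q a) * _ = Omega.dA k V _ (arrStar k Q a) at e4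
  change (delta k V (PathAlg k Q.double)).1 (arr k Q a) = _ at h1
  change (delta k V (PathAlg k Q.double)).1 (arrStar k Q a) = _ at h2
  rw [h1, h2, map_sub, map_sub,
    Omega.insert_tmul (arr_mem a) (arrStar_mem a) (vert_mem_deg _),
    Omega.insert_tmul (arr_mem a) (vert_mem_deg _) (arrStar_mem a),
    Omega.insert_tmul (arrStar_mem a) (arr_mem a) (vert_mem_deg _),
    Omega.insert_tmul (arrStar_mem a) (vert_mem_deg _) (arr_mem a),
    map_sub, Omega.dA_mul, Omega.dA_mul, e1, e2, mul_assoc, e3, mul_assoc, e4]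
  simp only [add_zero, mul_zero, zero_mul, zpow_zero, one_smul]
  abel

/-- Two elements with the same differential differ by an element of `R`, by `dA_eq_zero_iff`. The
class commutes with `R` since `w` itself is a sum of closed paths. -/
theorem quiverMoment_represents [CharZero k] [DecidableEq V] :
    RepresentsMoment (quiverForm k Q) (quiverMoment k Q) := by
  refine ⟨fun r => ?_, fun a => ?_⟩
  · rw [str_mul_comm vert_mul_quiverMoment, sub_self]
    exact zero_mem _
  · rw [iota_delta_quiverForm, ← dA_eq_zero_iff, map_sub, sub_eq_zero]

variable [DecidableEq E]

/-- Noncommutative chain rule. Both sides are derivations along the inclusion of `kQ` into forms,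
and on an arrow the right side reduces to `e_{t(a)} (D a) e_{s(a)}`. -/
theorem dA_toDouble (x : PathAlg k Q.plain) :
    Omega.dA k V _ (toDouble k Q x) = ∑ a, sandwichD a (partialDer a x) := by
  have hT : ∀ (a : E) z (y : PathAlg k Q.plain), sandwichD a (z * (1 ⊗ₜ[k] y)) =
      sandwichD a z * Omega.inA k V _ (toDouble k Q y) := by
    intro a z y
    induction z using TensorProduct.induction_on with
    | zero => simp
    | add z z' h h' => simp only [add_mul, map_add, h, h']
    | tmul p q => simp [sandwichD, mul_assoc]
  have hT' : ∀ (a : E) z (y : PathAlg k Q.plain), sandwichD a ((y ⊗ₜ[k] 1) * z) =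
      Omega.inA k V _ (toDouble k Q y) * sandwichD a z := by
    intro a z y
    induction z using TensorProduct.induction_on with
    | zero => simp
    | add z z' h h' => simp only [mul_add, map_add, h, h']
    | tmul p q => simp [sandwichD, mul_assoc]
  have key : Omega.dA k V _ ∘ₗ (toDouble k Q).toLinearMap =
      ∑ a, sandwichD a ∘ₗ partialDer a := by
    refine leibniz_ext (f := (Omega.inA k V _).comp (toDouble k Q))
      (g := (Omega.inA k V _).comp (toDouble k Q)) (fun x y => ?_) (fun x y => ?_) (fun i => ?_)
      (fun a => ?_)
    · simp [Omega.dA_mul]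
    · simp only [LinearMap.sum_apply, LinearMap.comp_apply, Finset.sum_mul, Finset.mul_sum,
        ← Finset.sum_add_distrib]
      refine Finset.sum_congr rfl fun a _ => ?_
      rw [partialDer, der_mul, map_add, Algebra.TensorProduct.includeLeft_apply,
        Algebra.TensorProduct.includeRight_apply, hT, hT']
      rfl
    · simp [LinearMap.sum_apply, partialDer, toDouble_vert, dA_vert]
    · rw [LinearMap.sum_apply, Finset.sum_eq_single a]
      · have h := dA_arrow (k := k) (Q := Q.double) (Sum.inl a)
        rw [LinearMap.comp_apply, LinearMap.comp_apply, partialDer, der_arrow]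
        simp only [AlgHom.toLinearMap_apply, toDouble_arrow, if_true]
        simp only [sandwichD, mul_one, Algebra.TensorProduct.includeLeft_apply,
          Algebra.TensorProduct.includeRight_apply, Algebra.TensorProduct.tmul_mul_tmul, one_mul,
          LinearMap.comp_apply, TensorProduct.map_tmul, LinearMap.mulRight_apply,
          LinearMap.mul'_apply, AlgHom.toLinearMap_apply, AlgHom.comp_apply, toDouble_vert]
        exact h.symm
      · intro b _ hb
        simp [partialDer, hb.symm]
      · simp
  have h := DFunLike.congr_fun key x
  simpa [LinearMap.sum_apply] using h

/-- The differential of a potential, in terms of its cyclic derivatives. -/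
theorem mk_dA_toDouble (x : PathAlg k Q.plain) : DR.mk k V _ (Omega.dA k V _ (toDouble k Q x)) =
    DR.mk k V _ (∑ a, Omega.inA k V _ (toDouble k Q (cyclicDer a x)) *
      Omega.dA k V _ (arr k Q a)) := by
  rw [dA_toDouble, map_sum, map_sum]
  exact Finset.sum_congr rfl fun a _ => mk_sandwichD a _

variable (W : Potential k Q)

/-- Only the coefficients `ξ(a*) = ∂W/∂a` of `D a` survive in `i_ξ(ω)`, and these are the
coefficients of `D W`. -/
theorem contr_hamiltonian (x : PathAlg k Q.plain) :
    DR.contr (hamiltonian (Potential.mk k Q x)) (quiverForm k Q) =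
      DR.D k V _ (DR.mk k V _ (Omega.inA k V _ (toDouble k Q x))) := by
  rw [contr_quiverForm, DR.D_mk, Omega.D_inA, mk_dA_toDouble]
  congr 1
  refine Finset.sum_congr rfl fun a _ => ?_
  rw [hamiltonian_arr, hamiltonian_arrStar, map_zero, zero_mul, sub_zero]
  rfl

/-- Since `ξ(a) = 0`, the Lie derivative is `∑ D(∂W/∂a) D a`. This is the differential of `∑ (∂W/∂a)
D a = D W`, hence zero in the cyclic quotient. -/
theorem lie_hamiltonian : DR.lie (hamiltonian W) (quiverForm k Q) = 0 := by
  obtain ⟨x, rfl⟩ := Submodule.mkQ_surjective _ W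
  have h := congrArg (DR.D k V (PathAlg k Q.double)) (mk_dA_toDouble x)
  rw [DR.D_mk, DR.D_mk, Omega.D_dA, map_zero, map_sum] at h
  rw [quiverForm, DR.lie_mk, map_sum, h]
  congr 1
  refine Finset.sum_congr rfl fun a _ => ?_
  rw [Omega.lie_mul _ (Omega.par_dA_of_mem (arrStar_mem a)), Omega.lie_dA, Omega.lie_dA,
    hamiltonian_arr, hamiltonian_arrStar, Omega.D_mul (Omega.par_inA_of_mem (toDouble_mem _)),
    Omega.D_inA, Omega.D_dA, map_zero, mul_zero, smul_zero, mul_zero, smul_zero]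
  rfl

/-- As `ξ` kills the degree-zero arrow `a`, it turns `[a, a*]` into `[a, ∂W/∂a]` without sign; the
sum vanishes by `sum_arrow_commutator_cyclicDer`. -/
theorem hamiltonian_quiverMoment : (hamiltonian W).1 (quiverMoment k Q) = 0 := by
  obtain ⟨x, rfl⟩ := Submodule.mkQ_surjective _ W
  have h := congrArg (toDouble k Q) (sum_arrow_commutator_cyclicDer (Q := Q.plain) x)
  rw [map_zero, map_sum] at h
  rw [quiverMoment, map_sum, ← h]
  refine Finset.sum_congr rfl fun a _ => ?_
  rw [map_sub, sder_mul (hamiltonian _).2, sder_mul (hamiltonian _).2, hamiltonian_arr,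
    hamiltonian_arrStar, twist_of_mem 1 (arr_mem a), map_sub, map_mul, map_mul, toDouble_arrow]
  simp
  rfl

theorem isGinzburgTriple_quiver [CharZero k] [DecidableEq V] :
    IsGinzburgTriple (-1) (quiverForm k Q) (hamiltonian W) (quiverMoment k Q) where
  nonpos n hn := deg_eq_bot (fun b => by rcases b with a | a <;> simp [deg_inl, deg_inr]) hn
  finiteType := finiteType
  projective := omega1_projective
  generated := generated_quiver
  closed := quiverForm_closed
  bisymplectic := quiverForm_bisymplectic
  sq_zero := hamiltonian_sq_zero W
  lie_zero := lie_hamiltonian W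
  moment := quiverMoment_represents
  moment_deg := quiverMoment_mem
  moment_zero := hamiltonian_quiverMoment W

end DoubleQuiver

/-! ### Universal property and grading of the free product with `R[t]`. -/

section FreeProduct

variable {k : Type u} {I : Type v} {A : Type w} [Field k] [Ring A] [Algebra k A] [GrAlg k I A]

namespace FreeProd

variable (k I A) in
/-- The projection from the tensor algebra. -/
def proj : TensorAlgebra k (A × Polynomial (I → k)) →ₐ[k] FreeProd k I A :=
  RingQuot.mkAlgHom k (Rel k I A)

theorem proj_rel {x y : TensorAlgebra k (A × Polynomial (I → k))} (h : Rel k I A x y) :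
    proj k I A x = proj k I A y := RingQuot.mkAlgHom_rel k h

variable (k I A) in
/-- The canonical homomorphism from `A` to the free product. -/
def inlHom : A →ₐ[k] FreeProd k I A :=
  AlgHom.ofLinearMap ((proj k I A).toLinearMap ∘ₗ TensorAlgebra.ι k ∘ₗ
    LinearMap.inl k A (Polynomial (I → k)))
    (by simpa using proj_rel (Rel.one (k := k) (I := I) (A := A)))
    (fun a b => by simpa using proj_rel (Rel.mul_left (k := k) (I := I) a b))

theorem inlHom_apply (a : A) : inlHom k I A a = inl k I A a := rfl

variable (k I A) in
/-- The canonical homomorphism from `R[t]` to the free product. -/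
def inrHom : Polynomial (I → k) →ₐ[k] FreeProd k I A :=
  AlgHom.ofLinearMap ((proj k I A).toLinearMap ∘ₗ TensorAlgebra.ι k ∘ₗ
    LinearMap.inr k A (Polynomial (I → k)))
    (by
      have h := proj_rel (Rel.amalg (k := k) (I := I) (A := A) 1)
      have h1 := proj_rel (Rel.one (k := k) (I := I) (A := A))
      rw [map_one, map_one, h1, map_one] at h
      exact h.symm)
    (fun f g => by simpa using proj_rel (Rel.mul_right (k := k) (A := A) f g))

theorem inrHom_X : inrHom k I A Polynomial.X = t k I A := rfl

theorem inrHom_C (r : I → k) : inrHom k I A (Polynomial.C r) = inlHom k I A (str k I A r) :=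
  (proj_rel (Rel.amalg (k := k) (I := I) (A := A) r)).symm

/-- In `R[t]` the variable commutes with the coefficients, and amalgamation identifies these with
the image of `R` in `A`. This is also why `lift` asks for a commutation hypothesis. -/
theorem inlHom_str_mul_t (r : I → k) :
    inlHom k I A (str k I A r) * t k I A = t k I A * inlHom k I A (str k I A r) := by
  rw [← inrHom_C, ← inrHom_X, ← map_mul, ← map_mul, Polynomial.X_mul_C]

section Lift

variable {B : Type*} [Ring B] [Algebra k B] (f : A →ₐ[k] B) (T : B)
  (hT : ∀ r, Commute (f (str k I A r)) T)

/-- The homomorphism `R[t] → B` given by `f` on `R` and `t ↦ T`. -/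
def polyHom : Polynomial (I → k) →ₐ[k] B :=
  Polynomial.eval₂AlgHom (f.comp (str k I A)) T hT

theorem polyHom_C (r : I → k) : polyHom f T hT (Polynomial.C r) = f (str k I A r) :=
  Polynomial.eval₂_C _ _

theorem polyHom_X : polyHom f T hT Polynomial.X = T := Polynomial.eval₂_X _ _

/-- The universal property of the free product. -/
def lift : FreeProd k I A →ₐ[k] B :=
  RingQuot.liftAlgHom k ⟨TensorAlgebra.lift k (f.toLinearMap.coprod
    (polyHom f T hT).toLinearMap), by
    rintro _ _ (_ | ⟨a, b⟩ | ⟨p, q⟩ | r)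
    · simp
    · simp
    · simp
    · simp [polyHom_C]⟩

theorem lift_inlHom (a : A) : lift f T hT (inlHom k I A a) = f a := by
  simp only [lift, inlHom, proj, AlgHom.ofLinearMap_apply, LinearMap.comp_apply]
  erw [RingQuot.liftAlgHom_mkAlgHom_apply]
  simp

theorem lift_t : lift f T hT (t k I A) = T := by
  simp only [lift, t]
  erw [RingQuot.liftAlgHom_mkAlgHom_apply]
  simp [polyHom_X]

theorem hom_ext {f g : FreeProd k I A →ₐ[k] B}
    (h : ∀ a, f (inlHom k I A a) = g (inlHom k I A a)) (ht : f (t k I A) = g (t k I A)) :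
    f = g := by
  refine RingQuot.ringQuot_ext' k f g (TensorAlgebra.hom_ext (LinearMap.prod_ext ?_ ?_))
  · exact LinearMap.ext h
  · have e : f.comp (inrHom k I A) = g.comp (inrHom k I A) := by
      refine Polynomial.algHom_ext' (AlgHom.ext fun r => ?_) ht
      change f (inrHom k I A (Polynomial.C r)) = g (inrHom k I A (Polynomial.C r))
      rw [inrHom_C, h]
    exact LinearMap.ext fun p => DFunLike.congr_fun e p

end Lift

theorem degree_mul_mem {e m n : ℤ} {x y : FreeProd k I A} (hx : x ∈ degree k I A e m)
    (hy : y ∈ degree k I A e n) : x * y ∈ degree k I A e (m + n) := by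
  refine Submodule.span_induction₂ (p := fun x y _ _ => x * y ∈ degree k I A e (m + n))
      ?_ ?_ ?_ ?_ ?_ ?_ ?_ hx hy
  · rintro _ _ ⟨l, hl, rfl, rfl⟩ ⟨l', hl', rfl, rfl⟩
    refine Submodule.subset_span ⟨l ++ l', fun y hy => ?_, by simp, by simp⟩
    rcases List.mem_append.1 hy with h | h
    · exact hl y h
    · exact hl' y h
  · simp
  · simp
  · intro x y z _ _ _ h h'
    rw [add_mul]; exact add_mem h h'
  · intro x y z _ _ _ h h'
    rw [mul_add]; exact add_mem h h'
  · intro c x y _ _ h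
    rw [smul_mul_assoc]; exact Submodule.smul_mem _ _ h
  · intro c x y _ _ h
    rw [mul_smul_comm]; exact Submodule.smul_mem _ _ h

theorem inlHom_mem_degree (e : ℤ) {m : ℤ} {a : A} (ha : a ∈ deg k I A m) :
    inlHom k I A a ∈ degree k I A e m :=
  Submodule.subset_span ⟨[(inl k I A a, m)], by simpa using Or.inl ⟨a, ha, rfl⟩, by simp, by
    simp [inlHom_apply]⟩

theorem t_mem_degree (e : ℤ) : t k I A ∈ degree k I A e e :=
  Submodule.subset_span ⟨[(t k I A, e)], by simp, by simp, by simp⟩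

end FreeProd

end FreeProduct

/-! ### The path algebra of `Q.hat` and its differential. -/

section Hat

variable {V : Type v} {E : Type w} {k : Type u} [Field k] [Fintype V] {Q : FinQuiver V E}

open PathAlg

variable (k Q) in
/-- The inclusion of the path algebra of the double quiver into that of `Q.hat`. -/
def doubleToHat : PathAlg k Q.double →ₐ[k] PathAlg k Q.hat :=
  PathAlg.map Sum.inl (fun _ => rfl) (fun _ => rfl)

theorem doubleToHat_vert (i : V) : doubleToHat k Q (vert k Q.double i) = vert k Q.hat i :=
  map_vert _ _ _ i

theorem doubleToHat_arrow (b : E ⊕ E) :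
    doubleToHat k Q (arrow k Q.double b) = arrow k Q.hat (Sum.inl b) := by
  simp [doubleToHat, PathAlg.map]

theorem doubleToHat_arr (a : E) : doubleToHat k Q (arr k Q a) = hatArr k Q a :=
  doubleToHat_arrow _

theorem doubleToHat_arrStar (a : E) : doubleToHat k Q (arrStar k Q a) = hatStar k Q a :=
  doubleToHat_arrow _

theorem doubleToHat_str (r : V → k) : doubleToHat k Q (str k V _ r) = str k V _ r := by
  simp [str_apply, doubleToHat_vert]

theorem doubleToHat_toDouble (x : PathAlg k Q.plain) :
    doubleToHat k Q (toDouble k Q x) = toHat k Q x := by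
  have h : (doubleToHat k Q).comp (toDouble k Q) = toHat k Q := by
    refine PathAlg.hom_ext (fun i => ?_) (fun a => ?_)
    · rw [AlgHom.comp_apply, toDouble_vert, doubleToHat_vert]
      exact (map_vert _ _ _ i).symm
    · rw [AlgHom.comp_apply, toDouble_arrow, doubleToHat_arr]
      simp [toHat, PathAlg.map, hatArr]
  exact DFunLike.congr_fun h x

theorem doubleToHat_mem {n : ℤ} {x : PathAlg k Q.double}
    (hx : x ∈ deg k V (PathAlg k Q.double) n) :
    doubleToHat k Q x ∈ deg k V (PathAlg k Q.hat) n := by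
  refine Submodule.span_induction ?_ ?_ ?_ ?_ hx
  · rintro _ ⟨i, l, rfl, rfl⟩
    refine Submodule.subset_span ⟨i, l.map Sum.inl, ?_, ?_⟩
    · rw [List.map_map]; rfl
    · rw [map_mul, doubleToHat_vert, word, word, map_list_prod, List.map_map, List.map_map]
      congr 2
      exact List.map_congr_left fun b _ => doubleToHat_arrow b
  · simp
  · intro x y _ _ hx hy
    rw [map_add]; exact add_mem hx hy
  · intro c x _ hx
    rw [map_smul]; exact Submodule.smul_mem _ _ hx

theorem doubleToHat_twist (n : ℤ) (x : PathAlg k Q.double) :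
    doubleToHat k Q (twist k V _ n x) = twist k V _ n (doubleToHat k Q x) := by
  induction x using DirectSum.Decomposition.inductionOn (deg k V (PathAlg k Q.double)) with
  | zero => simp
  | homogeneous x => rw [twist_of_mem n x.2, twist_of_mem n (doubleToHat_mem x.2), map_smul]
  | add x y hx hy => simp only [map_add, hx, hy]

theorem hatLoop_mem (i : V) : hatLoop k Q i ∈ deg k V (PathAlg k Q.hat) (-2) :=
  arrow_mem_deg (Q := Q.hat) (Sum.inr i)

theorem vert_mul_hatLoop (i : V) : vert k Q.hat i * hatLoop k Q i = hatLoop k Q i :=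
  tgt_mul k Q.hat (Sum.inr i)

theorem hatLoop_mul_vert (i : V) : hatLoop k Q i * vert k Q.hat i = hatLoop k Q i :=
  mul_src k Q.hat (Sum.inr i)

/-- The single element `t = ∑ t_j` still contains each loop as `t_i = e_i t`. With the mirror
statement it follows that `t` commutes with `R`, as the free product requires. -/
theorem vert_mul_sum_hatLoop (i : V) : vert k Q.hat i * ∑ j, hatLoop k Q j = hatLoop k Q i := by
  rw [Finset.mul_sum, Finset.sum_eq_single i, vert_mul_hatLoop]
  · intro j _ hj
    exact tgt_mul_of_ne (Q := Q.hat) (a := Sum.inr j) (Ne.symm hj)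
  · simp

theorem sum_hatLoop_mul_vert (i : V) : (∑ j, hatLoop k Q j) * vert k Q.hat i = hatLoop k Q i := by
  rw [Finset.sum_mul, Finset.sum_eq_single i, hatLoop_mul_vert]
  · intro j _ hj
    exact arrow_mul_of_ne k Q.hat (a := Sum.inr j) hj
  · simp

/-! ### The path algebra of `Q.hat` as a free product -/

variable (k Q) in
/-- The homomorphism from the free product to the path algebra of `Q.hat`, with
`t ↦ ∑ i, t_i`. -/
def freeProdToHat : FreeProd k V (PathAlg k Q.double) →ₐ[k] PathAlg k Q.hat :=
  FreeProd.lift (doubleToHat k Q) (∑ i, hatLoop k Q i) (fun r => by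
    rw [doubleToHat_str]
    exact str_mul_comm (fun i => by rw [vert_mul_sum_hatLoop, sum_hatLoop_mul_vert]) r)

theorem inlHom_vert_mul_t (i : V) :
    FreeProd.inlHom k V _ (vert k Q.double i) * FreeProd.t k V _ =
      FreeProd.t k V _ * FreeProd.inlHom k V _ (vert k Q.double i) := by
  obtain ⟨r, hr⟩ := vert_mem_range (k := k) (Q := Q.double) i
  rw [← hr]
  exact FreeProd.inlHom_str_mul_t r

variable (k Q) in
/-- The homomorphism from the path algebra of `Q.hat` to the free product, with
`t_i ↦ e_i t`. -/
def hatToFreeProd : PathAlg k Q.hat →ₐ[k] FreeProd k V (PathAlg k Q.double) :=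
  PathAlg.lift (fun i => FreeProd.inlHom k V _ (vert k Q.double i))
    (Sum.elim (fun b => FreeProd.inlHom k V _ (arrow k Q.double b))
      fun i => FreeProd.inlHom k V _ (vert k Q.double i) * FreeProd.t k V _)
    (by rw [← map_sum, sum_vert, map_one])
    (fun i => by rw [← map_mul, vert_mul_self])
    (fun i j h => by rw [← map_mul, vert_mul_of_ne k _ h, map_zero])
    (fun b => by
      rcases b with b | i
      · exact (map_mul _ _ _).symm.trans (congrArg _ (tgt_mul k Q.double b))
      · change FreeProd.inlHom k V _ (vert k Q.double i) *
          (FreeProd.inlHom k V _ (vert k Q.double i) * _) = _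
        rw [← mul_assoc, ← map_mul, vert_mul_self]; rfl)
    (fun b => by
      rcases b with b | i
      · exact (map_mul _ _ _).symm.trans (congrArg _ (mul_src k Q.double b))
      · change FreeProd.inlHom k V _ (vert k Q.double i) * _ *
          FreeProd.inlHom k V _ (vert k Q.double i) = _
        rw [mul_assoc, ← inlHom_vert_mul_t, ← mul_assoc, ← map_mul, vert_mul_self]; rfl)

theorem freeProdToHat_inlHom (x : PathAlg k Q.double) :
    freeProdToHat k Q (FreeProd.inlHom k V _ x) = doubleToHat k Q x :=
  FreeProd.lift_inlHom _ _ _ x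

theorem freeProdToHat_t : freeProdToHat k Q (FreeProd.t k V _) = ∑ i, hatLoop k Q i :=
  FreeProd.lift_t _ _ _

theorem hatToFreeProd_vert (i : V) :
    hatToFreeProd k Q (vert k Q.hat i) = FreeProd.inlHom k V _ (vert k Q.double i) :=
  PathAlg.lift_vert _ _ _ _ _ _ _ i

theorem hatToFreeProd_arrow (b : E ⊕ E) : hatToFreeProd k Q (arrow k Q.hat (Sum.inl b)) =
    FreeProd.inlHom k V _ (arrow k Q.double b) :=
  PathAlg.lift_arrow _ _ _ _ _ _ _ (Sum.inl b)

theorem hatToFreeProd_hatLoop (i : V) : hatToFreeProd k Q (hatLoop k Q i) =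
    FreeProd.inlHom k V _ (vert k Q.double i) * FreeProd.t k V _ :=
  PathAlg.lift_arrow _ _ _ _ _ _ _ (Sum.inr i)

variable (k Q) in
/-- The isomorphism between the free product `k Q.double *_R R[t]` and the path algebra of
`Q.hat`. -/
def freeProdEquivHat : FreeProd k V (PathAlg k Q.double) ≃ₐ[k] PathAlg k Q.hat :=
  AlgEquiv.ofAlgHom (freeProdToHat k Q) (hatToFreeProd k Q)
    (PathAlg.hom_ext
      (fun i => by
        rw [AlgHom.comp_apply, hatToFreeProd_vert, freeProdToHat_inlHom, doubleToHat_vert]; rfl)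
      (fun b => by
        rcases b with b | i
        · rw [AlgHom.comp_apply, hatToFreeProd_arrow, freeProdToHat_inlHom, doubleToHat_arrow]; rfl
        · refine (congrArg (freeProdToHat k Q) (hatToFreeProd_hatLoop i)).trans ?_
          rw [map_mul, freeProdToHat_inlHom, doubleToHat_vert, freeProdToHat_t,
            vert_mul_sum_hatLoop]
          rfl))
    (FreeProd.hom_ext
      (fun x => by
        have h : ((hatToFreeProd k Q).comp (doubleToHat k Q)) = FreeProd.inlHom k V _ :=
          PathAlg.hom_ext
            (fun i => by rw [AlgHom.comp_apply, doubleToHat_vert, hatToFreeProd_vert])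
            (fun b => by rw [AlgHom.comp_apply, doubleToHat_arrow, hatToFreeProd_arrow])
        rw [AlgHom.comp_apply, freeProdToHat_inlHom]
        exact DFunLike.congr_fun h x)
      -- On `t` the composite gives `∑ e_i t = t`.
      (by
        rw [AlgHom.comp_apply, freeProdToHat_t, map_sum]
        simp only [hatToFreeProd_hatLoop]
        rw [← Finset.sum_mul, ← map_sum, sum_vert, map_one, one_mul]
        rfl))

theorem freeProdEquivHat_inl (x : PathAlg k Q.double) :
    freeProdEquivHat k Q (FreeProd.inl k V _ x) = doubleToHat k Q x :=
  freeProdToHat_inlHom x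

theorem freeProdEquivHat_t : freeProdEquivHat k Q (FreeProd.t k V _) = ∑ i, hatLoop k Q i :=
  freeProdToHat_t

theorem hatToFreeProd_mem_degree {n : ℤ} {x : PathAlg k Q.hat}
    (hx : x ∈ deg k V (PathAlg k Q.hat) n) :
    hatToFreeProd k Q x ∈ FreeProd.degree k V (PathAlg k Q.double) (-2) n := by
  refine Submodule.span_induction ?_ ?_ ?_ ?_ hx
  · rintro _ ⟨i, l, rfl, rfl⟩
    have h : hatToFreeProd k Q (word k Q.hat l) ∈
        FreeProd.degree k V (PathAlg k Q.double) (-2) (l.map Q.hat.deg).sum := by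
      clear hx
      induction l with
      | nil =>
        have h1 : (1 : PathAlg k Q.double) ∈ deg k V (PathAlg k Q.double) 0 :=
          SetLike.GradedOne.one_mem
        simpa [word] using FreeProd.inlHom_mem_degree (-2) h1
      | cons b l ih =>
        have e : word k Q.hat (b :: l) = arrow k Q.hat b * word k Q.hat l := by simp [word]
        rw [e, map_mul, List.map_cons, List.sum_cons]
        refine FreeProd.degree_mul_mem ?_ ih
        rcases b with b | i
        · rw [hatToFreeProd_arrow]
          exact FreeProd.inlHom_mem_degree (-2) (arrow_mem_deg b)
        · have h := FreeProd.degree_mul_mem (FreeProd.inlHom_mem_degree (-2)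
            (vert_mem_deg (k := k) (Q := Q.double) i)) (FreeProd.t_mem_degree (-2))
          rw [zero_add, ← hatToFreeProd_hatLoop] at h
          exact h
    have h' := FreeProd.degree_mul_mem (FreeProd.inlHom_mem_degree (-2)
      (vert_mem_deg (k := k) (Q := Q.double) i)) h
    rwa [zero_add, ← hatToFreeProd_vert, ← map_mul] at h'
  · simp
  · intro x y _ _ hx hy
    rw [map_add]; exact add_mem hx hy
  · intro c x _ hx
    rw [map_smul]; exact Submodule.smul_mem _ _ hx

theorem freeProdToHat_mem_deg {n : ℤ} {x : FreeProd k V (PathAlg k Q.double)}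
    (hx : x ∈ FreeProd.degree k V (PathAlg k Q.double) (-2) n) :
    freeProdToHat k Q x ∈ deg k V (PathAlg k Q.hat) n := by
  refine Submodule.span_induction ?_ ?_ ?_ ?_ hx
  · rintro _ ⟨l, hl, rfl, rfl⟩
    clear hx
    induction l with
    | nil => simpa using (SetLike.GradedOne.one_mem : (1 : PathAlg k Q.hat) ∈ deg k V _ 0)
    | cons y l ih =>
      rw [List.map_cons, List.map_cons, List.sum_cons, List.prod_cons, map_mul]
      refine SetLike.mul_mem_graded ?_ (ih fun z hz => hl z (List.mem_cons_of_mem _ hz))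
      rcases hl y List.mem_cons_self with ⟨a, ha, hy⟩ | ⟨hy, hy'⟩
      · rw [hy, ← FreeProd.inlHom_apply, freeProdToHat_inlHom]
        exact doubleToHat_mem ha
      · rw [hy, hy', freeProdToHat_t]
        exact Submodule.sum_mem _ fun i _ => hatLoop_mem i
  · simp
  · intro x y _ _ hx hy
    rw [map_add]; exact add_mem hx hy
  · intro c x _ hx
    rw [map_smul]; exact Submodule.smul_mem _ _ hx

/-- Each of the two mutually inverse homomorphisms preserves degrees on generators, hence on
products; this gives the two inclusions. -/
theorem map_degree_freeProdEquivHat (n : ℤ) :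
    (FreeProd.degree k V (PathAlg k Q.double) (-2) n).map (freeProdEquivHat k Q).toLinearMap =
      deg k V (PathAlg k Q.hat) n := by
  refine le_antisymm ?_ fun x hx => ?_
  · rintro _ ⟨x, hx, rfl⟩
    exact freeProdToHat_mem_deg hx
  · exact ⟨_, hatToFreeProd_mem_degree hx, (freeProdEquivHat k Q).apply_symm_apply x⟩

/-! ### The differential -/

variable [Fintype E]

theorem doubleToHat_quiverMoment : doubleToHat k Q (quiverMoment k Q) =
    ∑ a, (hatArr k Q a * hatStar k Q a - hatStar k Q a * hatArr k Q a) := by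
  simp only [quiverMoment, map_sum, map_sub, map_mul, doubleToHat_arr, doubleToHat_arrStar]

variable [DecidableEq E] (W : Potential k Q)

theorem gammaD_mem : gammaD W ∈ sder k V (PathAlg k Q.hat) 1 := by
  -- `gammaD` is the underlying map of this `sderOf`, so only the degrees of the values remain: `-1
  -- + 1` on `a*` and `-2 + 1` on `t_i`, read off in the double quiver.
  refine (sderOf (Q := Q.hat) 1 (Sum.elim (Sum.elim 0 fun a => toHat k Q (W.deriv a))
      fun _ => ∑ a, (hatArr k Q a * hatStar k Q a - hatStar k Q a * hatArr k Q a)) ?_).2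
  rintro ((a | a) | i)
  · exact zero_mem _
  · change toHat k Q (W.deriv a) ∈ deg k V (PathAlg k Q.hat) (-1 + 1)
    rw [← doubleToHat_toDouble]
    exact doubleToHat_mem (toDouble_mem _)
  · change ∑ a, (hatArr k Q a * hatStar k Q a - hatStar k Q a * hatArr k Q a) ∈
      deg k V (PathAlg k Q.hat) (-2 + 1)
    rw [← doubleToHat_quiverMoment]
    exact doubleToHat_mem quiverMoment_mem

/-- The inclusion preserves degrees and so commutes with the parity twist. Both composites are then
derivations along the same pair and need only be compared on `a` and `a*`. -/
theorem gammaD_doubleToHat (x : PathAlg k Q.double) :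
    gammaD W (doubleToHat k Q x) = doubleToHat k Q ((hamiltonian W).1 x) := by
  have h : gammaD W ∘ₗ (doubleToHat k Q).toLinearMap =
      (doubleToHat k Q).toLinearMap ∘ₗ (hamiltonian W).1 := by
    refine leibniz_ext (f := (doubleToHat k Q).comp (twist k V _ 1)) (g := doubleToHat k Q)
      (fun x y => ?_) (fun x y => ?_) (fun i => ?_) (fun b => ?_)
    · simp only [LinearMap.comp_apply, AlgHom.toLinearMap_apply, map_mul, AlgHom.comp_apply,
        sder_mul (gammaD_mem W), doubleToHat_twist]
    · simp only [LinearMap.comp_apply, AlgHom.toLinearMap_apply, map_mul, AlgHom.comp_apply,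
        sder_mul (hamiltonian W).2, map_add]
    · simp only [LinearMap.comp_apply, AlgHom.toLinearMap_apply, doubleToHat_vert,
        apply_vert_eq_zero (hamiltonian W).2.1, apply_vert_eq_zero (gammaD_mem W).1, map_zero]
    · simp only [LinearMap.comp_apply, AlgHom.toLinearMap_apply, doubleToHat_arrow]
      rcases b with a | a
      · refine (gammaD_arr W a).trans ?_
        exact ((congrArg _ (hamiltonian_arr W a)).trans (map_zero _)).symm
      · refine (gammaD_star W a).trans ?_
        exact ((congrArg _ (hamiltonian_arrStar W a)).trans (doubleToHat_toDouble _)).symm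
  exact DFunLike.congr_fun h x

theorem gammaD_hatLoop (i : V) : gammaD W (hatLoop k Q i) =
    doubleToHat k Q (vert k Q.double i * quiverMoment k Q * vert k Q.double i) := by
  rw [gammaD_loop, ← doubleToHat_quiverMoment, map_mul, map_mul, doubleToHat_vert]

/-- On the double quiver this is `ξ² = 0`. On the loops it is the moment condition: `d t_i = e_i w
e_i` and `ξ(e_i w e_i) = e_i ξ(w) e_i = 0`. -/
theorem gammaD_sq_zero (x : PathAlg k Q.hat) : gammaD W (gammaD W x) = 0 := by
  refine sder_sq_zero ⟨gammaD W, gammaD_mem W⟩ (fun b => ?_) x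
  change gammaD W (gammaD W (arrow k Q.hat b)) = 0
  rcases b with b | i
  · rw [← doubleToHat_arrow, gammaD_doubleToHat, gammaD_doubleToHat, hamiltonian_sq_zero, map_zero]
  · refine (congrArg _ (gammaD_hatLoop W i)).trans ?_
    rw [gammaD_doubleToHat, sder_mul (hamiltonian W).2, sder_mul (hamiltonian W).2,
      hamiltonian_quiverMoment, apply_vert_eq_zero (hamiltonian W).2.1]
    simp

theorem isGinzburgIso_quiver :
    IsGinzburgIso (-1) (hamiltonian W) (quiverMoment k Q) (gammaD W) (freeProdEquivHat k Q) where
  map_str r := (freeProdEquivHat_inl _).trans (doubleToHat_str r)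
  map_degree := map_degree_freeProdEquivHat
  superder := gammaD_mem W
  sq_zero := gammaD_sq_zero W
  d_inl x := by rw [freeProdEquivHat_inl, freeProdEquivHat_inl, gammaD_doubleToHat]
  d_t := by
    rw [freeProdEquivHat_t, freeProdEquivHat_inl, map_sum]
    simp only [gammaD_hatLoop]
    -- The differentials of the loops add up to `∑ e_i w e_i`, which is `w` because `w` commutes
    -- with the idempotents.
    rw [← map_sum, sum_vert_mul_vert vert_mul_quiverMoment]

end Hat

end NCForms

end

open NCForms in
theorem mainTheorem7 {k V E : Type*} [Field k] [CharZero k] [Fintype V] [DecidableEq V] [Fintype E]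
    [DecidableEq E] (Q : FinQuiver V E) (W : Potential k Q) :
    ∃ ξ : sder k V (PathAlg k Q.double) 1,
      IsGinzburgTriple (-1) (quiverForm k Q) ξ (quiverMoment k Q) ∧
      IsSymplectic (quiverForm k Q) ∧
      (∀ W₀ : PathAlg k Q.plain, Potential.mk k Q W₀ = W →
        contrForm (quiverForm k Q) (DirectSum.lof k ℤ _ 1 ξ) =
          DR.D k V _ (DR.mk k V _ (Omega.inA k V _ (toDouble k Q W₀)))) ∧
      (∀ a : E, ξ.1 (arr k Q a) = 0 ∧ ξ.1 (arrStar k Q a) = toDouble k Q (W.deriv a)) ∧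
      ∃ φ : FreeProd k V (PathAlg k Q.double) ≃ₐ[k] PathAlg k Q.hat,
        IsGinzburgIso (-1) ξ (quiverMoment k Q) (gammaD W) φ ∧
        (∀ a : E, φ (FreeProd.inl k V _ (arr k Q a)) = hatArr k Q a ∧
          φ (FreeProd.inl k V _ (arrStar k Q a)) = hatStar k Q a) ∧
        φ (FreeProd.t k V _) = ∑ i, hatLoop k Q i := by
  refine ⟨hamiltonian W, isGinzburgTriple_quiver W, quiverForm_symplectic, ?_,
    fun a => ⟨hamiltonian_arr W a, hamiltonian_arrStar W a⟩, freeProdEquivHat k Q,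
    isGinzburgIso_quiver W, fun a => ⟨?_, ?_⟩, freeProdEquivHat_t⟩
  -- `D W` is computed from an arbitrary representative `W₀` of the potential in `kQ`.
  · rintro W₀ rfl
    rw [contrForm_lof, contr_hamiltonian]
  · rw [freeProdEquivHat_inl, doubleToHat_arr]
  · rw [freeProdEquivHat_inl, doubleToHat_arrStar]
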